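/- Let $K$ be a field of characteristic $0$; all representations are algebraic representations over $K$. Let $J=\begin{pmatrix}&&&1\\&&1&\\&-1&&\\-1&&&\end{pmatrix}$, let $\mathrm{GSp}_4=\{(g,\mu)\in \mathrm{GL}_4\times \mathrm{GL}_1 : g^tJg=\mu J\}$ with multiplier $\mu\colon \mathrm{GSp}_4\to \mathrm{GL}_1$, and put $G=\mathrm{GSp}_4\times_{\mathrm{GL}_1}\mathrm{GL}_2$ and $H=\mathrm{GL}_2\times_{\mathrm{GL}_1}\mathrm{GL}_2$, the fibre products being taken over $\mu$ and $\det$. Write also $\mu$ for the character $(g,h)\mapsto\det g=\det h$ of $H$. Let $\iota\colon H\hookrightarrow G$ be the embedding $$\left(\begin{pmatrix}a&b\\c&d\end{pmatrix},\begin{pmatrix}a'&b'\\c'&d'\end{pmatrix}\right)\mapsto\left(\begin{pmatrix}a&&&b\\&a'&b'&\\&c'&d'&\\c&&&d\end{pmatrix},\begin{pmatrix}a'&b'\\c'&d'\end{pmatrix}\right).$$ For integers $k\ge 0$ let $\mathrm{Sym}^k$ be the $k$-th symmetric power of the standard representation of $\mathrm{GL}_2$. For integers $a,b\geq 0$ let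 $V^{a,b}$ be the (existing, and unique up to isomorphism) irreducible algebraic representation of $\mathrm{GSp}_4$ with highest weight $(a+b)\chi_1+a\chi_2$ with respect to the upper triangular Borel subgroup, where $\chi_i$ is the $i$-th diagonal entry. For $c\ge 0$ put $W^{a,b,c}=V^{a,b}\boxtimes \mathrm{Sym}^c$, a representation of $G$. Then for all integers $a,b,c\ge0$: 1. As representations of $H$, $$\iota^*(W^{a,b,c})\cong\bigoplus_{q=0}^{a}\ \bigoplus_{r=0}^{b}\ \bigoplus_{j=0}^{\min(a-q+r,\,c)}\left(\mathrm{Sym}^{a+b-q-r}\boxtimes \mathrm{Sym}^{a-q+r+c-2j}\right)\otimes\mu^{j+q}.$$ 2. $\iota^*(W^{a,b,c})$ has an irreducible $H$-subrepresentation isomorphic to $(\mathrm{Sym}^d\otimes\mu^e)\boxtimes 1$ for some integers $d\ge0$ and $e$ if and only if $c\le a+b$. 3. If $c\le a+b$, the irreducible $H$-subrepresentations of $\iota^*(W^{a,b,c})$ of this form are exactly $$(\mathrm{Sym}^{b+c-2r}\otimes\mu^{a+r})\boxtimes 1,\qquad r\in\mathbb Z,\quad \max(0,-a+c)\le r\le\min(b,c),$$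 and for each such $r$ there is exactly one subrepresentation isomorphic to it. -/

import Mathlib

open scoped MatrixGroups TensorProduct DirectSum

noncomputable section

namespace GSpBranching

/-! ### The groups -/

section Groups

variable (K : Type*) [Field K]

/-- The antidiagonal skew-symmetric form defining `GSp₄`. -/
def J : Matrix (Fin 4) (Fin 4) K :=
  !![0, 0, 0, 1;
     0, 0, 1, 0;
     0, -1, 0, 0;
     -1, 0, 0, 0]

/-- `GSp₄(K)`: the pairs `(g, μ)` in `GL₄(K) × Kˣ` with `gᵀ J g = μ J`. -/
def GSp4 : Subgroup (GL (Fin 4) K × Kˣ) where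
  carrier := {x | (x.1 : Matrix (Fin 4) (Fin 4) K).transpose * J K * (x.1 : Matrix (Fin 4) (Fin 4) K)
    = (x.2 : K) • J K}
  one_mem' := by simp
  mul_mem' := by
    intro x y hx hy
    simp only [Set.mem_ofPred_eq] at hx hy ⊢
    calc ((x * y).1 : Matrix (Fin 4) (Fin 4) K).transpose * J K
            * ((x * y).1 : Matrix (Fin 4) (Fin 4) K)
        = (y.1 : Matrix (Fin 4) (Fin 4) K).transpose
            * ((x.1 : Matrix (Fin 4) (Fin 4) K).transpose * J K
              * (x.1 : Matrix (Fin 4) (Fin 4) K)) * (y.1 : Matrix (Fin 4) (Fin 4) K) := by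
          simp [Matrix.transpose_mul, Matrix.mul_assoc]
      _ = ((x * y).2 : K) • J K := by
          rw [hx]
          simp [hy, smul_smul]
  inv_mem' := by
    intro x hx
    simp only [Set.mem_ofPred_eq] at hx ⊢
    have h1 : (x.1 : Matrix (Fin 4) (Fin 4) K) * ((x⁻¹).1 : Matrix (Fin 4) (Fin 4) K) = 1 := by
      rw [Prod.fst_inv, ← Units.val_mul, mul_inv_cancel, Units.val_one]
    have h2 : ((x⁻¹).1 : Matrix (Fin 4) (Fin 4) K).transpose
        * (x.1 : Matrix (Fin 4) (Fin 4) K).transpose = 1 := by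
      rw [← Matrix.transpose_mul, h1, Matrix.transpose_one]
    have h3 : (((x⁻¹).2 : Kˣ) : K) * (x.2 : K) = 1 := by
      rw [Prod.snd_inv, ← Units.val_mul, inv_mul_cancel, Units.val_one]
    calc ((x⁻¹).1 : Matrix (Fin 4) (Fin 4) K).transpose * J K
            * ((x⁻¹).1 : Matrix (Fin 4) (Fin 4) K)
        = (((x⁻¹).2 : Kˣ) : K) • (((x⁻¹).1 : Matrix (Fin 4) (Fin 4) K).transpose
            * ((x.2 : K) • J K) * ((x⁻¹).1 : Matrix (Fin 4) (Fin 4) K)) := by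
          rw [Matrix.mul_smul, Matrix.smul_mul, smul_smul, h3, one_smul]
      _ = (((x⁻¹).2 : Kˣ) : K) • ((((x⁻¹).1 : Matrix (Fin 4) (Fin 4) K).transpose
            * (x.1 : Matrix (Fin 4) (Fin 4) K).transpose) * J K
            * ((x.1 : Matrix (Fin 4) (Fin 4) K) * ((x⁻¹).1 : Matrix (Fin 4) (Fin 4) K))) := by
          rw [← hx]
          simp only [Matrix.mul_assoc]
      _ = (((x⁻¹).2 : Kˣ) : K) • J K := by
          rw [h1, h2, one_mul, mul_one]

/-- The symplectic multiplier `μ : GSp₄ → GL₁`. -/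
def multiplier : GSp4 K →* Kˣ := (MonoidHom.snd _ _).comp (GSp4 K).subtype

/-- The underlying `4 × 4` matrix of an element of `GSp₄(K)`. -/
def entries {K : Type*} [Field K] (g : GSp4 K) : Matrix (Fin 4) (Fin 4) K :=
  ((g : GL (Fin 4) K × Kˣ).1 : Matrix (Fin 4) (Fin 4) K)

/-- `G = GSp₄ ×_{GL₁} GL₂`, the fibre product over the multiplier and the determinant. -/
def G : Subgroup (GSp4 K × GL (Fin 2) K) :=
  ((multiplier K).comp (MonoidHom.fst _ _)).eqLocus
    (Matrix.GeneralLinearGroup.det.comp (MonoidHom.snd _ _))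

/-- `H = GL₂ ×_{GL₁} GL₂`, the fibre product over the determinants. -/
def H : Subgroup (GL (Fin 2) K × GL (Fin 2) K) :=
  (Matrix.GeneralLinearGroup.det.comp (MonoidHom.fst _ _)).eqLocus
    (Matrix.GeneralLinearGroup.det.comp (MonoidHom.snd _ _))

/-- The first projection `G → GSp₄`. -/
def G.pr₁ : G K →* GSp4 K := (MonoidHom.fst _ _).comp (G K).subtype

/-- The second projection `G → GL₂`. -/
def G.pr₂ : G K →* GL (Fin 2) K := (MonoidHom.snd _ _).comp (G K).subtype

/-- The first projection `H → GL₂`. -/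
def H.pr₁ : H K →* GL (Fin 2) K := (MonoidHom.fst _ _).comp (H K).subtype

/-- The second projection `H → GL₂`. -/
def H.pr₂ : H K →* GL (Fin 2) K := (MonoidHom.snd _ _).comp (H K).subtype

/-- The character `μ` of `H`: the common determinant of the two components. -/
def H.mu : H K →* Kˣ := Matrix.GeneralLinearGroup.det.comp (H.pr₁ K)

/-- The nested block embedding of pairs of `2 × 2` matrices in `4 × 4` matrices. -/
def block : Matrix (Fin 2) (Fin 2) K × Matrix (Fin 2) (Fin 2) K →* Matrix (Fin 4) (Fin 4) K where
  toFun x :=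
    !![x.1 0 0, 0, 0, x.1 0 1;
       0, x.2 0 0, x.2 0 1, 0;
       0, x.2 1 0, x.2 1 1, 0;
       x.1 1 0, 0, 0, x.1 1 1]
  map_one' := by
    ext i j
    fin_cases i <;> fin_cases j <;> simp
  map_mul' x y := by
    ext i j
    fin_cases i <;> fin_cases j <;> simp [Matrix.mul_apply, Fin.sum_univ_succ]

/-- The block embedding `GL₂ × GL₂ → GL₄`. -/
def blockGL : GL (Fin 2) K × GL (Fin 2) K →* GL (Fin 4) K :=
  (Units.map (block K)).comp MulEquiv.prodUnits.symm.toMonoidHom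

lemma blockGL_coe (x : GL (Fin 2) K × GL (Fin 2) K) :
    (blockGL K x : Matrix (Fin 4) (Fin 4) K) = block K (x.1, x.2) := rfl

lemma block_mem (x : H K) :
    (blockGL K (x : GL (Fin 2) K × GL (Fin 2) K), H.mu K x) ∈ GSp4 K := by
  obtain ⟨⟨g, h⟩, hx⟩ := x
  have e : (g : Matrix (Fin 2) (Fin 2) K).det = (h : Matrix (Fin 2) (Fin 2) K).det :=
    congrArg Units.val hx
  rw [Matrix.det_fin_two, Matrix.det_fin_two] at e
  change (blockGL K (g, h) : Matrix (Fin 4) (Fin 4) K).transpose * J K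
    * (blockGL K (g, h) : Matrix (Fin 4) (Fin 4) K)
    = (g : Matrix (Fin 2) (Fin 2) K).det • J K
  rw [blockGL_coe, Matrix.det_fin_two]
  ext i j
  fin_cases i <;> fin_cases j <;>
    simp [block, J, Matrix.mul_apply, Fin.sum_univ_succ] <;> first
      | ring1
      | linear_combination e
      | linear_combination -e

/-- The embedding `ι : H → G`, `(g, h) ↦ (block (g, h), h)`. -/
def iota : H K →* G K where
  toFun x := ⟨(⟨(blockGL K (x : GL (Fin 2) K × GL (Fin 2) K), H.mu K x), block_mem K x⟩,
    H.pr₂ K x), x.2⟩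
  map_one' := by
    ext1
    refine Prod.ext (Subtype.ext (Prod.ext ?_ ?_)) ?_ <;> simp
  map_mul' x y := by
    ext1
    refine Prod.ext (Subtype.ext (Prod.ext ?_ ?_)) ?_ <;> simp

end Groups

/-! ### Representations -/

section Reps

variable {K : Type*} [Field K] {Γ : Type*} [Group Γ]
  {V : Type*} [AddCommGroup V] [Module K V]

/-- The twist `ρ ⊗ χ` of a representation by a character. -/
def twist (ρ : Representation K Γ V) (χ : Γ →* Kˣ) : Representation K Γ V where
  toFun g := (χ g : K) • ρ g
  map_one' := by simp
  map_mul' g h := by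
    ext v
    simp [smul_smul, mul_comm]

/-- The endomorphism of the symmetric algebra induced by an endomorphism `f`. -/
def symMap (f : V →ₗ[K] V) : SymmetricAlgebra K V →ₐ[K] SymmetricAlgebra K V :=
  SymmetricAlgebra.lift (SymmetricAlgebra.ι K V ∘ₗ f)

variable (K V) in
/-- The `n`-th symmetric power: the degree `n` part of the symmetric algebra. -/
def SymPow (n : ℕ) : Submodule K (SymmetricAlgebra K V) :=
  LinearMap.range (SymmetricAlgebra.ι K V) ^ n

lemma symMap_mem (f : V →ₗ[K] V) (n : ℕ) (x : SymmetricAlgebra K V) (hx : x ∈ SymPow K V n) :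
    symMap f x ∈ SymPow K V n := by
  have h : Submodule.map (symMap f).toLinearMap (SymPow K V n) ≤ SymPow K V n := by
    rw [SymPow, Submodule.map_pow]
    refine pow_le_pow_left' ?_ n
    rintro _ ⟨_, ⟨v, rfl⟩, rfl⟩
    exact ⟨f v, by simp [symMap]⟩
  exact h ⟨x, hx, rfl⟩

/-- The `n`-th symmetric power of a representation. -/
def symPow (ρ : Representation K Γ V) (n : ℕ) : Representation K Γ (SymPow K V n) where
  toFun g := (symMap (ρ g)).toLinearMap.restrict (symMap_mem (ρ g) n)
  map_one' := by
    have h : symMap (ρ (1 : Γ)) = AlgHom.id K _ := by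
      apply SymmetricAlgebra.algHom_ext
      ext v
      simp [symMap]
    ext x
    change symMap (ρ 1) (x : SymmetricAlgebra K V) = x
    rw [h, AlgHom.id_apply]
  map_mul' g h := by
    have e : symMap (ρ (g * h)) = (symMap (ρ g)).comp (symMap (ρ h)) := by
      apply SymmetricAlgebra.algHom_ext
      ext v
      simp [symMap]
    ext x
    change symMap (ρ (g * h)) (x : SymmetricAlgebra K V) = symMap (ρ g) (symMap (ρ h) x)
    rw [e, AlgHom.comp_apply]

variable (K) in
/-- The standard representation of `GL₂`. -/
def std : Representation K (GL (Fin 2) K) (Fin 2 → K) where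
  toFun g := Matrix.toLin' (g : Matrix (Fin 2) (Fin 2) K)
  map_one' := by ext; simp
  map_mul' g h := by ext; simp

variable (K) in
/-- `Sym^k`, the `k`-th symmetric power of the standard representation of `GL₂`. -/
abbrev Sym (k : ℕ) : Representation K (GL (Fin 2) K) (SymPow K (Fin 2 → K) k) :=
  symPow (std K) k

/-- The external tensor product `V ⊠ W`, as a representation of `G = GSp₄ ×_{GL₁} GL₂`. -/
abbrev boxG {U : Type*} [AddCommGroup U] [Module K U]
    (π : Representation K (GSp4 K) V) (σ : Representation K (GL (Fin 2) K) U) :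
    Representation K (G K) (V ⊗[K] U) :=
  Representation.tprod (π.comp (G.pr₁ K)) (σ.comp (G.pr₂ K))

/-- The external tensor product `V ⊠ W`, as a representation of `H = GL₂ ×_{GL₁} GL₂`. -/
abbrev boxH {U : Type*} [AddCommGroup U] [Module K U]
    (ρ : Representation K (GL (Fin 2) K) V) (σ : Representation K (GL (Fin 2) K) U) :
    Representation K (H K) (V ⊗[K] U) :=
  Representation.tprod (ρ.comp (H.pr₁ K)) (σ.comp (H.pr₂ K))

variable (K) in
/-- The ring of regular functions on `GSp₄`, as functions on `K`-points: it is generated by the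
matrix entries and the inverse of the multiplier. -/
def regularFunctions : Subalgebra K (GSp4 K → K) :=
  Algebra.adjoin K
    (Set.range (fun ij : Fin 4 × Fin 4 => fun g : GSp4 K => entries g ij.1 ij.2) ∪
      {fun g : GSp4 K => (((multiplier K g)⁻¹ : Kˣ) : K)})

/-- A finite-dimensional representation of `GSp₄` is algebraic if its matrix coefficients are
regular functions. -/
def IsAlgebraicRep (π : Representation K (GSp4 K) V) : Prop :=
  FiniteDimensional K V ∧
    ∀ (v : V) (f : Module.Dual K V), (fun g => f (π g v)) ∈ regularFunctions K

/-- `π` has highest weight `m χ₁ + n χ₂` with respect to the upper triangular Borel subgroup: some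
nonzero vector is an eigenvector of the Borel subgroup, with the character that sends an upper
triangular matrix to `(entry 1,1)^m (entry 2,2)^n`. (For irreducible `π` the line spanned by such a
vector is unique.) -/
def HasHighestWeight (π : Representation K (GSp4 K) V) (m n : ℕ) : Prop :=
  ∃ v : V, v ≠ 0 ∧ ∀ g : GSp4 K, (entries g).BlockTriangular id →
    π g v = (entries g 0 0 ^ m * entries g 1 1 ^ n) • v

/-- `π` is (a model of) `V^{a,b}`: the irreducible algebraic representation of `GSp₄` with highest
weight `(a + b) χ₁ + a χ₂`. -/
structure IsV (a b : ℕ) (π : Representation K (GSp4 K) V) : Prop where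
  algebraic : IsAlgebraicRep π
  irreducible : π.IsIrreducible
  highestWeight : HasHighestWeight π (a + b) a

/-- `ι^*(W^{a,b,c})`, where `W^{a,b,c} = V^{a,b} ⊠ Sym^c` and `π` is `V^{a,b}`. -/
abbrev iotaW (π : Representation K (GSp4 K) V) (c : ℕ) :
    Representation K (H K) (V ⊗[K] SymPow K (Fin 2 → K) c) :=
  (boxG π (Sym K c)).comp (iota K)

variable (K) in
/-- `(Sym^d ⊗ μ^e) ⊠ 1` as a representation of `H`. -/
abbrev symBoxOne (d : ℕ) (e : ℤ) :
    Representation K (H K) (SymPow K (Fin 2 → K) d ⊗[K] K) :=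
  boxH (twist (Sym K d) (Matrix.GeneralLinearGroup.det ^ e))
    (Representation.trivial K (GL (Fin 2) K) K)

/-- The indices `(q, r, j)` with `0 ≤ q ≤ a`, `0 ≤ r ≤ b`, `0 ≤ j ≤ min (a - q + r) c`. -/
abbrev Index (a b c : ℕ) : Type :=
  {x : ℕ × ℕ × ℕ // x.1 ≤ a ∧ x.2.1 ≤ b ∧ x.2.2 ≤ min (a - x.1 + x.2.1) c}

variable (K) in
/-- The summand `Sym^{a+b-q-r} ⊠ Sym^{a-q+r+c-2j} ⊗ μ^{j+q}`. In the index range all the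
subtractions are between natural numbers in the right order. -/
abbrev summand (a b c : ℕ) (x : Index a b c) :
    Representation K (H K)
      (SymPow K (Fin 2 → K) (a + b - x.1.1 - x.1.2.1) ⊗[K]
        SymPow K (Fin 2 → K) (a - x.1.1 + x.1.2.1 + c - 2 * x.1.2.2)) :=
  twist (boxH (Sym K (a + b - x.1.1 - x.1.2.1)) (Sym K (a - x.1.1 + x.1.2.1 + c - 2 * x.1.2.2)))
    (H.mu K ^ (x.1.2.2 + x.1.1))

/-- `S` is an irreducible `H`-subrepresentation isomorphic to `(Sym^d ⊗ μ^e) ⊠ 1`. -/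
def IsSymBoxOne {ρ : Representation K (H K) V} (S : Subrepresentation ρ) (d : ℕ) (e : ℤ) : Prop :=
  S.toRepresentation.IsIrreducible ∧
    Nonempty (S.toRepresentation.Equiv (symBoxOne K d e))

end Reps

end GSpBranching

end

/-!
# Branching from `GSp₄ ×_{GL₁} GL₂` to `GL₂ ×_{GL₁} GL₂`

**A model of `V^{a,b}`.** Let `hwFun a b` be the function `g ↦ g₀₀ ^ b * (leading 2 × 2 minor) ^ a`
on `GSp₄(K)`, and let `model a b` be the span of its right translates. In a representation with
highest weight `(a + b) χ₁ + a χ₂` and highest weight vector `v`, there is a linear form whose matrix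
coefficient at `v` is `hwFun a b`: take any linear form that does not kill `v`, and pass to a
coefficient of its translates along the cocharacter `s ↦ diag(1, s, s², s³)`, which contracts the
lower unipotent group; on the big cell the matrix coefficient is then forced, and a regular function
that vanishes on the big cell is zero (`exists_dual_eq_hwFun`, `regular_eq_zero_of_bigCell`). Hence
every `V^{a,b}` is isomorphic to the model (`nonempty_equiv_model`). The same contraction shows that
the model is irreducible (`isIrreducible_model`), which gives existence (`exists_isV`).

**Restriction of the model to `H`.** Split the columns into the outer pair (first and last) and the
inner pair. The first row gives a linear form `outer ξ` and a linear form `inner η` in a vector of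
the standard representation of either factor of `H`, and the first two rows give a bilinear form
`mixed ξ η` and a function `outerMinor` on which `H` acts by `μ`. The functions
`outerMinor ^ q * mixed ξ η ^ m * outer ξ ^ k * inner η ^ r` with `q + m = a` and `k + r = b` are the
image of `ξ ^ (m + k) ⊗ η ^ (m + r)` under an equivariant map from
`(Sym^(m + k) ⊠ Sym^(m + r)) ⊗ μ^q`. Polarization and the quadratic relations between the four kinds
of functions show that their span is stable under multiplication by the generators, hence contains
the model (`model_le_famSpan`). Conversely, tangent vectors along the root subgroups that mix inner
and outer columns show, by induction on `q`, that they lie in the model (`fam_mem_model`). The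
highest weights that occur are pairwise different, so the sum is direct (`injective_of_hw`,
`exists_branching`).

**The rest.** The Clebsch–Gordan decomposition of `Sym^l ⊗ Sym^c` is given by powers of the
determinant of two points of the plane (`exists_clebschGordan`), and yields the branching law
(`nonempty_equiv_irrSum`). A subrepresentation isomorphic to `(Sym^d ⊗ μ^e) ⊠ 1` contains a vector
that is fixed by the unipotent elements and has the corresponding weight. The summands with trivial
second factor have `j = c = a - q + r`, hence different twists, so that this vector is a multiple of
the highest weight vector of exactly one summand (`exists_index_of_isSymBoxOne`,
`isSymBoxOne_unique`).
-/

noncomputable section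

namespace GSpBranching

open Polynomial
open scoped Pointwise

/-! ### Interpolation -/

section Interpolation

variable {K : Type*} [Field K]

/-- The coefficients of a vector-valued polynomial lie in every subspace that contains infinitely
many of its values. -/
lemma mem_of_sum_smul_mem {X : Type*} [AddCommMonoid X] [Module K X] (N : Submodule K X)
    {T : Set K} (hT : T.Infinite) (n : ℕ) (c : ℕ → X)
    (h : ∀ s ∈ T, ∑ k ∈ Finset.range n, s ^ k • c k ∈ N) : ∀ k < n, c k ∈ N := by
  -- a module over a field is a group, whichever additive instance it carries
  let _ : AddCommGroup X := Module.addCommMonoidToAddCommGroup K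
  intro k hk
  rw [← Submodule.Quotient.mk_eq_zero N]
  rw [← Module.forall_dual_apply_eq_zero_iff K]
  intro f
  set P : K[X] :=
    ∑ i ∈ Finset.range n, C (f (Submodule.Quotient.mk (c i))) * Polynomial.X ^ i with hP
  have hz : P = 0 := by
    refine Polynomial.eq_zero_of_infinite_isRoot P (hT.mono ?_)
    intro s hs
    have := congrArg f ((Submodule.Quotient.mk_eq_zero N).2 (h s hs))
    simp only [← Submodule.mkQ_apply, map_sum, map_smul, map_zero, smul_eq_mul] at this
    simp only [Set.mem_ofPred_eq, IsRoot, hP, eval_finsetSum, eval_mul, eval_C, eval_pow, eval_X]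
    rw [← this]
    exact Finset.sum_congr rfl fun i _ => by rw [mul_comm]; rfl
  have := congrArg (fun p => p.coeff k) hz
  simpa [hP, Polynomial.finsetSum_coeff, Polynomial.coeff_X_pow, hk] using this

lemma eq_zero_of_sum_pow_smul [Infinite K] {X : Type*} [AddCommMonoid X] [Module K X] {n : ℕ}
    (c : Fin n → X) (h : ∀ s : K, ∑ i : Fin n, s ^ (i : ℕ) • c i = 0) (i : Fin n) : c i = 0 := by
  have := mem_of_sum_smul_mem (⊥ : Submodule K X) Set.infinite_univ n
    (fun k => if h : k < n then c ⟨k, h⟩ else 0) (fun s _ => ?_) i i.2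
  · simpa only [i.2, dif_pos, Submodule.mem_bot] using this
  · rw [Finset.sum_range, Submodule.mem_bot]
    exact (Finset.sum_congr rfl fun i _ => by rw [dif_pos i.2]).trans (h s)

variable {R : Type*} [CommRing R] [Algebra K R]

lemma coeff_mem_of_eval_mem (N : Submodule K R) {T : Set K} (hT : T.Infinite) (P : R[X])
    (h : ∀ s ∈ T, P.eval (algebraMap K R s) ∈ N) (k : ℕ) : P.coeff k ∈ N := by
  rcases lt_or_ge P.natDegree k with hk | hk
  · rw [Polynomial.coeff_eq_zero_of_natDegree_lt hk]; exact N.zero_mem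
  · refine mem_of_sum_smul_mem N hT (P.natDegree + 1) P.coeff (fun s hs => ?_) k (by omega)
    have := h s hs
    rw [Polynomial.eval_eq_sum_range] at this
    convert this using 2 with i
    rw [← map_pow, Algebra.smul_def, mul_comm]

/-- A subspace that contains the points of a polynomial curve contains its tangent vector
at `0`. -/
lemma derivative_eval_mem [Infinite K] (N : Submodule K R) (P : R[X])
    (h : ∀ s : K, P.eval (algebraMap K R s) ∈ N) : P.derivative.eval 0 ∈ N := by
  rw [← Polynomial.coeff_zero_eq_eval_zero, Polynomial.coeff_derivative]
  simpa using coeff_mem_of_eval_mem N Set.infinite_univ P (fun s _ => h s) 1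

lemma eval_mem_of_eval_mem (N : Submodule K R) {T : Set K} (hT : T.Infinite) (P : R[X])
    (h : ∀ s ∈ T, P.eval (algebraMap K R s) ∈ N) (s : K) : P.eval (algebraMap K R s) ∈ N := by
  rw [Polynomial.eval_eq_sum_range]
  refine N.sum_mem fun i _ => ?_
  rw [← map_pow, mul_comm, ← Algebra.smul_def]
  exact N.smul_mem _ (coeff_mem_of_eval_mem N hT P h i)

end Interpolation

/-! ### Symmetric powers of the plane -/

section SymPow

variable {K : Type*} [Field K]

variable (K) in
/-- The underlying space of `Sym^n ⊠ Sym^l`. -/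
abbrev SymBox (n l : ℕ) : Type _ := SymPow K (Fin 2 → K) n ⊗[K] SymPow K (Fin 2 → K) l

/-- The `n`-th power of a vector of the plane, in the `n`-th symmetric power. -/
def pw (n : ℕ) (ξ : Fin 2 → K) : SymPow K (Fin 2 → K) n :=
  ⟨SymmetricAlgebra.ι K (Fin 2 → K) ξ ^ n,
    Submodule.pow_mem_pow _ (LinearMap.mem_range_self _ ξ) n⟩

@[simp] lemma coe_pw (n : ℕ) (ξ : Fin 2 → K) :
    (pw n ξ : SymmetricAlgebra K (Fin 2 → K)) = SymmetricAlgebra.ι K (Fin 2 → K) ξ ^ n := rfl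

/-- The monomial `e₀ ^ (n - i) * e₁ ^ i` in the `n`-th symmetric power of the plane. -/
def mono {K : Type*} [Field K] (n : ℕ) (i : Fin (n + 1)) : SymPow K (Fin 2 → K) n :=
  ⟨SymmetricAlgebra.ι K (Fin 2 → K) ![1, 0] ^ (n - i) *
      SymmetricAlgebra.ι K (Fin 2 → K) ![0, 1] ^ (i : ℕ), by
    have h := Submodule.mul_mem_mul
      (Submodule.pow_mem_pow _
        (LinearMap.mem_range_self (SymmetricAlgebra.ι K (Fin 2 → K)) ![1, 0]) (n - i))
      (Submodule.pow_mem_pow _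
        (LinearMap.mem_range_self (SymmetricAlgebra.ι K (Fin 2 → K)) ![0, 1]) (i : ℕ))
    rwa [← pow_add, Nat.sub_add_cancel (by omega)] at h⟩

/-- Dehomogenisation: the algebra map from the symmetric algebra of the plane to polynomials in
one variable that sends the basis vectors to `1` and `X`. -/
def dehom : SymmetricAlgebra K (Fin 2 → K) →ₐ[K] K[X] :=
  SymmetricAlgebra.lift
    ((LinearMap.proj 0).smulRight (1 : K[X]) + (LinearMap.proj 1).smulRight (Polynomial.X : K[X]))

lemma dehom_ι (ξ : Fin 2 → K) :
    dehom (SymmetricAlgebra.ι K (Fin 2 → K) ξ) = C (ξ 0) + C (ξ 1) * Polynomial.X := by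
  simp [dehom, Polynomial.smul_eq_C_mul]

lemma dehom_mono (n : ℕ) (i : Fin (n + 1)) :
    dehom (mono (K := K) n i).1 = Polynomial.X ^ (i : ℕ) := by
  simp [mono, dehom_ι]

lemma span_mono (n : ℕ) : Submodule.span K (Set.range (mono (K := K) n)) = ⊤ := by
  have key : SymPow K (Fin 2 → K) n ≤
      Submodule.map (SymPow K (Fin 2 → K) n).subtype (Submodule.span K (Set.range (mono n))) := by
    have hr : LinearMap.range (SymmetricAlgebra.ι K (Fin 2 → K)) = Submodule.span K
        {SymmetricAlgebra.ι K (Fin 2 → K) ![1, 0], SymmetricAlgebra.ι K (Fin 2 → K) ![0, 1]} := by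
      apply le_antisymm
      · rintro _ ⟨ξ, rfl⟩
        have : ξ = ξ 0 • ![1, 0] + ξ 1 • ![0, 1] := by
          ext i; fin_cases i <;> simp
        rw [this, map_add, map_smul, map_smul]
        exact Submodule.add_mem _
          (Submodule.smul_mem _ _ (Submodule.subset_span (by simp)))
          (Submodule.smul_mem _ _ (Submodule.subset_span (by simp)))
      · rw [Submodule.span_le]
        rintro x (rfl | rfl) <;> exact ⟨_, rfl⟩
    have hmon : ∀ n : ℕ, ∀ x ∈
        ({SymmetricAlgebra.ι K (Fin 2 → K) ![1, 0], SymmetricAlgebra.ι K (Fin 2 → K) ![0, 1]} :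
        Set (SymmetricAlgebra K (Fin 2 → K))) ^ n, ∃ i : Fin (n + 1), (mono n i).1 = x := by
      intro n
      induction n with
      | zero => intro x hx; exact ⟨0, by simpa [mono, eq_comm] using hx⟩
      | succ n ih =>
        intro x hx
        rw [pow_succ] at hx
        obtain ⟨y, hy, z, hz, rfl⟩ := hx
        obtain ⟨i, rfl⟩ := ih y hy
        rcases hz with rfl | rfl
        · refine ⟨i.castSucc, ?_⟩
          simp only [mono, Fin.val_castSucc]
          rw [show n + 1 - (i : ℕ) = (n - i) + 1 by omega]
          ring
        · refine ⟨i.succ, ?_⟩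
          simp only [mono, Fin.val_succ]
          rw [show n + 1 - ((i : ℕ) + 1) = n - i by omega]
          ring
    change LinearMap.range (SymmetricAlgebra.ι K (Fin 2 → K)) ^ n ≤ _
    rw [hr, Submodule.span_pow, Submodule.span_le]
    intro x hx
    obtain ⟨i, rfl⟩ := hmon n x hx
    exact ⟨mono n i, Submodule.subset_span ⟨i, rfl⟩, rfl⟩
  rw [eq_top_iff]
  rintro x -
  obtain ⟨y, hy, hyx⟩ := key x.2
  rwa [← Subtype.ext hyx]

lemma linearIndependent_mono (n : ℕ) : LinearIndependent K (mono (K := K) n) := by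
  refine LinearIndependent.of_comp (dehom.toLinearMap ∘ₗ (SymPow K (Fin 2 → K) n).subtype) ?_
  have : ⇑(dehom.toLinearMap ∘ₗ (SymPow K (Fin 2 → K) n).subtype) ∘ mono n
      = (Polynomial.basisMonomials K) ∘ (fun i : Fin (n + 1) => (i : ℕ)) := by
    funext i
    simp [dehom_mono, Polynomial.X_pow_eq_monomial]
  rw [this]
  exact (Polynomial.basisMonomials K).linearIndependent.comp _ Fin.val_injective

/-- The monomial basis of the `n`-th symmetric power of the plane. -/
def monoBasis (n : ℕ) : Module.Basis (Fin (n + 1)) K (SymPow K (Fin 2 → K) n) :=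
  Module.Basis.mk (linearIndependent_mono n) (span_mono n).ge

@[simp] lemma monoBasis_apply (n : ℕ) (i : Fin (n + 1)) : monoBasis (K := K) n i = mono n i := by
  simp [monoBasis]

instance (n : ℕ) : Module.Finite K (SymPow K (Fin 2 → K) n) :=
  Module.Finite.of_basis (monoBasis n)

@[simp] lemma finrank_symPow (n : ℕ) : Module.finrank K (SymPow K (Fin 2 → K) n) = n + 1 := by
  rw [Module.finrank_eq_card_basis (monoBasis n), Fintype.card_fin]

lemma pw_eq_sum (n : ℕ) (a b : K) :
    pw n ![a, b] = ∑ i : Fin (n + 1), (a ^ (n - i) * b ^ (i : ℕ) * n.choose i) • mono n i := by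
  apply Subtype.ext
  have e : (![a, b] : Fin 2 → K) = b • ![0, 1] + a • ![1, 0] := by
    ext i; fin_cases i <;> simp
  rw [coe_pw, e, map_add, map_smul, map_smul, add_pow, AddSubmonoidClass.coe_finsetSum,
    Finset.sum_range]
  refine Finset.sum_congr rfl fun k _ => ?_
  simp only [mono, SetLike.val_smul, Algebra.smul_def, map_pow, map_mul, map_natCast]
  ring

/-- In characteristic zero the symmetric power is spanned by powers of vectors `(1, s)`. -/
lemma span_pw [CharZero K] (n : ℕ) :
    Submodule.span K (Set.range fun s : K => pw n ![1, s]) = ⊤ := by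
  rw [eq_top_iff, ← span_mono, Submodule.span_le]
  rintro _ ⟨i, rfl⟩
  have h := mem_of_sum_smul_mem (Submodule.span K (Set.range fun s : K => pw n ![1, s]))
    Set.infinite_univ (n + 1)
    (fun k => if h : k < n + 1 then (n.choose k : K) • mono n ⟨k, h⟩ else 0) (fun s _ => ?_) i i.2
  · simp only [i.2, dif_pos] at h
    have hc : (n.choose i : K) ≠ 0 :=
      Nat.cast_ne_zero.2 (Nat.choose_pos (Nat.lt_succ_iff.1 i.2)).ne'
    exact (Submodule.smul_mem_iff _ hc).1 h
  · refine Set.mem_of_eq_of_mem ?_ (Submodule.subset_span (Set.mem_range_self s))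
    rw [pw_eq_sum, Finset.sum_range]
    refine Finset.sum_congr rfl fun k _ => ?_
    rw [dif_pos k.2, smul_smul, one_pow, one_mul]

/-- Linear maps out of `Sym^n ⊗ Sym^l` in characteristic zero are determined by their values on
products of powers. -/
lemma symPow_hom_ext [CharZero K] {n l : ℕ} {X : Type*} [AddCommMonoid X] [Module K X]
    {f g : SymBox K n l →ₗ[K] X}
    (h : ∀ ξ η, f (pw n ξ ⊗ₜ pw l η) = g (pw n ξ ⊗ₜ pw l η)) : f = g := by
  apply TensorProduct.ext
  refine LinearMap.ext_on (span_pw n) ?_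
  rintro _ ⟨s, rfl⟩
  refine LinearMap.ext_on (span_pw l) ?_
  rintro _ ⟨t, rfl⟩
  exact h _ _

/-- Products of powers span the tensor product of two symmetric powers. -/
lemma symPow_tensor_induction [CharZero K] {n l : ℕ}
    (N : Submodule K (SymBox K n l))
    (h : ∀ s t : K, pw n ![1, s] ⊗ₜ pw l ![1, t] ∈ N) (y) : y ∈ N := by
  induction y using TensorProduct.induction_on with
  | zero => exact N.zero_mem
  | add x y hx hy => exact N.add_mem hx hy
  | tmul x z =>
    have hx : x ∈ Submodule.span K (Set.range fun s : K => pw n ![1, s]) :=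
      span_pw (K := K) n ▸ Submodule.mem_top
    have hz : z ∈ Submodule.span K (Set.range fun s : K => pw l ![1, s]) :=
      span_pw (K := K) l ▸ Submodule.mem_top
    have h1 : Submodule.span K (Set.range fun s : K => pw n ![1, s]) ≤
        N.comap ((TensorProduct.mk K _ _).flip z) := by
      rw [Submodule.span_le]
      rintro _ ⟨s, rfl⟩
      have h2 : Submodule.span K (Set.range fun s : K => pw l ![1, s]) ≤
          N.comap (TensorProduct.mk K _ _ (pw n ![1, s])) := by
        rw [Submodule.span_le]
        rintro _ ⟨t, rfl⟩
        exact h s t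
      exact h2 hz
    exact h1 hx

/-- Evaluation of an element of `Sym^n ⊗ Sym^l`, viewed as a bihomogeneous polynomial, at the
pair of points `(1, s)` and `(1, t)`. -/
def evalAt (n l : ℕ) (s t : K) :
    SymBox K n l →ₗ[K] K :=
  TensorProduct.lift ((LinearMap.mul K K).compl₁₂
    ((Polynomial.leval s) ∘ₗ dehom.toLinearMap ∘ₗ (SymPow K (Fin 2 → K) n).subtype)
    ((Polynomial.leval t) ∘ₗ dehom.toLinearMap ∘ₗ (SymPow K (Fin 2 → K) l).subtype))

lemma evalAt_pw (n l : ℕ) (s t : K) (ξ η : Fin 2 → K) :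
    evalAt n l s t (pw n ξ ⊗ₜ pw l η) = (ξ 0 + s * ξ 1) ^ n * (η 0 + t * η 1) ^ l := by
  simp only [evalAt, TensorProduct.lift.tmul, LinearMap.compl₁₂_apply, LinearMap.comp_apply,
    Submodule.subtype_apply, coe_pw, AlgHom.toLinearMap_apply, map_pow, dehom_ι,
    Polynomial.leval_apply, LinearMap.mul_apply', Polynomial.eval_pow, Polynomial.eval_add,
    Polynomial.eval_mul, Polynomial.eval_C, Polynomial.eval_X]
  rw [mul_comm (ξ 1), mul_comm (η 1)]

lemma evalAt_mono (n l : ℕ) (s t : K) (i : Fin (n + 1)) (j : Fin (l + 1)) :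
    evalAt n l s t (mono n i ⊗ₜ mono l j) = s ^ (i : ℕ) * t ^ (j : ℕ) := by
  simp only [evalAt, TensorProduct.lift.tmul, LinearMap.compl₁₂_apply, LinearMap.comp_apply,
    Submodule.subtype_apply, AlgHom.toLinearMap_apply, dehom_mono,
    Polynomial.leval_apply, LinearMap.mul_apply', Polynomial.eval_pow, Polynomial.eval_X]

/-- A bihomogeneous polynomial that vanishes at all pairs of points `(1, s)` and `(1, t)` is
zero. -/
lemma eq_zero_of_evalAt [Infinite K] {n l : ℕ}
    (y : SymBox K n l)
    (h : ∀ s t : K, evalAt n l s t y = 0) : y = 0 := by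
  set b := (monoBasis (K := K) n).tensorProduct (monoBasis (K := K) l) with hb
  rw [← b.sum_repr y] at h ⊢
  have h1 : ∀ s t : K, ∑ i : Fin (n + 1), s ^ (i : ℕ) •
      (∑ j : Fin (l + 1), t ^ (j : ℕ) • b.repr y (i, j)) = 0 := by
    intro s t
    rw [← h s t, map_sum, Fintype.sum_prod_type]
    refine Finset.sum_congr rfl fun i _ => ?_
    rw [Finset.smul_sum]
    refine Finset.sum_congr rfl fun j _ => ?_
    simp only [b, Module.Basis.tensorProduct_apply, monoBasis_apply, map_smul, evalAt_mono,
      smul_eq_mul]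
    ring
  refine Finset.sum_eq_zero fun ij _ => ?_
  obtain ⟨i, j⟩ := ij
  have h2 := fun t => eq_zero_of_sum_pow_smul _ (fun s => h1 s t) i
  have h3 : b.repr y (i, j) = 0 := eq_zero_of_sum_pow_smul _ h2 j
  rw [h3, zero_smul]

end SymPow

/-! ### Linear maps out of symmetric powers -/

section Lift

variable {K : Type*} [Field K] {R : Type*} [CommRing R] [Algebra K R]

/-- A bihomogeneous monomial of bidegree `(n, l)` in two points of the plane, with coefficient in
a `K`-algebra. -/
def bimono (n l i j : ℕ) (c : R) (ξ η : Fin 2 → K) : R :=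
  (ξ 0 ^ (n - i) * ξ 1 ^ i * (η 0 ^ (l - j) * η 1 ^ j)) • c

variable (K R) in
/-- The `R`-valued functions of two points of the plane that are bihomogeneous polynomials of
bidegree `(n, l)`. -/
def bihom (n l : ℕ) : Submodule K ((Fin 2 → K) → (Fin 2 → K) → R) :=
  Submodule.span K {φ | ∃ i ≤ n, ∃ j ≤ l, ∃ c, φ = bimono n l i j c}

lemma bihom_mul {n l n' l' : ℕ} {φ ψ : (Fin 2 → K) → (Fin 2 → K) → R}
    (hφ : φ ∈ bihom K R n l) (hψ : ψ ∈ bihom K R n' l') : φ * ψ ∈ bihom K R (n + n') (l + l') := by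
  induction hφ using Submodule.span_induction with
  | zero => rw [zero_mul]; exact Submodule.zero_mem _
  | add x y _ _ hx hy => rw [add_mul]; exact Submodule.add_mem _ hx hy
  | smul a x _ hx => rw [smul_mul_assoc]; exact Submodule.smul_mem _ _ hx
  | mem x hx =>
    induction hψ using Submodule.span_induction with
    | zero => rw [mul_zero]; exact Submodule.zero_mem _
    | add x y _ _ hx hy => rw [mul_add]; exact Submodule.add_mem _ hx hy
    | smul a x _ hx => rw [mul_smul_comm]; exact Submodule.smul_mem _ _ hx
    | mem y hy =>
      obtain ⟨i, hi, j, hj, c, rfl⟩ := hx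
      obtain ⟨i', hi', j', hj', c', rfl⟩ := hy
      refine Submodule.subset_span
        ⟨i + i', add_le_add hi hi', j + j', add_le_add hj hj', c * c', ?_⟩
      funext ξ η
      simp only [Pi.mul_apply, bimono]
      rw [smul_mul_smul_comm, show n + n' - (i + i') = (n - i) + (n' - i') by omega,
        show l + l' - (j + j') = (l - j) + (l' - j') by omega]
      congr 1
      ring

lemma bihom_const (c : R) : (fun _ _ => c) ∈ bihom K R 0 0 :=
  Submodule.subset_span ⟨0, le_rfl, 0, le_rfl, c, by funext ξ η; simp [bimono]⟩

lemma bihom_pow {n l : ℕ} {φ : (Fin 2 → K) → (Fin 2 → K) → R} (hφ : φ ∈ bihom K R n l) (m : ℕ) :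
    φ ^ m ∈ bihom K R (m * n) (m * l) := by
  induction m with
  | zero => rw [pow_zero, zero_mul, zero_mul]; exact bihom_const 1
  | succ m ih => rw [pow_succ, add_mul, add_mul, one_mul, one_mul]; exact bihom_mul ih hφ

lemma bihom_left (f : (Fin 2 → K) →ₗ[K] R) : (fun ξ _ => f ξ) ∈ bihom K R 1 0 := by
  have : (fun ξ _ => f ξ : (Fin 2 → K) → (Fin 2 → K) → R) =
      bimono 1 0 0 0 (f ![1, 0]) + bimono 1 0 1 0 (f ![0, 1]) := by
    funext ξ η
    have : ξ = ξ 0 • ![1, 0] + ξ 1 • ![0, 1] := by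
      ext i; fin_cases i <;> simp
    conv_lhs => rw [this, map_add, map_smul, map_smul]
    simp [bimono]
  rw [this]
  exact Submodule.add_mem _
    (Submodule.subset_span ⟨0, by simp, 0, le_rfl, _, rfl⟩)
    (Submodule.subset_span ⟨1, le_rfl, 0, le_rfl, _, rfl⟩)

lemma bihom_right (f : (Fin 2 → K) →ₗ[K] R) : (fun _ η => f η) ∈ bihom K R 0 1 := by
  have : (fun _ η => f η : (Fin 2 → K) → (Fin 2 → K) → R) =
      bimono 0 1 0 0 (f ![1, 0]) + bimono 0 1 0 1 (f ![0, 1]) := by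
    funext ξ η
    have : η = η 0 • ![1, 0] + η 1 • ![0, 1] := by
      ext i; fin_cases i <;> simp
    conv_lhs => rw [this, map_add, map_smul, map_smul]
    simp [bimono]
  rw [this]
  exact Submodule.add_mem _
    (Submodule.subset_span ⟨0, le_rfl, 0, by simp, _, rfl⟩)
    (Submodule.subset_span ⟨0, le_rfl, 1, le_rfl, _, rfl⟩)

/-- The linear functional on `Sym^n` that sends the power `ξ ^ n` to `ξ₀ ^ (n - i) * ξ₁ ^ i`. -/
def powCoeff (n i : ℕ) : SymPow K (Fin 2 → K) n →ₗ[K] K :=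
  ((n.choose i : K)⁻¹) • (Polynomial.lcoeff K i ∘ₗ dehom.toLinearMap ∘ₗ Submodule.subtype _)

lemma powCoeff_pw [CharZero K] {n i : ℕ} (hi : i ≤ n) (ξ : Fin 2 → K) :
    powCoeff n i (pw n ξ) = ξ 0 ^ (n - i) * ξ 1 ^ i := by
  have hc : (n.choose i : K) ≠ 0 := Nat.cast_ne_zero.2 (Nat.choose_pos hi).ne'
  simp only [powCoeff, LinearMap.smul_apply, LinearMap.comp_apply, Submodule.subtype_apply, coe_pw,
    AlgHom.toLinearMap_apply, map_pow, dehom_ι, Polynomial.lcoeff_apply, smul_eq_mul]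
  rw [add_comm, add_pow, Polynomial.finsetSum_coeff, Finset.sum_eq_single i]
  · rw [mul_pow, ← C_pow, ← C_pow, ← C_eq_natCast, mul_assoc, mul_assoc, Polynomial.coeff_C_mul,
      ← C_mul, Polynomial.coeff_X_pow_mul', if_pos le_rfl, Nat.sub_self, Polynomial.coeff_C_zero]
    field_simp
  · intro k _ hk
    rw [mul_pow, ← C_pow, ← C_pow, ← C_eq_natCast, mul_assoc, mul_assoc, Polynomial.coeff_C_mul,
      ← C_mul, mul_comm (Polynomial.X ^ k), Polynomial.coeff_C_mul, Polynomial.coeff_X_pow,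
      if_neg (Ne.symm hk), mul_zero, mul_zero]
  · intro h
    exact absurd (Finset.mem_range.2 (by omega)) h

/-- A bihomogeneous polynomial of bidegree `(n, l)` in two points of the plane factors through a
linear map on `Sym^n ⊗ Sym^l`. -/
lemma exists_lift [CharZero K] {n l : ℕ} {φ : (Fin 2 → K) → (Fin 2 → K) → R}
    (hφ : φ ∈ bihom K R n l) :
    ∃ Φ : SymBox K n l →ₗ[K] R,
      ∀ ξ η, Φ (pw n ξ ⊗ₜ pw l η) = φ ξ η := by
  induction hφ using Submodule.span_induction with
  | zero => exact ⟨0, fun _ _ => rfl⟩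
  | add x y _ _ hx hy =>
    obtain ⟨Φ, h⟩ := hx
    obtain ⟨Ψ, h'⟩ := hy
    exact ⟨Φ + Ψ, fun ξ η => by rw [LinearMap.add_apply, h, h']; rfl⟩
  | smul a x _ hx =>
    obtain ⟨Φ, h⟩ := hx
    exact ⟨a • Φ, fun ξ η => by rw [LinearMap.smul_apply, h]; rfl⟩
  | mem x hx =>
    obtain ⟨i, hi, j, hj, c, rfl⟩ := hx
    refine ⟨(TensorProduct.lift ((LinearMap.mul K K).compl₁₂ (powCoeff n i)
      (powCoeff l j))).smulRight c, fun ξ η => ?_⟩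
    simp only [LinearMap.smulRight_apply, TensorProduct.lift.tmul, LinearMap.compl₁₂_apply,
      LinearMap.mul_apply', powCoeff_pw hi, powCoeff_pw hj, bimono]

/-- A linear map out of `Sym^n ⊗ Sym^l` takes values in every subspace that contains its values on
products of powers. -/
lemma range_lift [CharZero K] {n l : ℕ}
    (Φ : SymBox K n l →ₗ[K] R) (N : Submodule K R)
    (h : ∀ ξ η, Φ (pw n ξ ⊗ₜ pw l η) ∈ N) (y) : Φ y ∈ N :=
  symPow_tensor_induction (N.comap Φ) (fun _ _ => h _ _) y

end Lift

/-! ### The irreducible representations of `H` -/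

section IrrepsH

variable {K : Type*} [Field K]

/-- The representation `(Sym^n ⊠ Sym^l) ⊗ μ^e` of `H`. -/
abbrev irr (n l e : ℕ) :
    Representation K (H K) (SymBox K n l) :=
  twist (boxH (Sym K n) (Sym K l)) (H.mu K ^ e)

lemma Sym_pw (n : ℕ) (g : GL (Fin 2) K) (ξ : Fin 2 → K) :
    Sym K n g (pw n ξ) = pw n (std K g ξ) := by
  ext
  change symMap (std K g) (SymmetricAlgebra.ι K _ ξ ^ n) = _
  simp [symMap]

lemma irr_pw (n l e : ℕ) (h : H K) (ξ η : Fin 2 → K) :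
    irr n l e h (pw n ξ ⊗ₜ pw l η) =
      ((H.mu K h : Kˣ) : K) ^ e • (pw n (std K (H.pr₁ K h) ξ) ⊗ₜ[K] pw l (std K (H.pr₂ K h) η)) := by
  change ((((H.mu K ^ e) h : Kˣ)) : K) • TensorProduct.map (Sym K n (H.pr₁ K h))
    (Sym K l (H.pr₂ K h)) (pw n ξ ⊗ₜ pw l η) = _
  rw [TensorProduct.map_tmul, Sym_pw, Sym_pw]
  simp

/-- Equivariance of a linear map out of `(Sym^n ⊠ Sym^l) ⊗ μ^e` may be checked on powers. -/
lemma comp_irr_eq [CharZero K] {n l e : ℕ} {X : Type*} [AddCommMonoid X] [Module K X]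
    (ρ : Representation K (H K) X)
    (Φ : SymBox K n l →ₗ[K] X) (h : H K)
    (hΦ : ∀ ξ η, ρ h (Φ (pw n ξ ⊗ₜ pw l η)) = ((H.mu K h : Kˣ) : K) ^ e •
      Φ (pw n (std K (H.pr₁ K h) ξ) ⊗ₜ pw l (std K (H.pr₂ K h) η))) :
    Φ ∘ₗ irr n l e h = ρ h ∘ₗ Φ := by
  apply symPow_hom_ext
  intro ξ η
  rw [LinearMap.comp_apply, LinearMap.comp_apply, hΦ, irr_pw, map_smul]

/-- The element of `H` given by a pair of matrices of determinant one. -/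
def ofSL (A B : SL(2, K)) : H K :=
  ⟨(Matrix.SpecialLinearGroup.toGL A, Matrix.SpecialLinearGroup.toGL B), by
    change Matrix.GeneralLinearGroup.det _ = Matrix.GeneralLinearGroup.det _
    ext
    simp⟩

lemma ofSL_mul (A B A' B' : SL(2, K)) : ofSL (A * A') (B * B') = ofSL A B * ofSL A' B' := by
  apply Subtype.ext
  apply Prod.ext <;> simp [ofSL]

@[simp] lemma mu_ofSL (A B : SL(2, K)) : H.mu K (ofSL A B) = 1 := by
  change Matrix.GeneralLinearGroup.det (Matrix.SpecialLinearGroup.toGL A) = 1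
  ext
  simp

lemma std_pr₁_ofSL (A B : SL(2, K)) (ξ : Fin 2 → K) :
    std K (H.pr₁ K (ofSL A B)) ξ = (A : Matrix (Fin 2) (Fin 2) K).mulVec ξ := rfl

lemma std_pr₂_ofSL (A B : SL(2, K)) (ξ : Fin 2 → K) :
    std K (H.pr₂ K (ofSL A B)) ξ = (B : Matrix (Fin 2) (Fin 2) K).mulVec ξ := rfl

/-- The upper unipotent matrix with off-diagonal entry `s`. -/
def uni (s : K) : SL(2, K) := ⟨!![1, s; 0, 1], by simp⟩

lemma uni_add (s t : K) : uni (s + t) = uni s * uni t := by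
  apply Subtype.ext
  change _ = !![1, s; 0, 1] * !![1, t; 0, 1]
  simp [uni, add_comm]

/-- The lower triangular matrix of determinant one with first column `(x, y)`. -/
def lowSL (x y : K) (hx : x ≠ 0) : SL(2, K) := ⟨!![x, 0; y, x⁻¹], by simp [hx]⟩

lemma lowSL_mulVec (x y : K) (hx : x ≠ 0) : (lowSL x y hx).1.mulVec ![1, 0] = ![x, y] := by
  ext i; fin_cases i <;> simp [lowSL, Matrix.mulVec, dotProduct, Fin.sum_univ_two]

/-- The diagonal matrix with entries `x` and `x⁻¹`. -/
abbrev diagSL (x : K) (hx : x ≠ 0) : SL(2, K) := lowSL x 0 hx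

lemma irr_ofSL_pw (n l e : ℕ) (A B : SL(2, K)) (ξ η : Fin 2 → K) :
    irr n l e (ofSL A B) (pw n ξ ⊗ₜ pw l η) =
      pw n (A.1.mulVec ξ) ⊗ₜ[K] pw l (B.1.mulVec η) := by
  rw [irr_pw, mu_ofSL, std_pr₁_ofSL, std_pr₂_ofSL]
  simp

/-- The highest weight vector of `(Sym^n ⊠ Sym^l) ⊗ μ^e`. -/
def hw (n l : ℕ) : SymBox K n l :=
  pw n ![1, 0] ⊗ₜ pw l ![1, 0]

lemma evalAt_hw (n l : ℕ) (s t : K) : evalAt n l s t (hw n l) = 1 := by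
  simp [hw, evalAt_pw]

lemma hw_ne_zero (n l : ℕ) : hw (K := K) n l ≠ 0 := by
  intro h
  have := evalAt_hw (K := K) n l 0 0
  rw [h, map_zero] at this
  exact zero_ne_one this

/-- The evaluations are the upper unipotent translates of the coordinate along the highest weight
vector. -/
lemma evalAt_uni [CharZero K] (n l e : ℕ) (s t : K) (y) :
    evalAt n l 0 0 (irr n l e (ofSL (uni s) (uni t)) y) = evalAt n l s t y := by
  have : evalAt n l 0 0 ∘ₗ irr n l e (ofSL (uni s) (uni t)) = evalAt n l s t := by
    apply symPow_hom_ext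
    intro ξ η
    rw [LinearMap.comp_apply, irr_ofSL_pw, evalAt_pw, evalAt_pw]
    simp [uni, Matrix.mulVec, dotProduct, Fin.sum_univ_two]
  exact LinearMap.congr_fun this y

/-- A vector fixed by the upper unipotent elements is a multiple of the highest weight vector. -/
lemma eq_smul_hw_of_fixed [CharZero K] {n l e : ℕ}
    {y : SymBox K n l}
    (h : ∀ s t : K, irr n l e (ofSL (uni s) (uni t)) y = y) : ∃ c : K, y = c • hw n l := by
  refine ⟨evalAt n l 0 0 y, sub_eq_zero.1 (eq_zero_of_evalAt _ fun s t => ?_)⟩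
  rw [map_sub, map_smul, evalAt_hw, ← evalAt_uni n l e s t y, h]
  simp

lemma irr_diag_hw (n l e : ℕ) (x y : K) (hx : x ≠ 0) (hy : y ≠ 0) :
    irr n l e (ofSL (diagSL x hx) (diagSL y hy)) (hw n l) = (x ^ n * y ^ l) • hw n l := by
  rw [hw, irr_ofSL_pw]
  have (z : K) (hz : z ≠ 0) (m : ℕ) :
      pw m ((diagSL z hz).1.mulVec ![1, 0]) = z ^ m • pw m ![1, 0] := by
    have : (![z, 0] : Fin 2 → K) = z • ![1, 0] := by
      ext i; fin_cases i <;> simp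
    rw [lowSL_mulVec, this]
    apply Subtype.ext
    rw [coe_pw, map_smul, _root_.smul_pow]
    rfl
  rw [this, this, TensorProduct.smul_tmul_smul]

/-- A stable subspace that contains the highest weight vector is the whole space, because the lower
triangular translates of that vector are the products of the powers of `(1, s)` and `(1, t)`. -/
lemma eq_top_of_hw_mem [CharZero K] {n l e : ℕ}
    (N : Submodule K (SymBox K n l))
    (hN : ∀ h, ∀ y ∈ N, irr n l e h y ∈ N) (hhw : hw n l ∈ N) : N = ⊤ := by
  refine eq_top_iff.2 fun y _ => symPow_tensor_induction N (fun s t => ?_) y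
  have := hN (ofSL (lowSL 1 s one_ne_zero) (lowSL 1 t one_ne_zero)) _ hhw
  rwa [hw, irr_ofSL_pw, lowSL_mulVec, lowSL_mulVec] at this

end IrrepsH

/-! ### Vectors fixed by unipotent elements -/

section PolyCurve

variable {K : Type*} [Field K]

variable {X : Type*} [AddCommMonoid X] [Module K X]

variable (K X) in
/-- The polynomial curves in a vector space. -/
def polyCurve : Submodule K (K → X) :=
  Submodule.span K {f | ∃ (k : ℕ) (x : X), f = fun s => s ^ k • x}

lemma eval_smul_mem_polyCurve (p : K[X]) (x : X) : (fun s => p.eval s • x) ∈ polyCurve K X := by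
  have : (fun s => p.eval s • x) =
      ∑ i ∈ Finset.range (p.natDegree + 1), p.coeff i • fun s : K => s ^ i • x := by
    funext s
    rw [Polynomial.eval_eq_sum_range, Finset.sum_smul, Finset.sum_apply]
    exact Finset.sum_congr rfl fun i _ => by rw [Pi.smul_apply, smul_smul]
  rw [this]
  exact Submodule.sum_mem _ fun i _ => Submodule.smul_mem _ _ (Submodule.subset_span ⟨i, x, rfl⟩)

lemma polyCurve_map {X' : Type*} [AddCommMonoid X'] [Module K X'] (L : X →ₗ[K] X') {f : K → X}
    (hf : f ∈ polyCurve K X) : (fun s => L (f s)) ∈ polyCurve K X' := by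
  have : polyCurve K X ≤ (polyCurve K X').comap (L.compLeft K) := by
    refine Submodule.span_le.2 ?_
    rintro _ ⟨k, x, rfl⟩
    exact Submodule.subset_span ⟨k, L x, by funext s; simp⟩
  exact this hf

end PolyCurve

section OneParam

variable {K : Type*} [Field K] {X : Type*} [AddCommMonoid X] [Module K X]

lemma exists_coeff_of_mem_polyCurve {f : K → X} (hf : f ∈ polyCurve K X) :
    ∃ (n : ℕ) (c : ℕ → X), ∀ s, f s = ∑ k ∈ Finset.range n, s ^ k • c k := by
  suffices h : ∃ c : ℕ →₀ X, ∀ s, f s = c.sum fun k x => s ^ k • x by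
    obtain ⟨c, hc⟩ := h
    obtain ⟨n, hn⟩ := Finset.exists_nat_subset_range c.support
    exact ⟨n, c, fun s => (hc s).trans (Finsupp.sum_of_support_subset _ hn _ (by simp))⟩
  induction hf using Submodule.span_induction with
  | zero => exact ⟨0, fun _ => by simp⟩
  | add x y _ _ hx hy =>
    obtain ⟨c, h⟩ := hx
    obtain ⟨d, h'⟩ := hy
    exact ⟨c + d, fun s => by
      rw [Pi.add_apply, h, h', Finsupp.sum_add_index' (by simp) (by simp)]⟩
  | smul a x _ hx =>
    obtain ⟨c, h⟩ := hx
    refine ⟨a • c, fun s => ?_⟩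
    rw [Pi.smul_apply, h, Finsupp.sum_smul_index' (by simp), Finsupp.smul_sum]
    simp only [smul_comm a]
  | mem x hx =>
    obtain ⟨k, x, rfl⟩ := hx
    exact ⟨Finsupp.single k x, fun s => by simp⟩

/-- Substitution of `s + t` in a vector-valued polynomial leaves the leading coefficient
unchanged. -/
lemma exists_shift (n : ℕ) (c : ℕ → X) (t : K) :
    ∃ c' : ℕ → X, (∀ s : K, ∑ k ∈ Finset.range n, (s + t) ^ k • c k =
      ∑ k ∈ Finset.range n, s ^ k • c' k) ∧ ∀ m, n = m + 1 → c' m = c m := by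
  induction n with
  | zero => exact ⟨0, by simp, by simp⟩
  | succ n ih =>
    obtain ⟨d, hd, -⟩ := ih
    refine ⟨fun k => if k = n then c n else d k + (t ^ (n - k) * n.choose k) • c n,
      fun s => ?_, fun m hm => by simp [show m = n by omega]⟩
    rw [Finset.sum_range_succ, Finset.sum_range_succ, hd, add_pow,
      Finset.sum_range_succ, add_smul, Finset.sum_smul, ← add_assoc, ← Finset.sum_add_distrib]
    congr 1
    · refine Finset.sum_congr rfl fun k hk => ?_
      beta_reduce
      rw [if_neg (Finset.mem_range.1 hk).ne, smul_add, smul_smul, mul_assoc]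
    · simp

/-- A one-parameter group of operators that acts polynomially on a nonzero stable subspace has a
nonzero fixed vector there, namely the leading coefficient of an orbit. -/
lemma exists_fixed_of_oneParam [Infinite K] (τ : K → Module.End K X) (h0 : τ 0 = 1)
    (hadd : ∀ s t, τ (s + t) = τ s * τ t) (N : Submodule K X) (hN : ∀ s, ∀ y ∈ N, τ s y ∈ N)
    (hpoly : ∀ y, (fun s => τ s y) ∈ polyCurve K X) (hne : N ≠ ⊥) :
    ∃ y ∈ N, y ≠ 0 ∧ ∀ s, τ s y = y := by
  let _ : AddCommGroup X := Module.addCommMonoidToAddCommGroup K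
  classical
  obtain ⟨y, hy, hy0⟩ := Submodule.exists_mem_ne_zero_of_ne_bot hne
  have hex := exists_coeff_of_mem_polyCurve (hpoly y)
  obtain ⟨c, hc⟩ := Nat.find_spec hex
  obtain ⟨m, hm⟩ : ∃ m, Nat.find hex = m + 1 := by
    refine Nat.exists_eq_succ_of_ne_zero fun h => hy0 ?_
    have := hc 0
    rw [h, h0] at this
    simpa using this
  rw [hm] at hc
  have hcN := mem_of_sum_smul_mem N Set.infinite_univ (m + 1) c
    (fun s _ => by rw [← hc s]; exact hN s y hy)
  refine ⟨c m, hcN m (by omega), fun h => ?_, fun t => ?_⟩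
  · refine Nat.find_min hex (m := m) (by omega) ⟨c, fun s => ?_⟩
    rw [hc s, Finset.sum_range_succ, h, smul_zero, add_zero]
  · obtain ⟨c', hc', htop⟩ := exists_shift (m + 1) c t
    have h := mem_of_sum_smul_mem (⊥ : Submodule K X) Set.infinite_univ (m + 1)
      (fun k => τ t (c k) - c' k) (fun s _ => ?_) m (by omega)
    · rw [Submodule.mem_bot, sub_eq_zero, htop m rfl] at h
      exact h
    · rw [Submodule.mem_bot]
      simp only [smul_sub, Finset.sum_sub_distrib]
      rw [← hc' s, ← hc (s + t), sub_eq_zero, add_comm s t, hadd, Module.End.mul_apply, hc s,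
        map_sum]
      simp only [map_smul]

end OneParam

section Fixed

variable {K : Type*} [Field K] {X : Type*} [AddCommMonoid X] [Module K X]

/-- The two one-parameter groups of upper unipotent elements of `H` act polynomially. -/
def PolyAct (ρ : Representation K (H K) X) : Prop :=
  ∀ y, (fun s => ρ (ofSL (uni s) 1) y) ∈ polyCurve K X ∧
    (fun s => ρ (ofSL 1 (uni s)) y) ∈ polyCurve K X

lemma uni_zero : uni (0 : K) = 1 := by
  apply Subtype.ext
  simp [uni, Matrix.one_fin_two]

lemma ofSL_one : ofSL (1 : SL(2, K)) 1 = 1 := by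
  apply Subtype.ext
  apply Prod.ext <;> simp [ofSL]

/-- A nonzero stable subspace of a polynomial representation of `H` contains a nonzero vector fixed
by the upper unipotent elements. -/
lemma exists_fixed [Infinite K] (ρ : Representation K (H K) X) (hρ : PolyAct ρ)
    (N : Submodule K X) (hN : ∀ h, ∀ y ∈ N, ρ h y ∈ N) (hne : N ≠ ⊥) :
    ∃ y ∈ N, y ≠ 0 ∧ ∀ s t : K, ρ (ofSL (uni s) (uni t)) y = y := by
  let _ : AddCommGroup X := Module.addCommMonoidToAddCommGroup K
  obtain ⟨y₁, hy₁, hy₁0, hfix₁⟩ := exists_fixed_of_oneParam (fun s => ρ (ofSL (uni s) 1))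
    (by rw [uni_zero, ofSL_one, map_one])
    (fun s t => by rw [uni_add, ← map_mul, ← ofSL_mul, one_mul]) N (fun s y hy => hN _ y hy)
    (fun y => (hρ y).1) hne
  let N' : Submodule K X :=
    N ⊓ ⨅ s : K, LinearMap.ker (ρ (ofSL (uni s) 1) - 1)
  have hN' : ∀ y, y ∈ N' ↔ y ∈ N ∧ ∀ s : K, ρ (ofSL (uni s) 1) y = y := by
    intro y
    simp [N', Submodule.mem_iInf, sub_eq_zero]
  obtain ⟨y, hy, hy0, hfix⟩ := exists_fixed_of_oneParam (fun s => ρ (ofSL 1 (uni s)))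
    (by rw [uni_zero, ofSL_one, map_one])
    (fun s t => by rw [uni_add, ← map_mul, ← ofSL_mul, one_mul]) N'
    (fun s y hy => by
      rw [hN'] at hy ⊢
      refine ⟨hN _ _ hy.1, fun t => ?_⟩
      rw [← Module.End.mul_apply, ← map_mul, ← ofSL_mul, one_mul, mul_one]
      nth_rw 2 [← hy.2 t]
      rw [← Module.End.mul_apply, ← map_mul, ← ofSL_mul, one_mul, mul_one])
    (fun y => (hρ y).2) (Submodule.ne_bot_iff _ |>.2 ⟨y₁, (hN' _).2 ⟨hy₁, hfix₁⟩, hy₁0⟩)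
  rw [hN'] at hy
  refine ⟨y, hy.1, hy0, fun s t => ?_⟩
  have : ofSL (uni s) (uni t) = ofSL (uni s) 1 * ofSL 1 (uni t) := by
    rw [← ofSL_mul, one_mul, mul_one]
  rw [this, map_mul, Module.End.mul_apply, hfix, hy.2]

lemma pw_uni_mem_polyCurve (n : ℕ) (t : K) :
    (fun s => pw n ((uni s).1.mulVec ![1, t])) ∈ polyCurve K (SymPow K (Fin 2 → K) n) := by
  have : (fun s => pw n ((uni s).1.mulVec ![1, t])) = ∑ i : Fin (n + 1), fun s : K =>
      (((1 + C t * Polynomial.X) ^ (n - i) * C (t ^ (i : ℕ) * n.choose i)).eval s) • mono n i := by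
    funext s
    have e : (uni s).1.mulVec ![1, t] = ![1 + t * s, t] := by
      ext i; fin_cases i <;>
        simp [uni, Matrix.mulVec, dotProduct, Fin.sum_univ_two, mul_comm]
    rw [e, pw_eq_sum, Finset.sum_apply]
    refine Finset.sum_congr rfl fun i _ => ?_
    simp [mul_assoc]
  rw [this]
  exact Submodule.sum_mem _ fun i _ => eval_smul_mem_polyCurve _ _

lemma polyAct_irr [CharZero K] (n l e : ℕ) : PolyAct (irr (K := K) n l e) := by
  refine fun y => ⟨?_, ?_⟩
  · let N : Submodule K (SymBox K n l) :=
      (polyCurve K _).comap (LinearMap.pi fun s => irr n l e (ofSL (uni s) 1))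
    refine symPow_tensor_induction N (fun t t' => ?_) y
    change (fun s => irr n l e (ofSL (uni s) 1) (pw n ![1, t] ⊗ₜ pw l ![1, t'])) ∈
      polyCurve K (SymBox K n l)
    simp only [irr_ofSL_pw]
    exact polyCurve_map ((TensorProduct.mk K _ _).flip _) (pw_uni_mem_polyCurve n t)
  · let N : Submodule K (SymBox K n l) :=
      (polyCurve K _).comap (LinearMap.pi fun s => irr n l e (ofSL 1 (uni s)))
    refine symPow_tensor_induction N (fun t t' => ?_) y
    change (fun s => irr n l e (ofSL 1 (uni s)) (pw n ![1, t] ⊗ₜ pw l ![1, t'])) ∈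
      polyCurve K (SymBox K n l)
    simp only [irr_ofSL_pw]
    exact polyCurve_map (TensorProduct.mk K _ _ _) (pw_uni_mem_polyCurve l t')

lemma isIrreducible_irr [CharZero K] (n l e : ℕ) :
    Representation.IsIrreducible (V := SymBox K n l) (irr n l e) := by
  have : Nontrivial (Subrepresentation (irr (K := K) n l e)) := by
    refine ⟨⊥, ⊤, fun h => hw_ne_zero (K := K) n l ?_⟩
    have h2 : hw (K := K) n l ∈ (⊤ : Subrepresentation (irr (K := K) n l e)).toSubmodule :=
      Submodule.mem_top
    rw [← h] at h2
    exact (Submodule.mem_bot K).1 h2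
  refine { eq_bot_or_eq_top := fun S => ?_ }
  by_cases hS : S.toSubmodule = ⊥
  · exact Or.inl (Subrepresentation.toSubmodule_injective hS)
  · obtain ⟨y, hy, hy0, hfix⟩ := exists_fixed (irr n l e) (polyAct_irr n l e) S.toSubmodule
      (fun h y hy => S.apply_mem_toSubmodule h hy) hS
    obtain ⟨c, rfl⟩ := eq_smul_hw_of_fixed hfix
    have hc : c ≠ 0 := fun h => hy0 (by rw [h, zero_smul])
    have hmem : hw n l ∈ S.toSubmodule := by
      rw [← inv_smul_smul₀ hc (hw n l)]
      exact S.toSubmodule.smul_mem _ hy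
    exact Or.inr (Subrepresentation.toSubmodule_injective
      (eq_top_of_hw_mem S.toSubmodule (fun h y hy => S.apply_mem_toSubmodule h hy) hmem))

end Fixed

section Sums

variable {K : Type*} [Field K] {ι : Type*} (n l e : ι → ℕ)

/-- The direct sum of a family of irreducible representations of `H`. -/
abbrev irrSum := Representation.directSum fun i => irr (K := K) (n i) (l i) (e i)

lemma irrSum_apply_apply (h : H K)
    (y : ⨁ i, SymBox K (n i) (l i)) (i : ι) :
    irrSum n l e h y i = irr (n i) (l i) (e i) h (y i) := by
  simp [irrSum, DirectSum.lmap_apply]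

lemma irrSum_of [DecidableEq ι] (h : H K) (i : ι) (z) :
    irrSum n l e h (DirectSum.lof K ι _ i z) =
      DirectSum.lof K ι _ i (irr (n i) (l i) (e i) h z) := by
  simp [irrSum]

variable [CharZero K]

lemma polyAct_irrSum : PolyAct (irrSum (K := K) n l e) := by
  classical
  intro y
  induction y using DirectSum.induction_on with
  | zero => simp only [map_zero]; exact ⟨Submodule.zero_mem _, Submodule.zero_mem _⟩
  | add x y hx hy =>
    simp only [map_add]
    exact ⟨Submodule.add_mem _ hx.1 hy.1, Submodule.add_mem _ hx.2 hy.2⟩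
  | of i z =>
    change (fun s => irrSum n l e _ (DirectSum.lof K ι _ i z)) ∈ _ ∧
      (fun s => irrSum n l e _ (DirectSum.lof K ι _ i z)) ∈ _
    simp only [irrSum_of]
    exact ⟨polyCurve_map (DirectSum.lof K ι _ i) (polyAct_irr _ _ _ z).1,
      polyCurve_map (DirectSum.lof K ι _ i) (polyAct_irr _ _ _ z).2⟩

/-- The components of a vector fixed by the upper unipotent elements are multiples of the highest
weight vectors. -/
lemma exists_eq_smul_hw_of_fixed
    {y : ⨁ i, SymBox K (n i) (l i)}
    (h : ∀ s t : K, irrSum n l e (ofSL (uni s) (uni t)) y = y) :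
    ∃ c : ι → K, ∀ i, y i = c i • hw (n i) (l i) := by
  choose c hc using fun i => eq_smul_hw_of_fixed (e := e i) (y := y i) fun s t => by
    rw [← irrSum_apply_apply, h]
  exact ⟨c, hc⟩

lemma two_pow_mul_three_pow_inj {n l n' l' : ℕ} (h : (2 : K) ^ n * 3 ^ l = 2 ^ n' * 3 ^ l') :
    n = n' ∧ l = l' := by
  have h' : 2 ^ n * 3 ^ l = 2 ^ n' * 3 ^ l' := by exact_mod_cast h
  have h2 := congrArg (fun m => m.factorization 2) h'
  have h3 := congrArg (fun m => m.factorization 3) h'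
  beta_reduce at h2 h3
  rw [Nat.factorization_mul (by positivity) (by positivity),
    Nat.factorization_mul (by positivity) (by positivity),
    Nat.prime_two.factorization_pow, Nat.prime_three.factorization_pow,
    Nat.prime_two.factorization_pow, Nat.prime_three.factorization_pow] at h2 h3
  simpa using And.intro h2 h3

/-- An equivariant map out of a sum of irreducible representations with pairwise different highest
weights is injective as soon as it does not kill any of the highest weight vectors. -/
theorem injective_of_hw [Fintype ι] [DecidableEq ι] {X : Type*} [AddCommMonoid X] [Module K X]
    (ρ : Representation K (H K) X)
    (Ψ : (⨁ i, SymBox K (n i) (l i)) →ₗ[K] X)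
    (hΨ : ∀ h, Ψ ∘ₗ irrSum n l e h = ρ h ∘ₗ Ψ)
    (hne : ∀ i, Ψ (DirectSum.lof K ι _ i (hw (n i) (l i))) ≠ 0)
    (hinj : Function.Injective fun i => (n i, l i)) : Function.Injective Ψ := by
  let _ : AddCommGroup (⨁ i, SymBox K (n i) (l i)) := Module.addCommMonoidToAddCommGroup K
  let _ : AddCommGroup X := Module.addCommMonoidToAddCommGroup K
  rw [← LinearMap.ker_eq_bot]
  by_contra hker
  obtain ⟨y, hy, hy0, hfix⟩ := exists_fixed (irrSum n l e)
    (polyAct_irrSum n l e) (LinearMap.ker Ψ)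
    (fun h y hy => by
      rw [LinearMap.mem_ker] at hy ⊢
      rw [← LinearMap.comp_apply, hΨ, LinearMap.comp_apply, hy, map_zero]) hker
  obtain ⟨c, hc⟩ := exists_eq_smul_hw_of_fixed n l e hfix
  have hsum : ∑ i, c i • Ψ (DirectSum.lof K ι _ i (hw (n i) (l i))) = 0 := by
    rw [← LinearMap.mem_ker.1 hy, ← DirectSum.sum_univ_of y, map_sum]
    refine Finset.sum_congr rfl fun i _ => ?_
    rw [hc, ← map_smul, ← map_smul]
    rfl
  -- the eigenvalues `2 ^ n * 3 ^ l` of a single torus element already separate the weights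
  have hlin : LinearIndependent K fun i => Ψ (DirectSum.lof K ι _ i (hw (n i) (l i))) := by
    refine Module.End.eigenvectors_linearIndependent'
      (ρ (ofSL (diagSL 2 two_ne_zero) (diagSL 3 three_ne_zero)))
      (fun i => 2 ^ n i * 3 ^ l i) (fun i j hij => hinj ?_) _ fun i => ⟨?_, hne i⟩
    · exact Prod.ext (two_pow_mul_three_pow_inj hij).1 (two_pow_mul_three_pow_inj hij).2
    · rw [Module.End.mem_eigenspace_iff, ← LinearMap.comp_apply, ← hΨ, LinearMap.comp_apply,
        irrSum_of, irr_diag_hw, map_smul, map_smul]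
  have hc0 := Fintype.linearIndependent_iff.1 hlin c hsum
  refine hy0 (DFinsupp.ext fun i => ?_)
  rw [hc, hc0, zero_smul]
  rfl

end Sums

/-! ### Subrepresentations of the form `(Sym^d ⊗ μ^e) ⊠ 1` -/

section Transfer

lemma equiv_map {K Γ V W : Type*} [Field K] [Group Γ] [AddCommMonoid V] [Module K V]
    [AddCommMonoid W] [Module K W] {ρ : Representation K Γ V} {σ : Representation K Γ W}
    (φ : ρ.Equiv σ) (g : Γ) (v : V) : φ (ρ g v) = σ g (φ v) :=
  LinearMap.congr_fun (φ.toIntertwiningMap.isIntertwining' g) v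

variable {K Γ V W : Type*} [Field K] [Group Γ] [AddCommGroup V] [Module K V] [AddCommGroup W]
  [Module K W] {ρ : Representation K Γ V} {σ : Representation K Γ W}

/-- The preimage of a subrepresentation under an equivalence. -/
def subrepComap (φ : ρ.Equiv σ) (S : Subrepresentation σ) : Subrepresentation ρ where
  toSubmodule := S.toSubmodule.comap φ.toLinearEquiv.toLinearMap
  apply_mem_toSubmodule g v hv := by
    change φ (ρ g v) ∈ S.toSubmodule
    rw [equiv_map]
    exact S.apply_mem_toSubmodule g hv

lemma isIrreducible_of_equiv (φ : ρ.Equiv σ) (h : σ.IsIrreducible) : ρ.IsIrreducible := by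
  have hn : Nontrivial (Subrepresentation ρ) := by
    obtain ⟨⟨S, T, hST⟩⟩ := h.toNontrivial
    refine ⟨subrepComap φ S, subrepComap φ T, fun e => hST ?_⟩
    apply Subrepresentation.toSubmodule_injective
    exact Submodule.comap_injective_of_surjective (f := φ.toLinearEquiv.toLinearMap)
      φ.toLinearEquiv.surjective (congrArg Subrepresentation.toSubmodule e)
  refine { eq_bot_or_eq_top := fun S => ?_ }
  have hS : S = subrepComap φ (subrepComap φ.symm S) := by
    apply Subrepresentation.toSubmodule_injective
    ext v
    change v ∈ S.toSubmodule ↔ φ.symm (φ v) ∈ S.toSubmodule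
    rw [φ.symm_apply_apply]
  rcases h.eq_bot_or_eq_top (subrepComap φ.symm S) with h' | h'
  · left
    rw [hS, h']
    apply Subrepresentation.toSubmodule_injective
    exact (LinearMap.ker_eq_bot (f := φ.toLinearEquiv.toLinearMap)).2 φ.toLinearEquiv.injective
  · right
    rw [hS, h']
    exact Subrepresentation.toSubmodule_injective rfl

/-- Two irreducible subrepresentations that share a nonzero vector are equal. -/
lemma eq_of_irreducible_of_mem {S T : Subrepresentation ρ} (hS : S.toRepresentation.IsIrreducible)
    (hT : T.toRepresentation.IsIrreducible) {v : V} (hv : v ≠ 0) (hvS : v ∈ S.toSubmodule)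
    (hvT : v ∈ T.toSubmodule) : S = T := by
  have key : ∀ S T : Subrepresentation ρ, S.toRepresentation.IsIrreducible →
      v ∈ S.toSubmodule → v ∈ T.toSubmodule → S.toSubmodule ≤ T.toSubmodule := by
    intro S T hS hvS hvT
    let U : Subrepresentation S.toRepresentation :=
      ⟨T.toSubmodule.comap S.toSubmodule.subtype, fun g w hw => T.apply_mem_toSubmodule g hw⟩
    rcases hS.eq_bot_or_eq_top U with h | h
    · exfalso
      have h2 : (⟨v, hvS⟩ : S.toSubmodule) ∈ U.toSubmodule := hvT
      rw [h] at h2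
      exact hv (congrArg Subtype.val ((Submodule.mem_bot K).1 h2))
    · intro w hw
      have h2 : (⟨w, hw⟩ : S.toSubmodule) ∈ U.toSubmodule := by
        rw [h]; exact Submodule.mem_top
      exact h2
  exact Subrepresentation.toSubmodule_injective
    (le_antisymm (key S T hS hvS hvT) (key T S hT hvT hvS))

/-- The range of an injective equivariant map is equivalent to the source. -/
lemma exists_subrep_equiv (f : W →ₗ[K] V) (hf : Function.Injective f)
    (heq : ∀ g, f ∘ₗ σ g = ρ g ∘ₗ f) :
    ∃ S : Subrepresentation ρ, Nonempty (S.toRepresentation.Equiv σ) := by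
  refine ⟨⟨LinearMap.range f, ?_⟩, ⟨(Representation.Equiv.mk (LinearEquiv.ofInjective f hf)
    fun g => ?_).symm⟩⟩
  · rintro g _ ⟨w, rfl⟩
    exact ⟨σ g w, LinearMap.congr_fun (heq g) w⟩
  · ext w
    exact LinearMap.congr_fun (heq g) w

end Transfer

section SymBoxOne

variable {K : Type*} [Field K]

/-- The degree zero symmetric power is the ground field. -/
def symPowZero : SymPow K (Fin 2 → K) 0 ≃ₗ[K] K :=
  LinearEquiv.ofBijective
    (Polynomial.lcoeff K 0 ∘ₗ dehom.toLinearMap ∘ₗ (SymPow K (Fin 2 → K) 0).subtype) (by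
      have hs : Function.Surjective (Polynomial.lcoeff K 0 ∘ₗ dehom.toLinearMap ∘ₗ
          (SymPow K (Fin 2 → K) 0).subtype) := by
        intro c
        exact ⟨c • pw 0 0, by simp⟩
      refine ⟨(LinearMap.injective_iff_surjective_of_finrank_eq_finrank ?_).2 hs, hs⟩
      simp)

lemma symPowZero_pw (ξ : Fin 2 → K) : symPowZero (pw 0 ξ) = 1 := by
  change (dehom (pw 0 ξ).1).coeff 0 = 1
  simp

lemma symBoxOne_pw (d : ℕ) (e : ℤ) (h : H K) (ξ : Fin 2 → K) (c : K) :
    symBoxOne K d e h (pw d ξ ⊗ₜ c) =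
      (((H.mu K h) ^ e : Kˣ) : K) • (pw d (std K (H.pr₁ K h) ξ) ⊗ₜ[K] c) := by
  change (((Matrix.GeneralLinearGroup.det ^ e : GL (Fin 2) K →* Kˣ) (H.pr₁ K h) : Kˣ) : K) •
    Sym K d (H.pr₁ K h) (pw d ξ) ⊗ₜ[K] c = _
  rw [Sym_pw, TensorProduct.smul_tmul']
  rfl

/-- The highest weight vector of `(Sym^d ⊗ μ^e) ⊠ 1`. -/
def hwOne (d : ℕ) : SymPow K (Fin 2 → K) d ⊗[K] K := pw d ![1, 0] ⊗ₜ 1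

lemma hwOne_ne_zero (d : ℕ) : hwOne (K := K) d ≠ 0 := by
  intro h
  have h2 := congrArg (LinearEquiv.lTensor (SymPow K (Fin 2 → K) d) symPowZero.symm) h
  have h1 : symPowZero.symm 1 = pw (K := K) 0 ![1, 0] := by
    rw [LinearEquiv.symm_apply_eq, symPowZero_pw]
  rw [hwOne, LinearEquiv.lTensor_tmul, LinearEquiv.map_zero, h1] at h2
  exact hw_ne_zero d 0 h2

lemma irr_zero_equiv [CharZero K] (n e : ℕ) :
    Nonempty ((irr (K := K) n 0 e).Equiv (symBoxOne K n e)) := by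
  refine ⟨Representation.Equiv.mk (LinearEquiv.lTensor _ symPowZero) fun h => ?_⟩
  apply symPow_hom_ext
  intro ξ η
  simp only [LinearMap.comp_apply, LinearEquiv.coe_coe]
  rw [irr_pw, LinearEquiv.map_smul, LinearEquiv.lTensor_tmul, LinearEquiv.lTensor_tmul,
    symPowZero_pw, symPowZero_pw, symBoxOne_pw]
  simp

variable [CharZero K] {ι : Type*} [DecidableEq ι] {n l e : ι → ℕ} {X : Type*} [AddCommGroup X]
  [Module K X] {ρ : Representation K (H K) X}

/-- A summand with trivial second factor gives a subrepresentation of the form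
`(Sym^d ⊗ μ^e) ⊠ 1`. -/
lemma exists_isSymBoxOne (Θ : ρ.Equiv (irrSum n l e)) {i : ι} (hi : l i = 0) :
    ∃ S : Subrepresentation ρ, IsSymBoxOne S (n i) (e i) := by
  let f : SymBox K (n i) (l i) →ₗ[K] X :=
    Θ.symm.toLinearEquiv.toLinearMap ∘ₗ DirectSum.lof K ι (fun i => SymBox K (n i) (l i)) i
  have hf : Function.Injective f :=
    Θ.symm.toLinearEquiv.injective.comp (DirectSum.of_injective i)
  obtain ⟨S, ⟨φ⟩⟩ := exists_subrep_equiv (W := SymBox K (n i) (l i)) (ρ := ρ)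
    (σ := irr (n i) (l i) (e i)) f hf fun g => by
      refine LinearMap.ext fun z => ?_
      change Θ.symm (DirectSum.lof K ι (fun i => SymBox K (n i) (l i)) i _) =
        ρ g (Θ.symm (DirectSum.lof K ι (fun i => SymBox K (n i) (l i)) i z))
      rw [← equiv_map, irrSum_of]
  refine ⟨S, isIrreducible_of_equiv φ (isIrreducible_irr _ _ _), ?_⟩
  generalize n i = a at φ
  generalize l i = b at φ hi
  subst hi
  obtain ⟨ψ⟩ := irr_zero_equiv (K := K) a (e i)
  exact ⟨φ.trans ψ⟩

lemma two_pow_inj {m m' : ℕ} (h : (2 : K) ^ m = 2 ^ m') : m = m' := by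
  have h' : 2 ^ m = 2 ^ m' := by
    apply Nat.cast_injective (R := K)
    push_cast
    exact h
  exact Nat.pow_right_injective le_rfl h'

lemma two_zpow_inj {m m' : ℤ} (h : (2 : K) ^ m = 2 ^ m') : m = m' := by
  have h' : (2 : ℚ) ^ m = 2 ^ m' := by
    apply Rat.cast_injective (α := K)
    push_cast
    exact h
  exact zpow_right_injective₀ (by norm_num) (by norm_num) h'

/-- An element of `H` of multiplier two that fixes the highest weight lines. -/
def scaleH : H K :=
  ⟨(Matrix.GeneralLinearGroup.mkOfDetNeZero !![1, 0; 0, 2] (by simp),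
    Matrix.GeneralLinearGroup.mkOfDetNeZero !![1, 0; 0, 2] (by simp)), rfl⟩

lemma mu_scaleH : ((H.mu K scaleH : Kˣ) : K) = 2 := by
  change Matrix.det !![(1 : K), 0; 0, 2] = 2
  simp

lemma std_scaleH :
    std K (H.pr₁ K scaleH) ![1, 0] = ![1, 0] ∧ std K (H.pr₂ K scaleH) ![1, 0] = ![1, 0] := by
  have : (!![(1 : K), 0; 0, 2] : Matrix (Fin 2) (Fin 2) K).mulVec ![1, 0] = ![1, 0] := by
    ext i; fin_cases i <;> simp
  exact ⟨this, this⟩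

/-- A subrepresentation isomorphic to `(Sym^d ⊗ μ^e) ⊠ 1` contains the highest weight vector of a
summand with matching invariants. -/
lemma exists_index_of_isSymBoxOne (Θ : ρ.Equiv (irrSum n l e)) {S : Subrepresentation ρ} {d : ℕ}
    {m : ℤ} (hS : IsSymBoxOne S d m) (hinj : ∀ i j, l i = 0 → l j = 0 → e i = e j → i = j) :
    ∃ i, n i = d ∧ l i = 0 ∧ (e i : ℤ) = m ∧
      Θ.symm (DirectSum.lof K ι (fun i => SymBox K (n i) (l i)) i (hw (n i) (l i))) ∈
        S.toSubmodule := by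
  obtain ⟨-, ⟨φ⟩⟩ := hS
  set z : S.toSubmodule := φ.symm (hwOne d) with hz
  have hz0 : z ≠ 0 := by
    intro h
    have h2 := congrArg φ h
    rw [hz, φ.apply_symm_apply, map_zero] at h2
    exact hwOne_ne_zero d h2
  set y := Θ z.1 with hy
  have hy0 : y ≠ 0 := by
    intro h
    apply hz0
    have h2 := congrArg Θ.symm h
    rw [hy, Θ.symm_apply_apply, map_zero] at h2
    exact Subtype.ext h2
  have hact : ∀ (h : H K) (c : K), symBoxOne K d m h (hwOne d) = c • hwOne d →
      irrSum n l e h y = c • y := by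
    intro h c hc
    have h1 : S.toRepresentation h z = c • z := by
      rw [hz, ← equiv_map φ.symm, hc, map_smul]
    have h2 : ρ h z.1 = c • z.1 := congrArg Subtype.val h1
    rw [hy, ← equiv_map, h2, map_smul]
  have hfix : ∀ s t : K, irrSum n l e (ofSL (uni s) (uni t)) y = y := by
    intro s t
    rw [hact (ofSL (uni s) (uni t)) 1 ?_, one_smul]
    rw [hwOne, symBoxOne_pw, mu_ofSL, std_pr₁_ofSL, one_zpow, Units.val_one]
    congr 3
    ext i; fin_cases i <;> simp [uni]
  obtain ⟨c, hc⟩ := exists_eq_smul_hw_of_fixed n l e hfix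
  have hcomp : ∀ (h : H K) (a : K) (i : ι) (b : K), symBoxOne K d m h (hwOne d) = a • hwOne d →
      irr (n i) (l i) (e i) h (hw (n i) (l i)) = b • hw (n i) (l i) → c i ≠ 0 → b = a := by
    intro h a i b ha hb hci
    have h1 : irr (n i) (l i) (e i) h (y i) = (a • y) i := by
      rw [← irrSum_apply_apply, hact h a ha]
    rw [DirectSum.smul_apply, hc, map_smul, hb] at h1
    have h2 := congrArg (evalAt (n i) (l i) 0 0) h1
    simp only [map_smul, evalAt_hw, smul_eq_mul, mul_one] at h2
    rw [mul_comm] at h2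
    exact mul_right_cancel₀ hci h2
  have hdiag (x w : K) (hx : x ≠ 0) (hw : w ≠ 0) : symBoxOne K d m
      (ofSL (diagSL x hx) (diagSL w hw)) (hwOne d) =
        x ^ d • hwOne d := by
    have : (![x, 0] : Fin 2 → K) = x • ![1, 0] := by
      ext i; fin_cases i <;> simp
    rw [hwOne, symBoxOne_pw, mu_ofSL, std_pr₁_ofSL, one_zpow, Units.val_one, one_smul, lowSL_mulVec,
      this, TensorProduct.smul_tmul']
    congr 1
    apply Subtype.ext
    rw [coe_pw, map_smul, _root_.smul_pow]
    rfl
  -- two diagonal elements and `scaleH` read off the three invariants of each component of `y`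
  have hwt : ∀ i, c i ≠ 0 → n i = d ∧ l i = 0 ∧ (e i : ℤ) = m := by
    intro i hi
    refine ⟨?_, ?_, ?_⟩
    · have := hcomp _ _ i _ (hdiag 2 1 two_ne_zero one_ne_zero) (irr_diag_hw _ _ _ _ _ _ _) hi
      rw [one_pow, mul_one] at this
      exact two_pow_inj this
    · have := hcomp _ _ i _ (hdiag 1 2 one_ne_zero two_ne_zero) (irr_diag_hw _ _ _ _ _ _ _) hi
      rw [one_pow, one_pow, one_mul] at this
      exact two_pow_inj (K := K) (this.trans (pow_zero (2 : K)).symm)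
    · have h1 : symBoxOne K d m scaleH (hwOne d) =
          (2 : K) ^ m • hwOne d := by
        rw [hwOne, symBoxOne_pw, std_scaleH.1, Units.val_zpow_eq_zpow_val, mu_scaleH]
      have h2 : irr (n i) (l i) (e i) (scaleH (K := K)) (hw (n i) (l i)) =
          ((2 : K) ^ (e i)) • hw (n i) (l i) := by
        rw [hw, irr_pw, std_scaleH.1, std_scaleH.2, mu_scaleH]
      have := hcomp _ _ i _ h1 h2 hi
      rw [← zpow_natCast] at this
      exact two_zpow_inj this
  obtain ⟨i, hi⟩ : ∃ i, c i ≠ 0 := by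
    by_contra! hall
    exact hy0 (DFinsupp.ext fun i => by rw [hc, hall, zero_smul]; rfl)
  obtain ⟨h1, h2, h3⟩ := hwt i hi
  refine ⟨i, h1, h2, h3, ?_⟩
  have hyi : y = c i • DirectSum.lof K ι (fun i => SymBox K (n i) (l i)) i (hw (n i) (l i)) := by
    refine DFinsupp.ext fun j => ?_
    by_cases hj : j = i
    · subst hj
      rw [hc, DirectSum.smul_apply, DirectSum.lof_apply]
    · have hcj : c j = 0 := by
        by_contra hcj
        obtain ⟨-, h2', h3'⟩ := hwt j hcj
        exact hj (hinj j i h2' h2 (by omega))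
      rw [hc, hcj, zero_smul]
      change 0 = (c i • DirectSum.lof K ι (fun i => SymBox K (n i) (l i)) i (hw (n i) (l i))) j
      rw [DirectSum.smul_apply, DirectSum.lof_eq_of, DirectSum.of_eq_of_ne _ _ _ hj, smul_zero]
  have hz' : Θ.symm (DirectSum.lof K ι (fun i => SymBox K (n i) (l i)) i (hw (n i) (l i))) =
      (c i)⁻¹ • z.1 := by
    rw [← Θ.symm_apply_apply z.1, ← hy, hyi, map_smul, inv_smul_smul₀ hi]
  rw [hz']
  exact S.toSubmodule.smul_mem _ z.2

/-- If the summands of the form `(Sym^d ⊗ μ^e) ⊠ 1` have different exponents `e`, then there is at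
most one subrepresentation isomorphic to each of them. -/
lemma isSymBoxOne_unique (Θ : ρ.Equiv (irrSum n l e)) {S S' : Subrepresentation ρ} {d : ℕ} {m : ℤ}
    (hS : IsSymBoxOne S d m) (hS' : IsSymBoxOne S' d m)
    (hinj : ∀ i j, l i = 0 → l j = 0 → e i = e j → i = j) : S = S' := by
  obtain ⟨i, -, hi, hie, hiS⟩ := exists_index_of_isSymBoxOne Θ hS hinj
  obtain ⟨j, -, hj, hje, hjS⟩ := exists_index_of_isSymBoxOne Θ hS' hinj
  obtain rfl := hinj i j hi hj (by omega)
  refine eq_of_irreducible_of_mem hS.1 hS'.1 (fun h => ?_) hiS hjS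
  have h2 := congrArg (fun w => Θ w i) h
  simp only [Θ.apply_symm_apply, map_zero] at h2
  rw [DirectSum.lof_apply] at h2
  exact hw_ne_zero _ _ h2

end SymBoxOne

/-! ### Elements of the symplectic similitude group -/

section Elements

variable {K : Type*} [Field K]

lemma J_mul_J : J K * J K = -1 := by
  ext i j
  fin_cases i <;> fin_cases j <;> simp [J, Matrix.mul_apply, Fin.sum_univ_four]

/-- A matrix that satisfies the symplectic similitude relation with multiplier `m`, as an element
of `GSp₄(K)`. -/
def mkGSp (A : Matrix (Fin 4) (Fin 4) K) (m : Kˣ) (h : A.transpose * J K * A = (m : K) • J K) :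
    GSp4 K :=
  have hinv : ((m⁻¹ : Kˣ) : K) • (-J K * A.transpose * J K) * A = 1 := by
    rw [Matrix.smul_mul, Matrix.mul_assoc, Matrix.mul_assoc, ← Matrix.mul_assoc A.transpose, h,
      Matrix.mul_smul, Matrix.neg_mul, J_mul_J, neg_neg, smul_smul, Units.inv_mul, one_smul]
  ⟨(⟨A, ((m⁻¹ : Kˣ) : K) • (-J K * A.transpose * J K), mul_eq_one_comm.1 hinv, hinv⟩, m), h⟩

@[simp] lemma entries_mkGSp (A : Matrix (Fin 4) (Fin 4) K) (m : Kˣ) (h) :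
    entries (mkGSp A m h) = A := rfl

@[simp] lemma multiplier_mkGSp (A : Matrix (Fin 4) (Fin 4) K) (m : Kˣ) (h) :
    multiplier K (mkGSp A m h) = m := rfl

@[simp] lemma entries_mul (g h : GSp4 K) : entries (g * h) = entries g * entries h := rfl

@[simp] lemma entries_one : entries (1 : GSp4 K) = 1 := rfl

lemma entries_rel (g : GSp4 K) :
    (entries g).transpose * J K * entries g = ((multiplier K g : Kˣ) : K) • J K := g.2

/-- The multiplier is determined by the matrix. -/
lemma ext_entries {g h : GSp4 K} (e : entries g = entries h) : g = h := by
  apply Subtype.ext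
  refine Prod.ext (Units.ext e) (Units.ext
    (?_ : ((multiplier K g : Kˣ) : K) = ((multiplier K h : Kˣ) : K)))
  have h1 := entries_rel g
  rw [e, entries_rel h] at h1
  have h2 := congrFun (congrFun h1 0) 3
  simpa [J, eq_comm] using h2

lemma entries_rel' (g : GSp4 K) :
    entries g * J K * (entries g).transpose = ((multiplier K g : Kˣ) : K) • J K := by
  set A := entries g
  set m := multiplier K g
  have h1 : ((m⁻¹ : Kˣ) : K) • (-J K * A.transpose * J K) * A = 1 := by
    rw [Matrix.smul_mul, Matrix.mul_assoc, Matrix.mul_assoc, ← Matrix.mul_assoc A.transpose,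
      entries_rel, Matrix.mul_smul, Matrix.neg_mul, J_mul_J, neg_neg, smul_smul, Units.inv_mul,
      one_smul]
  have h2 := mul_eq_one_comm.1 h1
  rw [Matrix.mul_smul] at h2
  have h3 : A * (-J K * A.transpose * J K) = (m : K) • 1 := by
    rw [← h2, smul_smul, Units.mul_inv, one_smul]
  calc A * J K * A.transpose = A * (-J K * A.transpose * J K) * J K := by
        simp only [Matrix.mul_assoc, J_mul_J, Matrix.neg_mul, Matrix.mul_neg, Matrix.mul_one,
          neg_neg]
    _ = (m : K) • J K := by rw [h3, Matrix.smul_mul, Matrix.one_mul]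

/-- The transpose of an element of `GSp₄(K)`. -/
def transp (g : GSp4 K) : GSp4 K :=
  mkGSp (entries g).transpose (multiplier K g) (by
    rw [Matrix.transpose_transpose, entries_rel'])

lemma rel_col (g : GSp4 K) (i j : Fin 4) :
    entries g 0 i * entries g 3 j + entries g 1 i * entries g 2 j - entries g 2 i * entries g 1 j
      - entries g 3 i * entries g 0 j = ((multiplier K g : Kˣ) : K) * J K i j := by
  have h := congrFun (congrFun (entries_rel g) i) j
  simp only [Matrix.smul_apply, smul_eq_mul] at h
  rw [← h]
  simp [J, Matrix.mul_apply, Fin.sum_univ_four]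
  ring

/-- The transpose of a symplectic similitude is one as well, so the first two rows satisfy a
relation. It identifies the outer and the inner minor up to sign. -/
lemma rel_row (g : GSp4 K) :
    entries g 0 0 * entries g 1 3 + entries g 0 1 * entries g 1 2 - entries g 0 2 * entries g 1 1
      - entries g 0 3 * entries g 1 0 = 0 := by
  have h := rel_col (transp g) 0 1
  simpa [transp, J] using h

lemma entries_mulVec_eq_zero (g : GSp4 K) (w : Fin 4 → K) (h : (entries g).mulVec w = 0) :
    w = 0 := by
  have h2 : (entries g⁻¹ * entries g).mulVec w = 0 := by
    rw [← Matrix.mulVec_mulVec, h, Matrix.mulVec_zero]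
  rwa [← entries_mul, inv_mul_cancel, entries_one, Matrix.one_mulVec] at h2

/-- The upper unipotent elements of `GSp₄(K)`. -/
def up (a b c d : K) : GSp4 K :=
  mkGSp !![1, a, b, c; 0, 1, d, b - a * d; 0, 0, 1, -a; 0, 0, 0, 1] 1 (by
    ext i j
    fin_cases i <;> fin_cases j <;> simp [J, Matrix.mul_apply, Fin.sum_univ_four] <;> ring)

/-- The lower unipotent elements of `GSp₄(K)`. -/
def low (a b c d : K) : GSp4 K := transp (up a b c d)

lemma entries_up (a b c d : K) :
    entries (up a b c d) = !![1, a, b, c; 0, 1, d, b - a * d; 0, 0, 1, -a; 0, 0, 0, 1] := rfl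

lemma entries_low (a b c d : K) :
    entries (low a b c d) = !![1, 0, 0, 0; a, 1, 0, 0; b, d, 1, 0; c, b - a * d, -a, 1] := by
  change Matrix.transpose !![1, a, b, c; 0, 1, d, b - a * d; 0, 0, 1, -a; 0, 0, 0, 1] = _
  ext i j
  fin_cases i <;> fin_cases j <;> rfl

@[simp] lemma multiplier_up (a b c d : K) : multiplier K (up a b c d) = 1 := rfl

@[simp] lemma multiplier_low (a b c d : K) : multiplier K (low a b c d) = 1 := rfl

lemma low_zero : low (0 : K) 0 0 0 = 1 := by
  apply ext_entries
  rw [entries_low, entries_one]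
  ext i j
  fin_cases i <;> fin_cases j <;> simp

lemma up_zero : up (0 : K) 0 0 0 = 1 := by
  apply ext_entries
  rw [entries_up, entries_one]
  ext i j
  fin_cases i <;> fin_cases j <;> simp

lemma low_mul_low (a b c d : K) : low a b c d * low (-a) (a * d - b) (-c) (-d) = 1 := by
  apply ext_entries
  rw [entries_mul, entries_low, entries_low, entries_one]
  ext i j
  fin_cases i <;> fin_cases j <;> simp [Matrix.mul_apply, Fin.sum_univ_four] <;> ring

/-- The cocharacter `s ↦ diag(1, s, s², s³)`. It contracts the lower unipotent group, and its
inverse contracts the upper one, as `s` tends to `0`. -/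
def cochar (s : Kˣ) : GSp4 K :=
  mkGSp (Matrix.diagonal ![1, (s : K), (s : K) ^ 2, (s : K) ^ 3]) (s ^ 3) (by
    ext i j
    fin_cases i <;> fin_cases j <;> simp [J, Matrix.mul_apply, Fin.sum_univ_four] <;> ring)

lemma entries_cochar (s : Kˣ) :
    entries (cochar s) = Matrix.diagonal ![1, (s : K), (s : K) ^ 2, (s : K) ^ 3] := rfl

lemma cochar_mul_low (s : Kˣ) (a b c d : K) :
    cochar s * low a b c d =
      low (s * a) (s ^ 2 * b) (s ^ 3 * c) (s * d) * cochar s := by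
  apply ext_entries
  rw [entries_mul, entries_mul, entries_low, entries_low, entries_cochar]
  ext i j
  fin_cases i <;> fin_cases j <;> simp <;> ring

lemma up_mul_cochar (s : Kˣ) (a b c d : K) :
    up a b c d * cochar s =
      cochar s * up (s * a) (s ^ 2 * b) (s ^ 3 * c) (s * d) := by
  apply ext_entries
  rw [entries_mul, entries_mul, entries_up, entries_up, entries_cochar]
  ext i j
  fin_cases i <;> fin_cases j <;> simp <;> ring

/-- The leading `2 × 2` minor. -/
def minor (g : GSp4 K) : K := entries g 0 0 * entries g 1 1 - entries g 0 1 * entries g 1 0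

/-- On the big cell an element is the product of a lower unipotent and an upper triangular one. -/
lemma exists_low_mul (g : GSp4 K) (h0 : entries g 0 0 ≠ 0) (h1 : minor g ≠ 0) :
    ∃ (a b c d : K) (B : GSp4 K), g = low a b c d * B ∧ (entries B).BlockTriangular id := by
  set A := entries g with hA
  obtain ⟨a, ha⟩ : ∃ a, a * A 0 0 = A 1 0 := ⟨A 1 0 / A 0 0, div_mul_cancel₀ _ h0⟩
  obtain ⟨b, hb⟩ : ∃ b, b * A 0 0 = A 2 0 := ⟨A 2 0 / A 0 0, div_mul_cancel₀ _ h0⟩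
  obtain ⟨c, hc⟩ : ∃ c, c * A 0 0 = A 3 0 := ⟨A 3 0 / A 0 0, div_mul_cancel₀ _ h0⟩
  obtain ⟨d, hd⟩ : ∃ d, d * minor g = A 0 0 * A 2 1 - A 0 1 * A 2 0 :=
    ⟨_ / minor g, div_mul_cancel₀ _ h1⟩
  set B := low (-a) (a * d - b) (-c) (-d) * g with hB
  have hBe : entries B = !![1, 0, 0, 0; -a, 1, 0, 0; a * d - b, -d, 1, 0; -c, -b, a, 1] * A := by
    rw [hB, entries_mul, entries_low]
    congr 1
    simp
  have e00 : entries B 0 0 = A 0 0 := by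
    rw [hBe]; simp [Matrix.mul_apply, Fin.sum_univ_four]
  have e10 : entries B 1 0 = 0 := by
    rw [hBe]; simp [Matrix.mul_apply, Fin.sum_univ_four]
    linear_combination -ha
  have e20 : entries B 2 0 = 0 := by
    rw [hBe]; simp [Matrix.mul_apply, Fin.sum_univ_four]
    linear_combination d * ha - hb
  have e30 : entries B 3 0 = 0 := by
    rw [hBe]; simp [Matrix.mul_apply, Fin.sum_univ_four]
    linear_combination b * ha - a * hb - hc
  have e21 : entries B 2 1 = 0 := by
    rw [hBe]; simp [Matrix.mul_apply, Fin.sum_univ_four]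
    apply mul_left_cancel₀ h0
    rw [minor, ← hA] at hd
    linear_combination -hd + d * A 0 1 * ha - A 0 1 * hb
  have e31 : entries B 3 1 = 0 := by
    have h := rel_col B 0 1
    rw [e10, e20, e30, e00] at h
    apply mul_left_cancel₀ h0
    simpa [J] using h
  have e11 : entries B 1 1 ≠ 0 := by
    intro h
    apply h1
    rw [hBe] at h
    simp [Matrix.mul_apply, Fin.sum_univ_four] at h
    rw [minor, ← hA]
    linear_combination A 0 0 * h + A 0 1 * ha
  have e32 : entries B 3 2 = 0 := by
    have h := rel_col B 0 2
    rw [e10, e20, e30, e00] at h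
    apply mul_left_cancel₀ h0
    simpa [J] using h
  refine ⟨a, b, c, d, B, ?_, ?_⟩
  · rw [hB, ← mul_assoc, low_mul_low, one_mul]
  · intro i j hij
    fin_cases i <;> fin_cases j <;> first | exact absurd hij (by decide) | assumption

end Elements

/-! ### Regular functions -/

section Regular

variable {K : Type*} [Field K]

/-- A regular function pulled back along a map whose coordinates lie in an algebra of functions
lies in that algebra. -/
lemma regular_comp_mem {T : Type*} (γ : T → GSp4 K) (C : Subalgebra K (T → K))
    (hent : ∀ i j, (fun t => entries (γ t) i j) ∈ C)
    (hmu : (fun t => (((multiplier K (γ t))⁻¹ : Kˣ) : K)) ∈ C) {F : GSp4 K → K}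
    (hF : F ∈ regularFunctions K) : (fun t => F (γ t)) ∈ C := by
  induction hF using Algebra.adjoin_induction with
  | mem x hx =>
    rcases hx with ⟨⟨i, j⟩, rfl⟩ | rfl
    · exact hent i j
    · exact hmu
  | algebraMap r => exact C.algebraMap_mem r
  | add x y _ _ hx hy => exact C.add_mem hx hy
  | mul x y _ _ hx hy => exact C.mul_mem hx hy

lemma entry_mem_regular (i j : Fin 4) : (fun g : GSp4 K => entries g i j) ∈ regularFunctions K :=
  Algebra.subset_adjoin (Or.inl ⟨(i, j), rfl⟩)

lemma inv_multiplier_mem_regular :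
    (fun g : GSp4 K => (((multiplier K g)⁻¹ : Kˣ) : K)) ∈ regularFunctions K :=
  Algebra.subset_adjoin (Or.inr rfl)

lemma regular_left_mul (g : GSp4 K) {F : GSp4 K → K} (hF : F ∈ regularFunctions K) :
    (fun h => F (g * h)) ∈ regularFunctions K := by
  refine regular_comp_mem _ _ (fun i j => ?_) ?_ hF
  · have : (fun h : GSp4 K => entries (g * h) i j) =
        ∑ k, entries g i k • fun h : GSp4 K => entries h k j := by
      funext h
      simp [Matrix.mul_apply]
    rw [this]
    exact Subalgebra.sum_mem _ fun k _ => Subalgebra.smul_mem _ (entry_mem_regular k j) _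
  · have : (fun h : GSp4 K => (((multiplier K (g * h))⁻¹ : Kˣ) : K)) =
        (((multiplier K g)⁻¹ : Kˣ) : K) • fun h : GSp4 K => (((multiplier K h)⁻¹ : Kˣ) : K) := by
      funext h
      simp [mul_comm]
    rw [this]
    exact Subalgebra.smul_mem _ inv_multiplier_mem_regular _

variable (K) in
/-- The algebra of polynomial functions in one variable. -/
def polyFun : Subalgebra K (K → K) := (Polynomial.aeval (id : K → K)).range

lemma mem_polyFun {f : K → K} : f ∈ polyFun K ↔ ∃ p : K[X], ∀ s, p.eval s = f s := by
  constructor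
  · rintro ⟨p, rfl⟩
    exact ⟨p, fun s => by
      simp [Polynomial.aeval_def, Polynomial.eval₂_eq_sum, Polynomial.eval_eq_sum,
        Polynomial.sum]⟩
  · rintro ⟨p, hp⟩
    exact ⟨p, funext fun s => by
      rw [← hp]
      simp [Polynomial.aeval_def, Polynomial.eval₂_eq_sum, Polynomial.eval_eq_sum,
        Polynomial.sum]⟩

lemma eval_mem_polyFun (p : K[X]) : (fun s => p.eval s) ∈ polyFun K :=
  mem_polyFun.2 ⟨p, fun _ => rfl⟩

lemma const_mem_polyFun (c : K) : (fun _ => c) ∈ polyFun K :=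
  mem_polyFun.2 ⟨C c, fun s => by simp⟩

/-- A regular function is polynomial along a curve whose entries are polynomial, if the multiplier
is constant. -/
lemma regular_curve {F : GSp4 K → K} (hF : F ∈ regularFunctions K) (γ : K → GSp4 K)
    (hγ : ∀ i j, (fun t => entries (γ t) i j) ∈ polyFun K) (m : Kˣ)
    (hm : ∀ t, multiplier K (γ t) = m) : ∃ p : K[X], ∀ s, p.eval s = F (γ s) :=
  mem_polyFun.1 (regular_comp_mem γ _ hγ
    (by simpa only [hm] using const_mem_polyFun (((m⁻¹ : Kˣ) : K))) hF)

/-- If a regular function vanishes at almost all points of a polynomial curve through `g`, then it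
vanishes at `g`. -/
lemma regular_eq_zero_of_curve [Infinite K] {F : GSp4 K → K} (hF : F ∈ regularFunctions K)
    (g : GSp4 K) (a b c d : K) (q : K[X]) (hq : q ≠ 0)
    (h : ∀ t, q.eval t ≠ 0 → F (up (t * a) (t * b) (t * c) (t * d) * g) = 0) : F g = 0 := by
  have hentry (p : Matrix (Fin 4) (Fin 4) K[X]) (i j : Fin 4) :
      (fun t => ((p.map (Polynomial.eval t)) * entries g) i j) ∈ polyFun K := by
    have : (fun t => ((p.map (Polynomial.eval t)) * entries g) i j) =
        fun t => (∑ k, p i k * C (entries g k j)).eval t := by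
      funext t
      simp [Matrix.mul_apply, Polynomial.eval_finsetSum]
    rw [this]
    exact eval_mem_polyFun _
  have hcurve : ∀ t : K, entries (up (t * a) (t * b) (t * c) (t * d) * g) =
      (!![1, Polynomial.X * C a, Polynomial.X * C b, Polynomial.X * C c;
        0, 1, Polynomial.X * C d, Polynomial.X * C b - Polynomial.X * C a * (Polynomial.X * C d);
        0, 0, 1, -(Polynomial.X * C a); 0, 0, 0, 1] : Matrix (Fin 4) (Fin 4) K[X]).map
          (Polynomial.eval t) * entries g := by
    intro t
    rw [entries_mul, entries_up]
    congr 1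
    ext i j
    fin_cases i <;> fin_cases j <;> simp <;> ring
  obtain ⟨p, hp⟩ := regular_curve hF (fun t => up (t * a) (t * b) (t * c) (t * d) * g)
    (fun i j => by simp only [hcurve]; exact hentry _ i j) (multiplier K g) (fun t => by simp)
  have hpq : p * q = 0 := by
    apply Polynomial.funext
    intro t
    rw [Polynomial.eval_mul, Polynomial.eval_zero, hp]
    by_cases ht : q.eval t = 0
    · rw [ht, mul_zero]
    · rw [h t ht, zero_mul]
  have hp0 : p = 0 := (mul_eq_zero.1 hpq).resolve_right hq
  have h0 := hp 0
  rw [hp0, Polynomial.eval_zero] at h0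
  simp only [zero_mul, up_zero, one_mul] at h0
  exact h0.symm

/-- A regular function that vanishes on the big cell is zero: along a curve of upper unipotent left
translates, first the entry `(0, 0)` and then the leading minor become nonzero. -/
lemma regular_eq_zero_of_bigCell [Infinite K] {F : GSp4 K → K} (hF : F ∈ regularFunctions K)
    (h : ∀ g, entries g 0 0 ≠ 0 → minor g ≠ 0 → F g = 0) (g : GSp4 K) : F g = 0 := by
  have step : ∀ g, entries g 0 0 ≠ 0 → F g = 0 := by
    intro g h0
    refine regular_eq_zero_of_curve hF g 0 0 0 1
      (C (minor g) + C (entries g 0 0 * entries g 2 1 - entries g 0 1 * entries g 2 0)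
        * Polynomial.X) (fun hz => ?_) fun t ht => h _ ?_ ?_
    · have hm1 : minor g = 0 := by
        have := congrArg (fun p => p.coeff 0) hz
        simpa using this
      have hm2 : entries g 0 0 * entries g 2 1 - entries g 0 1 * entries g 2 0 = 0 := by
        have := congrArg (fun p => p.coeff 1) hz
        simpa [Polynomial.coeff_C] using this
      have hm3 : entries g 0 0 * entries g 3 1 - entries g 0 1 * entries g 3 0 = 0 := by
        have hr := rel_col g 0 1
        have hJ : J K 0 1 = 0 := by simp [J]
        rw [hJ, mul_zero] at hr
        rw [minor] at hm1
        apply mul_left_cancel₀ h0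
        linear_combination (entries g 0 0) * hr - entries g 1 0 * hm2 + entries g 2 0 * hm1
      have hw := entries_mulVec_eq_zero g ![entries g 0 1, -entries g 0 0, 0, 0] (by
        rw [minor] at hm1
        ext i
        fin_cases i <;> simp [Matrix.mulVec, dotProduct, Fin.sum_univ_four]
        · ring
        · linear_combination -hm1
        · linear_combination -hm2
        · linear_combination -hm3)
      have := congrFun hw 1
      exact h0 (by simpa using this)
    · simpa [entries_up, Matrix.mul_apply, Fin.sum_univ_four] using h0
    · convert ht using 1
      simp [minor, entries_up, Matrix.mul_apply, Fin.sum_univ_four]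
      ring
  by_cases h0 : entries g 0 0 = 0
  swap
  · exact step g h0
  by_cases h1 : entries g 1 0 = 0
  swap
  · refine regular_eq_zero_of_curve hF g 1 0 0 0 (C (entries g 1 0) * Polynomial.X)
      (by simpa using h1) fun t ht => step _ ?_
    rw [Polynomial.eval_mul, Polynomial.eval_C, Polynomial.eval_X, mul_comm] at ht
    simpa [entries_up, Matrix.mul_apply, Fin.sum_univ_four, h0] using ht
  by_cases h2 : entries g 2 0 = 0
  swap
  · refine regular_eq_zero_of_curve hF g 0 1 0 0 (C (entries g 2 0) * Polynomial.X)
      (by simpa using h2) fun t ht => step _ ?_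
    rw [Polynomial.eval_mul, Polynomial.eval_C, Polynomial.eval_X, mul_comm] at ht
    simpa [entries_up, Matrix.mul_apply, Fin.sum_univ_four, h0] using ht
  by_cases h3 : entries g 3 0 = 0
  swap
  · refine regular_eq_zero_of_curve hF g 0 0 1 0 (C (entries g 3 0) * Polynomial.X)
      (by simpa using h3) fun t ht => step _ ?_
    rw [Polynomial.eval_mul, Polynomial.eval_C, Polynomial.eval_X, mul_comm] at ht
    simpa [entries_up, Matrix.mul_apply, Fin.sum_univ_four, h0] using ht
  have hw := entries_mulVec_eq_zero g ![1, 0, 0, 0] (by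
    ext i
    fin_cases i <;> simp [Matrix.mulVec, dotProduct, Fin.sum_univ_four, h0, h1, h2, h3])
  have := congrFun hw 0
  simp at this

end Regular

/-! ### The model of `V^{a,b}` in the regular functions -/

section Model

variable {K : Type*} [Field K]

/-- Right translation of functions on `GSp₄(K)`, as an algebra endomorphism. -/
def rtrans (h : GSp4 K) : (GSp4 K → K) →ₐ[K] (GSp4 K → K) where
  toFun F g := F (g * h)
  map_one' := rfl
  map_mul' _ _ := rfl
  map_zero' := rfl
  map_add' _ _ := rfl
  commutes' _ := rfl

@[simp] lemma rtrans_apply (h : GSp4 K) (F : GSp4 K → K) (g : GSp4 K) :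
    rtrans h F g = F (g * h) := rfl

variable (K) in
/-- The right regular representation of `GSp₄(K)`. -/
def rreg : Representation K (GSp4 K) (GSp4 K → K) where
  toFun h := (rtrans h).toLinearMap
  map_one' := by
    ext F g
    simp
  map_mul' h h' := by
    ext F g
    simp [mul_assoc]

lemma rreg_apply (h : GSp4 K) (F : GSp4 K → K) : rreg K h F = rtrans h F := rfl

variable (K) in
/-- The function `g ↦ g₀₀^b · (leading 2 × 2 minor)^a`, the highest weight vector. -/
def hwFun (a b : ℕ) : GSp4 K → K := fun g => entries g 0 0 ^ b * minor g ^ a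

variable (K) in
/-- The span of the right translates of `hwFun`: a model of `V^{a,b}`. -/
def model (a b : ℕ) : Subrepresentation (rreg K) where
  toSubmodule := Submodule.span K (Set.range fun h => rtrans h (hwFun K a b))
  apply_mem_toSubmodule h F hF := by
    induction hF using Submodule.span_induction with
    | mem x hx =>
      obtain ⟨h', rfl⟩ := hx
      refine Submodule.subset_span ⟨h * h', ?_⟩
      funext g
      simp [rreg_apply, mul_assoc]
    | zero => rw [map_zero]; exact Submodule.zero_mem _
    | add x y _ _ hx hy => rw [map_add]; exact Submodule.add_mem _ hx hy
    | smul c x _ hx => rw [map_smul]; exact Submodule.smul_mem _ c hx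

lemma rtrans_hwFun_mem (a b : ℕ) (h : GSp4 K) :
    rtrans h (hwFun K a b) ∈ (model K a b).toSubmodule := Submodule.subset_span ⟨h, rfl⟩

lemma hwFun_mem (a b : ℕ) : hwFun K a b ∈ (model K a b).toSubmodule := by
  have := rtrans_hwFun_mem a b (1 : GSp4 K)
  convert this using 1
  funext g
  simp

lemma hwFun_one (a b : ℕ) : hwFun K a b 1 = 1 := by simp [hwFun, minor]

lemma rtrans_hwFun (a b : ℕ) (h : GSp4 K) : (fun h => rtrans h (hwFun K a b)) h =
    (fun g => entries (g * h) 0 0) ^ b *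
      ((fun g => entries (g * h) 0 0) * (fun g => entries (g * h) 1 1) -
        (fun g => entries (g * h) 0 1) * fun g => entries (g * h) 1 0) ^ a := by
  funext g
  simp only [rtrans_apply, hwFun, minor, Pi.mul_apply, Pi.pow_apply, Pi.sub_apply]

lemma hwFun_mem_regular (a b : ℕ) : hwFun K a b ∈ regularFunctions K := by
  have h : hwFun K a b = (fun g => entries g 0 0) ^ b *
      ((fun g => entries g 0 0) * (fun g => entries g 1 1) -
        (fun g => entries g 0 1) * fun g => entries g 1 0) ^ a := by
    funext g
    simp [hwFun, minor]
  rw [h]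
  have he (i j : Fin 4) := entry_mem_regular (K := K) i j
  exact mul_mem (pow_mem (he _ _) _) (pow_mem (sub_mem (mul_mem (he _ _) (he _ _))
    (mul_mem (he _ _) (he _ _))) _)

lemma entries_lower_mul {B : GSp4 K} (hB : (entries B).BlockTriangular id) (g : GSp4 K)
    (j : Fin 4) : entries (transp B * g) 0 j = entries B 0 0 * entries g 0 j ∧
      entries (transp B * g) 1 j = entries B 0 1 * entries g 0 j + entries B 1 1 * entries g 1 j := by
  have h10 : entries B 1 0 = 0 := hB (by decide)
  have h20 : entries B 2 0 = 0 := hB (by decide)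
  have h30 : entries B 3 0 = 0 := hB (by decide)
  have h21 : entries B 2 1 = 0 := hB (by decide)
  have h31 : entries B 3 1 = 0 := hB (by decide)
  simp [transp, Matrix.mul_apply, Fin.sum_univ_four, h10, h20, h30, h21, h31]

lemma hwFun_lower_mul (a b : ℕ) {B : GSp4 K} (hB : (entries B).BlockTriangular id) (g : GSp4 K) :
    hwFun K a b (transp B * g) =
      (entries B 0 0 ^ (a + b) * entries B 1 1 ^ a) * hwFun K a b g := by
  have hm : minor (transp B * g) = entries B 0 0 * entries B 1 1 * minor g := by
    rw [minor, (entries_lower_mul hB g 0).1, (entries_lower_mul hB g 0).2,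
      (entries_lower_mul hB g 1).1, (entries_lower_mul hB g 1).2, minor]
    ring
  rw [hwFun, hwFun, hm, (entries_lower_mul hB g 0).1]
  ring

lemma hwFun_mul_upper (a b : ℕ) (g : GSp4 K) {B : GSp4 K} (hB : (entries B).BlockTriangular id) :
    hwFun K a b (g * B) = (entries B 0 0 ^ (a + b) * entries B 1 1 ^ a) * hwFun K a b g := by
  have h10 : entries B 1 0 = 0 := hB (by decide)
  have h20 : entries B 2 0 = 0 := hB (by decide)
  have h30 : entries B 3 0 = 0 := hB (by decide)
  have h21 : entries B 2 1 = 0 := hB (by decide)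
  have h31 : entries B 3 1 = 0 := hB (by decide)
  have h0 (i : Fin 4) : entries (g * B) i 0 = entries g i 0 * entries B 0 0 := by
    simp [Matrix.mul_apply, Fin.sum_univ_four, h10, h20, h30]
  have h1 (i : Fin 4) : entries (g * B) i 1 =
      entries g i 0 * entries B 0 1 + entries g i 1 * entries B 1 1 := by
    simp [Matrix.mul_apply, Fin.sum_univ_four, h21, h31]
  have hm : minor (g * B) = entries B 0 0 * entries B 1 1 * minor g := by
    simp only [minor, h0, h1]
    ring
  rw [hwFun, hwFun, hm, h0]
  ring

lemma blockTriangular_cochar (s : Kˣ) : (entries (cochar s)).BlockTriangular id := by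
  rw [entries_cochar]
  exact Matrix.blockTriangular_diagonal _

lemma transp_cochar (s : Kˣ) : transp (cochar s) = cochar s := by
  apply ext_entries
  simp [transp, entries_cochar]

lemma transp_transp (g : GSp4 K) : transp (transp g) = g := ext_entries (by simp [transp])

lemma transp_mul (g h : GSp4 K) : transp (g * h) = transp h * transp g :=
  ext_entries (by simp [transp])

lemma transp_low (a b c d : K) : transp (low a b c d) = up a b c d := transp_transp _

/-- The equivariance of the elements of the model under left translation by the lower triangular
Borel subgroup. -/
lemma model_lower_mul {a b : ℕ} {F : GSp4 K → K} (hF : F ∈ (model K a b).toSubmodule) {B : GSp4 K}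
    (hB : (entries B).BlockTriangular id) (g : GSp4 K) :
    F (transp B * g) = (entries B 0 0 ^ (a + b) * entries B 1 1 ^ a) * F g := by
  induction hF using Submodule.span_induction with
  | mem x hx =>
    obtain ⟨h', rfl⟩ := hx
    change hwFun K a b (transp B * g * h') = _ * hwFun K a b (g * h')
    rw [mul_assoc, hwFun_lower_mul a b hB]
  | zero => simp
  | add x y _ _ hx hy => rw [Pi.add_apply, Pi.add_apply, hx, hy]; ring
  | smul c x _ hx => rw [Pi.smul_apply, Pi.smul_apply, hx, smul_eq_mul, smul_eq_mul]; ring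

lemma rtrans_mem_regular (h : GSp4 K) {F : GSp4 K → K} (hF : F ∈ regularFunctions K) :
    rtrans h F ∈ regularFunctions K := by
  refine regular_comp_mem (fun g => g * h) _ (fun i j => ?_) ?_ hF
  · have : (fun g : GSp4 K => entries (g * h) i j) =
        ∑ k, entries h k j • fun g : GSp4 K => entries g i k := by
      funext g
      simp [Matrix.mul_apply, mul_comm]
    rw [this]
    exact Subalgebra.sum_mem _ fun k _ => Subalgebra.smul_mem _ (entry_mem_regular i k) _
  · have : (fun g : GSp4 K => (((multiplier K (g * h))⁻¹ : Kˣ) : K)) =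
        (((multiplier K h)⁻¹ : Kˣ) : K) • fun g : GSp4 K => (((multiplier K g)⁻¹ : Kˣ) : K) := by
      funext g
      simp
    rw [this]
    exact Subalgebra.smul_mem _ inv_multiplier_mem_regular _

lemma model_le_regular (a b : ℕ) :
    (model K a b).toSubmodule ≤ Subalgebra.toSubmodule (regularFunctions K) := by
  refine Submodule.span_le.2 ?_
  rintro _ ⟨h, rfl⟩
  exact rtrans_mem_regular h (hwFun_mem_regular a b)

end Model

/-! ### Uniqueness of `V^{a,b}` -/

section Uniqueness

variable {K : Type*} [Field K]

variable (K) in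
/-- The functions on `Kˣ` that become polynomial after multiplication by a power of the
variable. -/
def laurentFun : Subalgebra K (Kˣ → K) where
  carrier := {φ | ∃ (N : ℕ) (P : K[X]), ∀ s : Kˣ, (s : K) ^ N * φ s = P.eval (s : K)}
  mul_mem' := by
    rintro x y ⟨N, P, h⟩ ⟨M, Q, h'⟩
    refine ⟨N + M, P * Q, fun s => ?_⟩
    rw [Polynomial.eval_mul, ← h, ← h', Pi.mul_apply]
    ring
  add_mem' := by
    rintro x y ⟨N, P, h⟩ ⟨M, Q, h'⟩
    refine ⟨N + M, P * Polynomial.X ^ M + Q * Polynomial.X ^ N, fun s => ?_⟩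
    simp only [Polynomial.eval_add, Polynomial.eval_mul, Polynomial.eval_pow, Polynomial.eval_X,
      ← h, ← h', Pi.add_apply]
    ring
  algebraMap_mem' c := ⟨0, C c, fun s => by simp⟩

lemma regular_cochar_mem {F : GSp4 K → K} (hF : F ∈ regularFunctions K) :
    (fun s => F (cochar s)) ∈ laurentFun K := by
  refine regular_comp_mem cochar _ (fun i j => ?_) ?_ hF
  · by_cases hij : i = j
    · subst hij
      refine ⟨0, Polynomial.X ^ (i : ℕ), fun s => ?_⟩
      change _ * entries (cochar s) i i = _
      rw [entries_cochar]
      fin_cases i <;> simp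
    · exact ⟨0, 0, fun s => by simp [entries_cochar, hij]⟩
  · refine ⟨3, 1, fun s => ?_⟩
    have : multiplier K (cochar s) = s ^ 3 := rfl
    simp [this]

lemma low_curve {F : GSp4 K → K} (hF : F ∈ regularFunctions K) (a b c d : K) :
    ∃ p : K[X], ∀ s, p.eval s = F (low (s * a) (s ^ 2 * b) (s ^ 3 * c) (s * d)) := by
  refine regular_curve hF _ (fun i j => ?_) 1 fun t => by simp
  have : (fun s : K => entries (low (s * a) (s ^ 2 * b) (s ^ 3 * c) (s * d)) i j) = fun s =>
      ((!![1, 0, 0, 0; Polynomial.X * C a, 1, 0, 0;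
        Polynomial.X ^ 2 * C b, Polynomial.X * C d, 1, 0;
        Polynomial.X ^ 3 * C c, Polynomial.X ^ 2 * C (b - a * d), -(Polynomial.X * C a), 1] :
          Matrix (Fin 4) (Fin 4) K[X]) i j).eval s := by
    funext s
    rw [entries_low]
    fin_cases i <;> fin_cases j <;> simp <;> ring
  rw [this]
  exact eval_mem_polyFun _

lemma up_curve {F : GSp4 K → K} (hF : F ∈ regularFunctions K) (a b c d : K) :
    ∃ p : K[X], ∀ s, p.eval s = F (up (s * a) (s ^ 2 * b) (s ^ 3 * c) (s * d)) := by
  refine regular_curve hF _ (fun i j => ?_) 1 fun t => by simp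
  have : (fun s : K => entries (up (s * a) (s ^ 2 * b) (s ^ 3 * c) (s * d)) i j) = fun s =>
      ((!![1, Polynomial.X * C a, Polynomial.X ^ 2 * C b, Polynomial.X ^ 3 * C c;
        0, 1, Polynomial.X * C d, Polynomial.X ^ 2 * C (b - a * d);
        0, 0, 1, -(Polynomial.X * C a); 0, 0, 0, 1] :
          Matrix (Fin 4) (Fin 4) K[X]) i j).eval s := by
    funext s
    rw [entries_up]
    fin_cases i <;> fin_cases j <;> simp <;> ring
  rw [this]
  exact eval_mem_polyFun _

lemma eq_of_eval_units [Infinite K] {p q : K[X]} (h : ∀ s : Kˣ, p.eval (s : K) = q.eval (s : K)) :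
    p = q := by
  refine Polynomial.eq_of_infinite_eval_eq p q
    ((Set.infinite_of_finite_compl (s := {x : K | x ≠ 0}) ?_).mono fun s hs => h (Units.mk0 s hs))
  convert Set.finite_singleton (0 : K)
  ext
  simp

variable {V : Type*} [AddCommGroup V] [Module K V] {π : Representation K (GSp4 K) V}

lemma exists_laurent (hπ : IsAlgebraicRep π) (f : Module.Dual K V) :
    ∃ (N : ℕ) (Λ : V →ₗ[K] K[X]), ∀ w (s : Kˣ),
      (s : K) ^ N * f (π (cochar s) w) = (Λ w).eval (s : K) := by
  have := hπ.1
  let β := Module.finBasis K V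
  choose N P h using fun i => regular_cochar_mem (hπ.2 (β i) f)
  refine ⟨∑ i, N i, β.constr K fun i => P i * Polynomial.X ^ (∑ j ∈ Finset.univ.erase i, N j),
    fun w s => ?_⟩
  have hb : ∀ i, (s : K) ^ (∑ i, N i) * f (π (cochar s) (β i)) =
      (P i * Polynomial.X ^ (∑ j ∈ Finset.univ.erase i, N j)).eval (s : K) := by
    intro i
    rw [Polynomial.eval_mul, ← h, ← Finset.add_sum_erase _ _ (Finset.mem_univ i), pow_add,
      Polynomial.eval_pow, Polynomial.eval_X]
    ring
  have hl : ((s : K) ^ (∑ i, N i)) • (f ∘ₗ π (cochar s)) =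
      Polynomial.leval (s : K) ∘ₗ
        β.constr K fun i => P i * Polynomial.X ^ (∑ j ∈ Finset.univ.erase i, N j) := by
    refine β.ext fun i => ?_
    simp only [LinearMap.smul_apply, LinearMap.comp_apply, Module.Basis.constr_basis,
      Polynomial.leval_apply, smul_eq_mul]
    exact hb i
  exact LinearMap.congr_fun hl w

/-- In a representation with a highest weight vector `v` there is a linear form (the lowest weight
vector of the dual) for which the matrix coefficient of `v` is `hwFun`. It is the
coefficient of `s ^ a` in the translates by `cochar s` of an arbitrary linear form with
`f v = 1`. -/
lemma exists_dual_eq_hwFun [Infinite K] {a b : ℕ} (hπ : IsAlgebraicRep π) {v : V} (hv : v ≠ 0)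
    (hw : ∀ g : GSp4 K, (entries g).BlockTriangular id →
      π g v = (entries g 0 0 ^ (a + b) * entries g 1 1 ^ a) • v) :
    ∃ f : Module.Dual K V, ∀ g, f (π g v) = hwFun K a b g := by
  obtain ⟨f, hf⟩ : ∃ f : Module.Dual K V, f v = 1 := by
    obtain ⟨f, hf⟩ := not_forall.1 (mt (Module.forall_dual_apply_eq_zero_iff K v).1 hv)
    exact ⟨(f v)⁻¹ • f, by simp [hf]⟩
  obtain ⟨N, Λ, hΛ⟩ := exists_laurent hπ f
  let f0 : Module.Dual K V := Polynomial.lcoeff K (N + a) ∘ₗ Λ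
  have hlow : ∀ a' b' c' d', f0 (π (low a' b' c' d') v) = 1 := by
    intro a' b' c' d'
    obtain ⟨p, hp⟩ := low_curve (hπ.2 v f) a' b' c' d'
    have hp0 : p.coeff 0 = 1 := by
      rw [Polynomial.coeff_zero_eq_eval_zero, hp]
      simp [low_zero, hf]
    have : Λ (π (low a' b' c' d') v) = p * Polynomial.X ^ (N + a) := by
      refine eq_of_eval_units fun s => ?_
      rw [← hΛ, ← Module.End.mul_apply, ← map_mul, cochar_mul_low, map_mul, Module.End.mul_apply,
        hw _ (blockTriangular_cochar s), map_smul, map_smul, Polynomial.eval_mul, hp]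
      simp [entries_cochar]
      ring
    change (Λ (π (low a' b' c' d') v)).coeff (N + a) = 1
    rw [this, Polynomial.coeff_mul_X_pow', if_pos le_rfl, Nat.sub_self, hp0]
  refine ⟨f0, fun g => sub_eq_zero.1 (regular_eq_zero_of_bigCell
    (F := fun g => f0 (π g v) - hwFun K a b g)
    (sub_mem (hπ.2 v f0) (hwFun_mem_regular a b)) ?_ g)⟩
  intro g h0 h1
  obtain ⟨a', b', c', d', B, rfl, hB⟩ := exists_low_mul g h0 h1
  rw [map_mul, Module.End.mul_apply, hw B hB, map_smul, map_smul, hlow,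
    hwFun_mul_upper a b _ hB]
  have : hwFun K a b (low a' b' c' d') = 1 := by
    simp [hwFun, minor, entries_low]
  rw [this, smul_eq_mul, sub_self]

/-- Every model of `V^{a,b}` is isomorphic to `model`. -/
lemma nonempty_equiv_model [Infinite K] {a b : ℕ} (h : IsV a b π) :
    Nonempty (π.Equiv (model K a b).toRepresentation) := by
  obtain ⟨v, hv, hw⟩ := h.highestWeight
  obtain ⟨f, hf⟩ := exists_dual_eq_hwFun h.algebraic hv hw
  let T : V →ₗ[K] (GSp4 K → K) := LinearMap.pi fun g => f ∘ₗ π g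
  have hT : ∀ x w, T (π x w) = rtrans x (T w) := by
    intro x w
    funext g
    change f (π g (π x w)) = f (π (g * x) w)
    rw [map_mul]; rfl
  have hTv : T v = hwFun K a b := funext hf
  let N : Subrepresentation π := ⟨LinearMap.ker T, fun g w hw => by
    rw [LinearMap.mem_ker] at hw ⊢
    rw [hT, hw, map_zero]⟩
  have hinj : Function.Injective T := by
    rw [← LinearMap.ker_eq_bot]
    rcases h.irreducible.eq_bot_or_eq_top N with h' | h'
    · exact congrArg Subrepresentation.toSubmodule h'
    · exfalso
      have : v ∈ N.toSubmodule := by rw [h']; exact Submodule.mem_top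
      have h2 : T v = 0 := this
      rw [hTv] at h2
      have := congrFun h2 1
      rw [hwFun_one] at this
      exact one_ne_zero this
  let U : Subrepresentation π := ⟨Submodule.comap T (model K a b).toSubmodule, fun g w hw => by
    rw [Submodule.mem_comap] at hw ⊢
    rw [hT]
    exact (model K a b).apply_mem_toSubmodule g hw⟩
  have hU : ∀ w, T w ∈ (model K a b).toSubmodule := by
    rcases h.irreducible.eq_bot_or_eq_top U with h' | h'
    · exfalso
      have : v ∈ U.toSubmodule := by
        change T v ∈ (model K a b).toSubmodule
        rw [hTv]
        exact hwFun_mem a b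
      rw [h'] at this
      exact hv this
    · intro w
      have : w ∈ U.toSubmodule := by rw [h']; exact Submodule.mem_top
      exact this
  refine ⟨Representation.Equiv.mk (LinearEquiv.ofBijective (T.codRestrict _ hU) ⟨?_, ?_⟩) ?_⟩
  · exact fun x y hxy => hinj (congrArg Subtype.val hxy)
  · rintro ⟨F, hF⟩
    have hle : (model K a b).toSubmodule ≤ LinearMap.range T := by
      refine Submodule.span_le.2 ?_
      rintro _ ⟨x, rfl⟩
      exact ⟨π x v, by rw [hT, hTv]⟩
    obtain ⟨w, rfl⟩ := hle hF
    exact ⟨w, rfl⟩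
  · intro g
    ext1 w
    exact Subtype.ext (hT g w)

end Uniqueness

/-! ### Existence of `V^{a,b}` -/

section Existence

variable {K : Type*} [Field K]

/-- The translates of an element of the model along the contracting cocharacter form a polynomial
family. -/
lemma exists_cochar_curve {a b : ℕ} {F : GSp4 K → K} (hF : F ∈ (model K a b).toSubmodule) :
    ∃ P : (GSp4 K → K)[X], ∀ s : Kˣ,
      P.eval (algebraMap K (GSp4 K → K) s) = rtrans (cochar s) F := by
  let E : Subalgebra K (GSp4 K → K) :=
    { carrier := {F | ∃ P : (GSp4 K → K)[X], ∀ s : Kˣ,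
        P.eval (algebraMap K (GSp4 K → K) s) = rtrans (cochar s) F}
      mul_mem' := by
        rintro x y ⟨P, h⟩ ⟨Q, h'⟩
        exact ⟨P * Q, fun s => by rw [Polynomial.eval_mul, h, h', map_mul]⟩
      add_mem' := by
        rintro x y ⟨P, h⟩ ⟨Q, h'⟩
        exact ⟨P + Q, fun s => by rw [Polynomial.eval_add, h, h', map_add]⟩
      algebraMap_mem' := fun c => ⟨C (algebraMap K _ c), fun s => by
        rw [Polynomial.eval_C, AlgHom.commutes]⟩ }
  have hent : ∀ i j, (fun g : GSp4 K => entries g i j) ∈ E := by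
    intro i j
    refine ⟨C (fun g : GSp4 K => entries g i j) * Polynomial.X ^ (j : ℕ), fun s => ?_⟩
    funext g
    rw [Polynomial.eval_mul, Polynomial.eval_pow, Polynomial.eval_C, Polynomial.eval_X,
      rtrans_apply, entries_mul, entries_cochar]
    fin_cases j <;> simp
  have htr : ∀ (h : GSp4 K) i j, (fun g : GSp4 K => entries (g * h) i j) ∈ E := by
    intro h i j
    have : (fun g : GSp4 K => entries (g * h) i j) =
        ∑ k, entries h k j • fun g : GSp4 K => entries g i k := by
      funext g
      simp [Matrix.mul_apply, mul_comm]
    rw [this]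
    exact Subalgebra.sum_mem _ fun k _ => Subalgebra.smul_mem _ (hent i k) _
  have hle : (model K a b).toSubmodule ≤ Subalgebra.toSubmodule E := by
    refine Submodule.span_le.2 ?_
    rintro _ ⟨h, rfl⟩
    rw [rtrans_hwFun]
    change _ ∈ E
    exact mul_mem (pow_mem (htr h _ _) _) (pow_mem (sub_mem (mul_mem (htr h _ _) (htr h _ _))
      (mul_mem (htr h _ _) (htr h _ _))) _)
  exact hle hF

/-- The coefficient of `s ^ a` in the translates of `F` by `cochar s` is the multiple of `hwFun` by
the value of `F` at `1`, if it lies in the model. -/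
lemma coeff_cochar_curve [Infinite K] {a b : ℕ} {F : GSp4 K → K}
    (hF : F ∈ (model K a b).toSubmodule) (P : (GSp4 K → K)[X])
    (hP : ∀ s : Kˣ, P.eval (algebraMap K (GSp4 K → K) s) = rtrans (cochar s) F)
    (hG : P.coeff a ∈ (model K a b).toSubmodule) : P.coeff a = F 1 • hwFun K a b := by
  have hup : ∀ a' b' c' d', P.coeff a (up a' b' c' d') = F 1 := by
    intro a' b' c' d'
    obtain ⟨p, hp⟩ := up_curve (model_le_regular a b hF) a' b' c' d'
    have hp0 : p.coeff 0 = F 1 := by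
      rw [Polynomial.coeff_zero_eq_eval_zero, hp]
      simp [up_zero]
    let ev : (GSp4 K → K) →+* K := Pi.evalRingHom _ (up a' b' c' d')
    have : P.map ev = p * Polynomial.X ^ a := by
      refine eq_of_eval_units fun s => ?_
      have h1 := congrFun (hP s) (up a' b' c' d')
      rw [rtrans_apply, up_mul_cochar, ← transp_cochar,
        model_lower_mul hF (blockTriangular_cochar s), ← hp] at h1
      have h2 : (P.map ev).eval (s : K) =
          P.eval (algebraMap K (GSp4 K → K) s) (up a' b' c' d') := by
        rw [Polynomial.eval_map]
        change Polynomial.eval₂ ev (ev (algebraMap K (GSp4 K → K) s)) P = _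
        rw [Polynomial.eval₂_at_apply]
        rfl
      rw [h2, h1]
      simp [entries_cochar]
      ring
    have h3 := congrArg (fun p => p.coeff a) this
    simp only [Polynomial.coeff_map, Polynomial.coeff_mul_X_pow', le_refl, if_true, Nat.sub_self,
      hp0] at h3
    exact h3
  funext g
  have hreg : P.coeff a - F 1 • hwFun K a b ∈ regularFunctions K :=
    sub_mem (model_le_regular a b hG)
      (Subalgebra.smul_mem (regularFunctions K) (hwFun_mem_regular a b) (F 1))
  refine sub_eq_zero.1 (regular_eq_zero_of_bigCell hreg ?_ g)
  intro g h0 h1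
  have h1' : minor (transp g) ≠ 0 := by
    convert h1 using 1
    simp [minor, transp]
    ring
  obtain ⟨a', b', c', d', B, hg, hB⟩ := exists_low_mul (transp g) h0 h1'
  have hg' : g = transp B * up a' b' c' d' := by
    rw [← transp_transp g, hg, transp_mul, transp_low]
  have hone : hwFun K a b (up a' b' c' d') = 1 := by simp [hwFun, minor, entries_up]
  rw [hg', Pi.sub_apply, Pi.smul_apply, model_lower_mul hG hB, hwFun_lower_mul a b hB, hup, hone,
    smul_eq_mul]
  ring

/-- The model is irreducible: a nonzero stable subspace contains a function with nonzero value at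
`1`, hence, by passing to a coefficient along the contracting cocharacter, the generator. -/
lemma isIrreducible_model [Infinite K] (a b : ℕ) :
    (model K a b).toRepresentation.IsIrreducible := by
  have hne : (⟨hwFun K a b, hwFun_mem a b⟩ : (model K a b).toSubmodule) ≠ 0 := by
    intro h
    have := congrFun (congrArg Subtype.val h) 1
    change hwFun K a b 1 = 0 at this
    rw [hwFun_one] at this
    exact one_ne_zero this
  have hn : Nontrivial (Subrepresentation (model K a b).toRepresentation) := by
    refine ⟨⊥, ⊤, fun h => hne ?_⟩
    have : (⟨hwFun K a b, hwFun_mem a b⟩ : (model K a b).toSubmodule) ∈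
        (⊤ : Subrepresentation (model K a b).toRepresentation).toSubmodule := Submodule.mem_top
    rw [← h] at this
    exact this
  refine { eq_bot_or_eq_top := fun W => ?_ }
  by_cases hW : W = ⊥
  · exact Or.inl hW
  right
  let N : Submodule K (GSp4 K → K) := W.toSubmodule.map (model K a b).toSubmodule.subtype
  have hNmem : ∀ {F}, F ∈ N → F ∈ (model K a b).toSubmodule := by
    rintro _ ⟨F, _, rfl⟩
    exact F.2
  have hNtr : ∀ (h : GSp4 K) {F}, F ∈ N → rtrans h F ∈ N := by
    rintro h _ ⟨F, hF, rfl⟩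
    exact ⟨_, W.apply_mem_toSubmodule h hF, rfl⟩
  obtain ⟨F, hFN, hF1⟩ : ∃ F ∈ N, F 1 ≠ 0 := by
    have hb : W.toSubmodule ≠ ⊥ := fun h => hW (Subrepresentation.toSubmodule_injective h)
    obtain ⟨F, hF, hF0⟩ := Submodule.exists_mem_ne_zero_of_ne_bot hb
    have : ∃ g, F.1 g ≠ 0 := by
      by_contra! hcon
      exact hF0 (Subtype.ext (funext hcon))
    obtain ⟨g, hg⟩ := this
    exact ⟨rtrans g F.1, hNtr g ⟨F, hF, rfl⟩, by rwa [rtrans_apply, one_mul]⟩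
  obtain ⟨P, hP⟩ := exists_cochar_curve (hNmem hFN)
  have hco : P.coeff a ∈ N := by
    refine coeff_mem_of_eval_mem N (T := {x : K | x ≠ 0}) (Set.infinite_of_finite_compl ?_) P
      (fun s hs => ?_) a
    · convert Set.finite_singleton (0 : K)
      ext
      simp
    · have := hP (Units.mk0 s hs)
      rw [Units.val_mk0] at this
      rw [this]
      exact hNtr _ hFN
  have hhw : hwFun K a b ∈ N := by
    rw [coeff_cochar_curve (hNmem hFN) P hP (hNmem hco)] at hco
    exact (Submodule.smul_mem_iff _ hF1).1 hco
  have hle : (model K a b).toSubmodule ≤ N := by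
    refine Submodule.span_le.2 ?_
    rintro _ ⟨h, rfl⟩
    exact hNtr h hhw
  apply Subrepresentation.toSubmodule_injective
  refine eq_top_iff.2 fun F _ => ?_
  obtain ⟨F', hF', e⟩ := hle F.2
  rwa [← Subtype.ext e]

lemma model_finiteDimensional (a b : ℕ) : FiniteDimensional K (model K a b).toSubmodule := by
  let L (i : Fin 4) : Submodule K (GSp4 K → K) :=
    Submodule.span K (Set.range fun j : Fin 4 => fun g : GSp4 K => entries g i j)
  have hL : ∀ (h : GSp4 K) i j, (fun g : GSp4 K => entries (g * h) i j) ∈ L i := by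
    intro h i j
    have : (fun g : GSp4 K => entries (g * h) i j) =
        ∑ k, entries h k j • fun g : GSp4 K => entries g i k := by
      funext g
      simp [Matrix.mul_apply, mul_comm]
    rw [this]
    exact Submodule.sum_mem _ fun k _ => Submodule.smul_mem _ _ (Submodule.subset_span ⟨k, rfl⟩)
  have hle : (model K a b).toSubmodule ≤ L 0 ^ b * (L 0 * L 1) ^ a := by
    refine Submodule.span_le.2 ?_
    rintro _ ⟨h, rfl⟩
    rw [SetLike.mem_coe, rtrans_hwFun]
    exact Submodule.mul_mem_mul (Submodule.pow_mem_pow _ (hL h _ _) _)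
      (Submodule.pow_mem_pow _ (Submodule.sub_mem _ (Submodule.mul_mem_mul (hL h _ _) (hL h _ _))
        (Submodule.mul_mem_mul (hL h _ _) (hL h _ _))) _)
  have hfg (i : Fin 4) : (L i).FG := Submodule.fg_span (Set.finite_range _)
  have : FiniteDimensional K ↥(L 0 ^ b * (L 0 * L 1) ^ a) :=
    Module.Finite.iff_fg.2 (((hfg 0).pow b).mul (((hfg 0).mul (hfg 1)).pow a))
  exact Submodule.finiteDimensional_of_le hle

/-- The evaluations at points span the dual of the model, and their matrix coefficients are left
translates of regular functions. -/
lemma isAlgebraicRep_model (a b : ℕ) : IsAlgebraicRep (model K a b).toRepresentation := by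
  have hfd := model_finiteDimensional (K := K) a b
  refine ⟨hfd, fun F f => ?_⟩
  let D : Submodule K (Module.Dual K (model K a b).toSubmodule) :=
    { carrier := {f | ∀ F, (fun g => f ((model K a b).toRepresentation g F)) ∈ regularFunctions K}
      add_mem' := fun {x y} hx hy F => add_mem (hx F) (hy F)
      zero_mem' := fun F => zero_mem _
      smul_mem' := fun c x hx F => Subalgebra.smul_mem _ (hx F) c }
  suffices h : D = ⊤ by
    have : f ∈ D := by rw [h]; exact Submodule.mem_top
    exact this F
  have hev : ∀ g0 : GSp4 K, LinearMap.proj g0 ∘ₗ (model K a b).toSubmodule.subtype ∈ D :=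
    fun g0 F => regular_left_mul g0 (model_le_regular a b F.2)
  have hbot : D.dualCoannihilator = ⊥ := by
    refine eq_bot_iff.2 fun F hF => ?_
    rw [Submodule.mem_dualCoannihilator] at hF
    exact Subtype.ext (funext fun g0 => hF _ (hev g0))
  rw [← Subspace.dualCoannihilator_dualAnnihilator_eq (W := D), hbot,
    Submodule.dualAnnihilator_bot]

lemma isV_model [Infinite K] (a b : ℕ) : IsV a b (model K a b).toRepresentation where
  algebraic := isAlgebraicRep_model a b
  irreducible := isIrreducible_model a b
  highestWeight := by
    refine ⟨⟨hwFun K a b, hwFun_mem a b⟩, fun h => ?_, fun B hB => ?_⟩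
    · have := congrFun (congrArg Subtype.val h) 1
      change hwFun K a b 1 = 0 at this
      rw [hwFun_one] at this
      exact one_ne_zero this
    · apply Subtype.ext
      funext g
      exact hwFun_mul_upper a b g hB

lemma isV_of_equiv {V W : Type*} [AddCommGroup V] [Module K V] [AddCommGroup W] [Module K W]
    {π : Representation K (GSp4 K) V} {σ : Representation K (GSp4 K) W} {a b : ℕ}
    (φ : π.Equiv σ) (h : IsV a b σ) : IsV a b π where
  algebraic := by
    have := h.algebraic.1
    refine ⟨LinearEquiv.finiteDimensional φ.toLinearEquiv.symm, fun v f => ?_⟩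
    have h2 := h.algebraic.2 (φ v) (f ∘ₗ φ.toLinearEquiv.symm.toLinearMap)
    convert h2 using 3 with g
    rw [← equiv_map φ]
    exact congrArg f (φ.toLinearEquiv.symm_apply_apply _).symm
  irreducible := isIrreducible_of_equiv φ h.irreducible
  highestWeight := by
    obtain ⟨v, hv, hw⟩ := h.highestWeight
    refine ⟨φ.symm v, fun h0 => hv ?_, fun g hg => ?_⟩
    · exact (LinearEquiv.map_eq_zero_iff φ.symm.toLinearEquiv).1 h0
    · rw [← equiv_map φ.symm, hw g hg]
      exact LinearEquiv.map_smul φ.symm.toLinearEquiv _ _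

lemma exists_isV [Infinite K] (a b : ℕ) :
    ∃ (n : ℕ) (π : Representation K (GSp4 K) (Fin n → K)), IsV a b π := by
  have := model_finiteDimensional (K := K) a b
  let e := (Module.finBasis K (model K a b).toSubmodule).equivFun
  let π : Representation K (GSp4 K) (Fin (Module.finrank K (model K a b).toSubmodule) → K) :=
    ((e.conjRingEquiv : _ ≃+* _) : _ →* _).comp (model K a b).toRepresentation
  refine ⟨_, π, isV_of_equiv (Representation.Equiv.mk e.symm fun g => ?_) (isV_model a b)⟩
  refine LinearMap.ext fun w => ?_
  exact e.symm_apply_apply _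

end Existence

/-! ### Bihomogeneous families of regular functions -/

section Families

variable {K : Type*} [Field K]

variable (K) in
/-- The linear form with coefficients `ξ` in the entries `(i, j)` and `(i, j')` of the generic
element of `GSp₄`. -/
def rowForm (i j j' : Fin 4) : (Fin 2 → K) →ₗ[K] (GSp4 K → K) where
  toFun ξ g := ξ 0 * entries g i j + ξ 1 * entries g i j'
  map_add' ξ ξ' := by
    funext g
    simp
    ring
  map_smul' c ξ := by
    funext g
    simp
    ring

variable (K) in
/-- Linear forms in the outer entries of the first row: the standard representation of the first
factor of `H`. -/
abbrev outer : (Fin 2 → K) →ₗ[K] (GSp4 K → K) := rowForm K 0 0 3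

variable (K) in
/-- Linear forms in the inner entries of the first row: the standard representation of the second
factor of `H`. -/
abbrev inner : (Fin 2 → K) →ₗ[K] (GSp4 K → K) := rowForm K 0 1 2

variable (K) in
/-- The `2 × 2` minors of the first two rows in one outer and one inner column. -/
def mixed : (Fin 2 → K) →ₗ[K] (Fin 2 → K) →ₗ[K] (GSp4 K → K) :=
  LinearMap.mk₂ K (fun ξ η => rowForm K 0 0 3 ξ * rowForm K 1 1 2 η -
      rowForm K 1 0 3 ξ * rowForm K 0 1 2 η)
    (fun x y z => by simp only [map_add]; ring)
    (fun c x z => by simp only [map_smul, smul_mul_assoc, smul_sub])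
    (fun x y z => by simp only [map_add]; ring)
    (fun c x z => by simp only [map_smul, mul_smul_comm, smul_sub])

variable (K) in
/-- The minor of the first two rows in the outer columns; up to sign it is also the minor in the
inner columns. Under `H` it transforms by the character `μ`. -/
def outerMinor : GSp4 K → K := fun g =>
  entries g 0 0 * entries g 1 3 - entries g 0 3 * entries g 1 0

/-- The symplectic pairing on the plane. -/
def bracket (ξ α : Fin 2 → K) : K := ξ 0 * α 1 - ξ 1 * α 0

lemma rowForm_apply (i j j' : Fin 4) (ξ : Fin 2 → K) (g : GSp4 K) :
    rowForm K i j j' ξ g = ξ 0 * entries g i j + ξ 1 * entries g i j' := rfl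

lemma mixed_apply (ξ η : Fin 2 → K) (g : GSp4 K) :
    mixed K ξ η g = rowForm K 0 0 3 ξ g * rowForm K 1 1 2 η g -
      rowForm K 1 0 3 ξ g * rowForm K 0 1 2 η g := rfl

/-! The next three identities are the quadratic relations between the four kinds of functions. -/

lemma mixed_mul_inner (ξ η β : Fin 2 → K) : mixed K ξ β * inner K η =
    mixed K ξ η * inner K β - bracket η β • (outerMinor K * outer K ξ) := by
  funext g
  have h := rel_row g
  simp only [Pi.sub_apply, Pi.mul_apply, Pi.smul_apply, smul_eq_mul, mixed_apply, rowForm_apply,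
    outerMinor, bracket]
  linear_combination ((η 0 * β 1 - η 1 * β 0) *
    (ξ 0 * entries g 0 0 + ξ 1 * entries g 0 3)) * h

lemma mixed_mul_outer (ξ α η : Fin 2 → K) : mixed K α η * outer K ξ =
    mixed K ξ η * outer K α - bracket ξ α • (outerMinor K * inner K η) := by
  funext g
  simp only [Pi.sub_apply, Pi.mul_apply, Pi.smul_apply, smul_eq_mul, mixed_apply, rowForm_apply,
    outerMinor, bracket]
  ring

lemma mixed_mul_mixed (ξ α η β : Fin 2 → K) : mixed K ξ β * mixed K α η =
    mixed K ξ η * mixed K α β + (bracket ξ α * bracket η β) • outerMinor K ^ 2 := by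
  funext g
  have h := rel_row g
  simp only [Pi.add_apply, Pi.mul_apply, Pi.smul_apply, Pi.pow_apply, smul_eq_mul, mixed_apply,
    rowForm_apply, outerMinor, bracket]
  linear_combination (-(ξ 0 * α 1 - ξ 1 * α 0) * (η 0 * β 1 - η 1 * β 0) *
    (entries g 0 0 * entries g 1 3 - entries g 0 3 * entries g 1 0)) * h

/-- The family of functions whose span, for fixed exponents, is an irreducible constituent of the
restriction of `V^{a,b}` to `H`. -/
def fam (q m k r : ℕ) (ξ η : Fin 2 → K) : GSp4 K → K :=
  outerMinor K ^ q * mixed K ξ η ^ m * outer K ξ ^ k * inner K η ^ r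

variable (K) in
/-- The span of the families with bidegree `(a, b)` in the minors and the entries. -/
def famSpan (a b : ℕ) : Submodule K (GSp4 K → K) :=
  Submodule.span K {F | ∃ q m k r ξ η, q + m = a ∧ k + r = b ∧ F = fam q m k r ξ η}

lemma fam_mem {q m k r a b : ℕ} (h : q + m = a) (h' : k + r = b) (ξ η : Fin 2 → K) :
    fam q m k r ξ η ∈ famSpan K a b :=
  Submodule.subset_span ⟨q, m, k, r, ξ, η, h, h', rfl⟩

/-- Polarization: the Leibniz rule for a product of powers that stays in a subspace along a line. -/
lemma polarize [Infinite K] {R : Type*} [CommRing R] [Algebra K R] (N : Submodule K R)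
    (c x x' y y' z z' : R) (l m n : ℕ)
    (h : ∀ s : K, c * (x + s • x') ^ l * (y + s • y') ^ m * (z + s • z') ^ n ∈ N) :
    c * (l * x ^ (l - 1) * x' * y ^ m * z ^ n + x ^ l * (m * y ^ (m - 1) * y') * z ^ n +
      x ^ l * y ^ m * (n * z ^ (n - 1) * z')) ∈ N := by
  have := derivative_eval_mem N (C c * (C x + C x' * Polynomial.X) ^ l *
    (C y + C y' * Polynomial.X) ^ m * (C z + C z' * Polynomial.X) ^ n) (fun s => by
      have := h s
      simp only [Algebra.smul_def] at this
      simpa [mul_comm _ (algebraMap K R s)] using this)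
  convert this using 1
  simp [Polynomial.derivative_mul, Polynomial.derivative_pow]
  ring

lemma polarize_outer [Infinite K] (N : Submodule K (GSp4 K → K)) (q m k r : ℕ) (η : Fin 2 → K)
    (h : ∀ ξ, fam q m k r ξ η ∈ N) (ξ α : Fin 2 → K) :
    outerMinor K ^ q * inner K η ^ r * (m * mixed K ξ η ^ (m - 1) * mixed K α η * outer K ξ ^ k +
      mixed K ξ η ^ m * (k * outer K ξ ^ (k - 1) * outer K α)) ∈ N := by
  have := polarize N (outerMinor K ^ q * inner K η ^ r) (mixed K ξ η) (mixed K α η) (outer K ξ)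
    (outer K α) 0 0 m k 0 (fun s => by
      have := h (ξ + s • α)
      rw [fam, map_add, map_add, map_smul, map_smul, LinearMap.add_apply,
        LinearMap.smul_apply] at this
      convert this using 1
      ring)
  convert this using 1
  simp

lemma polarize_inner [Infinite K] (N : Submodule K (GSp4 K → K)) (q m k r : ℕ) (ξ : Fin 2 → K)
    (h : ∀ η, fam q m k r ξ η ∈ N) (η β : Fin 2 → K) :
    outerMinor K ^ q * outer K ξ ^ k * (m * mixed K ξ η ^ (m - 1) * mixed K ξ β * inner K η ^ r +
      mixed K ξ η ^ m * (r * inner K η ^ (r - 1) * inner K β)) ∈ N := by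
  have := polarize N (outerMinor K ^ q * outer K ξ ^ k) (mixed K ξ η) (mixed K ξ β) (inner K η)
    (inner K β) 0 0 m r 0 (fun s => by
      have := h (η + s • β)
      rw [fam, map_add, map_add, map_smul, map_smul] at this
      convert this using 1
      ring)
  convert this using 1
  simp

/-- Polarization in the outer variable, rewritten by the quadratic relations. -/
lemma outer_mul_fam_sub_mem [Infinite K] (N : Submodule K (GSp4 K → K)) (q m k r : ℕ)
    (η : Fin 2 → K) (h : ∀ ξ, fam q m (k + 1) r ξ η ∈ N) (ξ α : Fin 2 → K) :
    ((m : K) + k + 1) • (outer K α * fam q m k r ξ η) -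
      ((m : K) * bracket ξ α) • fam (q + 1) (m - 1) k (r + 1) ξ η ∈ N := by
  have h1 := polarize_outer N q m (k + 1) r η h ξ α
  convert h1 using 1
  rcases m with _ | m
  · simp [fam, Algebra.smul_def]
    ring
  · have h2 := mixed_mul_outer ξ α η
    simp only [Algebra.smul_def] at h2
    simp only [fam, Algebra.smul_def, Nat.add_sub_cancel, map_add, map_mul, map_one, map_natCast,
      Nat.cast_add, Nat.cast_one]
    linear_combination (-outerMinor K ^ q * inner K η ^ r * (m + 1) * mixed K ξ η ^ m *
      outer K ξ ^ k) * h2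

/-- Polarization in the inner variable, rewritten by the quadratic relations. -/
lemma inner_mul_fam_sub_mem [Infinite K] (N : Submodule K (GSp4 K → K)) (q m k r : ℕ)
    (ξ : Fin 2 → K) (h : ∀ η, fam q m k (r + 1) ξ η ∈ N) (η β : Fin 2 → K) :
    ((m : K) + r + 1) • (inner K β * fam q m k r ξ η) -
      ((m : K) * bracket η β) • fam (q + 1) (m - 1) (k + 1) r ξ η ∈ N := by
  have h1 := polarize_inner N q m k (r + 1) ξ h η β
  convert h1 using 1
  rcases m with _ | m
  · simp [fam, Algebra.smul_def]
    ring
  · have h2 := mixed_mul_inner ξ η β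
    simp only [Algebra.smul_def] at h2
    simp only [fam, Algebra.smul_def, Nat.add_sub_cancel, map_add, map_mul, map_one, map_natCast,
      Nat.cast_add, Nat.cast_one]
    linear_combination (-outerMinor K ^ q * outer K ξ ^ k * (m + 1) * mixed K ξ η ^ m *
      inner K η ^ r) * h2

lemma mul_famSpan_mem {a b a' b' : ℕ} {X : GSp4 K → K}
    (h : ∀ q m k r ξ η, q + m = a → k + r = b → X * fam q m k r ξ η ∈ famSpan K a' b')
    {F : GSp4 K → K} (hF : F ∈ famSpan K a b) : X * F ∈ famSpan K a' b' := by
  induction hF using Submodule.span_induction with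
  | mem x hx =>
    obtain ⟨q, m, k, r, ξ, η, h1, h2, rfl⟩ := hx
    exact h q m k r ξ η h1 h2
  | zero => rw [mul_zero]; exact Submodule.zero_mem _
  | add x y _ _ hx hy => rw [mul_add]; exact Submodule.add_mem _ hx hy
  | smul c x _ hx => rw [mul_smul_comm]; exact Submodule.smul_mem _ c hx

/-- The factor `m` takes care of the truncated exponent `m - 1`. -/
lemma smul_fam_pred_mem {q m k r a b : ℕ} (h : q + m = a + 1) (h' : k + r = b) (c : K)
    (ξ η : Fin 2 → K) : ((m : K) * c) • fam q (m - 1) k r ξ η ∈ famSpan K a b := by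
  rcases m with _ | m
  · simp
  · exact Submodule.smul_mem _ _ (fam_mem (by omega) h' ξ η)

lemma outerMinor_mul_mem {a b : ℕ} {F : GSp4 K → K} (hF : F ∈ famSpan K a b) :
    outerMinor K * F ∈ famSpan K (a + 1) b := by
  refine mul_famSpan_mem (fun q m k r ξ η h1 h2 => ?_) hF
  convert fam_mem (q := q + 1) (m := m) (a := a + 1) (by omega) h2 ξ η using 1
  rw [fam, fam]
  ring

variable [CharZero K]

lemma outer_mul_mem {a b : ℕ} (α : Fin 2 → K) {F : GSp4 K → K} (hF : F ∈ famSpan K a b) :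
    outer K α * F ∈ famSpan K a (b + 1) := by
  refine mul_famSpan_mem (fun q m k r ξ η h1 h2 => ?_) hF
  have h3 := outer_mul_fam_sub_mem (famSpan K a (b + 1)) q m k r η
    (fun ξ => fam_mem h1 (by omega) ξ η) ξ α
  have h5 := (Submodule.sub_mem_iff_left _ (smul_fam_pred_mem (by omega) (by omega) _ ξ η)).1 h3
  exact (Submodule.smul_mem_iff _ (by exact_mod_cast (m + k).succ_ne_zero)).1 h5

lemma inner_mul_mem {a b : ℕ} (β : Fin 2 → K) {F : GSp4 K → K} (hF : F ∈ famSpan K a b) :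
    inner K β * F ∈ famSpan K a (b + 1) := by
  refine mul_famSpan_mem (fun q m k r ξ η h1 h2 => ?_) hF
  have h3 := inner_mul_fam_sub_mem (famSpan K a (b + 1)) q m k r ξ
    (fun η => fam_mem h1 (by omega) ξ η) η β
  have h5 := (Submodule.sub_mem_iff_left _ (smul_fam_pred_mem (by omega) (by omega) _ ξ η)).1 h3
  exact (Submodule.smul_mem_iff _ (by exact_mod_cast (m + r).succ_ne_zero)).1 h5

lemma mixed_mul_fam_mem (q m k r : ℕ) (ξ α η : Fin 2 → K) :
    mixed K α η * fam q m k r ξ η ∈ famSpan K (q + m + 1) (k + r) := by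
  have h1 := polarize_outer (famSpan K (q + m + 1) (k + r)) q (m + 1) k r η
    (fun ξ => fam_mem (by omega) rfl ξ η) ξ α
  have h2 : (k : K) • (outer K α * fam q (m + 1) (k - 1) r ξ η) ∈
      famSpan K (q + m + 1) (k + r) := by
    rcases k with _ | k
    · simp
    · refine Submodule.smul_mem _ _ ?_
      rw [add_right_comm k]
      exact outer_mul_mem α (fam_mem (k := k) (by omega) rfl ξ η)
  have h3 : ((m : K) + 1) • (mixed K α η * fam q m k r ξ η) ∈ famSpan K (q + m + 1) (k + r) := by
    convert Submodule.sub_mem _ h1 h2 using 1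
    simp only [fam, Algebra.smul_def, Nat.add_sub_cancel, map_add, map_one, map_natCast,
      Nat.cast_add, Nat.cast_one]
    ring
  exact (Submodule.smul_mem_iff _ (by exact_mod_cast m.succ_ne_zero)).1 h3

lemma mixed_mul_mem {a b : ℕ} (α β : Fin 2 → K) {F : GSp4 K → K} (hF : F ∈ famSpan K a b) :
    mixed K α β * F ∈ famSpan K (a + 1) b := by
  refine mul_famSpan_mem (fun q m k r ξ η h1 h2 => ?_) hF
  subst h1 h2
  have h1 := polarize (famSpan K (q + m + 1) (k + r)) (outerMinor K ^ q * outer K ξ ^ k)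
    (mixed K α η) (mixed K α β) (mixed K ξ η) (mixed K ξ β) (inner K η) (inner K β) 1 m r
    (fun s => by
      have := mixed_mul_fam_mem q m k r ξ α (η + s • β)
      rw [fam, map_add, map_add, map_smul, map_smul, map_add, map_smul] at this
      convert this using 1
      ring)
  have h2 : (r : K) • (inner K β * (mixed K α η * fam q m k (r - 1) ξ η)) ∈
      famSpan K (q + m + 1) (k + r) := by
    rcases r with _ | r
    · simp
    · exact Submodule.smul_mem _ _ (inner_mul_mem β (mixed_mul_fam_mem q m k r ξ α η))
  have h3 : ((m : K) * (bracket ξ α * bracket η β)) • fam (q + 2) (m - 1) k r ξ η ∈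
      famSpan K (q + m + 1) (k + r) := smul_fam_pred_mem (by omega) rfl _ ξ η
  have h4 : ((m : K) + 1) • (mixed K α β * fam q m k r ξ η) ∈ famSpan K (q + m + 1) (k + r) := by
    convert Submodule.sub_mem _ (Submodule.sub_mem _ h1 h2) h3 using 1
    have h5 := mixed_mul_mixed ξ α η β
    simp only [Algebra.smul_def, map_mul] at h5
    simp only [fam, Algebra.smul_def, map_add, map_mul, map_one, map_natCast,
      Nat.cast_one, pow_one]
    rcases m with _ | m
    · simp
      ring
    · simp only [Nat.add_sub_cancel, Nat.cast_add, Nat.cast_one]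
      linear_combination (-outerMinor K ^ q * outer K ξ ^ k * (m + 1) * mixed K ξ η ^ m *
        inner K η ^ r) * h5
  exact (Submodule.smul_mem_iff _ (by exact_mod_cast m.succ_ne_zero)).1 h4

/-- The model of `V^{a,b}` lies in the span of the families. -/
lemma model_le_famSpan (a b : ℕ) : (model K a b).toSubmodule ≤ famSpan K a b := by
  refine Submodule.span_le.2 ?_
  rintro _ ⟨h, rfl⟩
  rw [rtrans_hwFun]
  set x : GSp4 K → K := fun g => entries (g * h) 0 0 with hx
  set y : GSp4 K → K := (fun g => entries (g * h) 0 0) * (fun g => entries (g * h) 1 1) -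
        (fun g => entries (g * h) 0 1) * fun g => entries (g * h) 1 0 with hy
  have hx' : x = outer K ![entries h 0 0, entries h 3 0] +
      inner K ![entries h 1 0, entries h 2 0] := by
    funext g
    simp [hx, rowForm_apply, Matrix.mul_apply, Fin.sum_univ_four]
    ring
  let p (i j : Fin 4) : K := entries h i 0 * entries h j 1 - entries h j 0 * entries h i 1
  have hy' : y = p 0 1 • mixed K ![1, 0] ![1, 0] + p 0 2 • mixed K ![1, 0] ![0, 1] +
      p 3 1 • mixed K ![0, 1] ![1, 0] + p 3 2 • mixed K ![0, 1] ![0, 1] +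
      (p 0 3 - p 1 2) • outerMinor K := by
    funext g
    have hr := rel_row g
    simp [hy, mixed_apply, outerMinor, rowForm_apply, Matrix.mul_apply, Fin.sum_univ_four, p]
    linear_combination p 1 2 * hr
  have hxm : ∀ {a b F}, F ∈ famSpan K a b → x * F ∈ famSpan K a (b + 1) := by
    intro a b F hF
    rw [hx', add_mul]
    exact Submodule.add_mem _ (outer_mul_mem _ hF) (inner_mul_mem _ hF)
  have hym : ∀ {a b F}, F ∈ famSpan K a b → y * F ∈ famSpan K (a + 1) b := by
    intro a b F hF
    rw [hy']
    simp only [add_mul, smul_mul_assoc]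
    have h1 (ξ η) (c : K) := Submodule.smul_mem _ c (mixed_mul_mem ξ η hF)
    exact Submodule.add_mem _ (Submodule.add_mem _ (Submodule.add_mem _ (Submodule.add_mem _
      (h1 _ _ _) (h1 _ _ _)) (h1 _ _ _)) (h1 _ _ _)) (Submodule.smul_mem _ _
        (outerMinor_mul_mem hF))
  have hone : (1 : GSp4 K → K) ∈ famSpan K 0 0 := by
    convert fam_mem (q := 0) (m := 0) (k := 0) (r := 0) rfl rfl (0 : Fin 2 → K) 0 using 1
    simp [fam]
  have hyp : ∀ a, y ^ a ∈ famSpan K a 0 := by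
    intro a
    induction a with
    | zero => rw [pow_zero]; exact hone
    | succ a ih => rw [pow_succ']; exact hym ih
  change x ^ b * y ^ a ∈ famSpan K a b
  induction b with
  | zero => rw [pow_zero, one_mul]; exact hyp a
  | succ b ih => rw [pow_succ', mul_assoc]; exact hxm ih

end Families

/-! ### The families lie in the model -/

section Spanning

variable {K : Type*} [Field K]

variable (K) in
/-- The embedding `H → GSp₄`. -/
def toGSp : H K →* GSp4 K := (G.pr₁ K).comp (iota K)

lemma entries_toGSp (h : H K) : entries (toGSp K h) =
    block K ((H.pr₁ K h : Matrix (Fin 2) (Fin 2) K), (H.pr₂ K h : Matrix (Fin 2) (Fin 2) K)) := rfl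

lemma rtrans_outer (h : H K) (i : Fin 4) (ξ : Fin 2 → K) :
    rtrans (toGSp K h) (rowForm K i 0 3 ξ) = rowForm K i 0 3 (std K (H.pr₁ K h) ξ) := by
  funext g
  simp [rowForm_apply, entries_toGSp, block, Matrix.mul_apply, Fin.sum_univ_four, std]
  ring

lemma rtrans_inner (h : H K) (i : Fin 4) (η : Fin 2 → K) :
    rtrans (toGSp K h) (rowForm K i 1 2 η) = rowForm K i 1 2 (std K (H.pr₂ K h) η) := by
  funext g
  simp [rowForm_apply, entries_toGSp, block, Matrix.mul_apply, Fin.sum_univ_four, std]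
  ring

lemma rtrans_mixed (h : H K) (ξ η : Fin 2 → K) : rtrans (toGSp K h) (mixed K ξ η) =
    mixed K (std K (H.pr₁ K h) ξ) (std K (H.pr₂ K h) η) := by
  change rtrans (toGSp K h) (rowForm K 0 0 3 ξ * rowForm K 1 1 2 η -
      rowForm K 1 0 3 ξ * rowForm K 0 1 2 η) = _
  rw [map_sub, map_mul, map_mul, rtrans_outer, rtrans_outer, rtrans_inner, rtrans_inner]
  rfl

lemma rtrans_outerMinor (h : H K) : rtrans (toGSp K h) (outerMinor K) =
    ((H.mu K h : Kˣ) : K) • outerMinor K := by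
  funext g
  have hmu : ((H.mu K h : Kˣ) : K) = (H.pr₁ K h : Matrix (Fin 2) (Fin 2) K).det := rfl
  rw [Pi.smul_apply, hmu, Matrix.det_fin_two]
  simp [outerMinor, entries_toGSp, block, Matrix.mul_apply, Fin.sum_univ_four]
  ring

lemma rtrans_fam (h : H K) (q m k r : ℕ) (ξ η : Fin 2 → K) :
    rtrans (toGSp K h) (fam q m k r ξ η) = ((H.mu K h : Kˣ) : K) ^ q •
      fam q m k r (std K (H.pr₁ K h) ξ) (std K (H.pr₂ K h) η) := by
  rw [fam, map_mul, map_mul, map_mul, map_pow, map_pow, map_pow, map_pow, rtrans_outerMinor,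
    rtrans_mixed, rtrans_outer, rtrans_inner, _root_.smul_pow, fam]
  simp only [smul_mul_assoc]

/-- A product of powers that lies in a subspace at infinitely many points of a line does so at the
base point. -/
lemma mem_of_line [Infinite K] {R : Type*} [CommRing R] [Algebra K R] (N : Submodule K R)
    {T : Set K} (hT : T.Infinite) (c x x' y y' : R) (l m : ℕ)
    (h : ∀ s ∈ T, c * (x + s • x') ^ l * (y + s • y') ^ m ∈ N) : c * x ^ l * y ^ m ∈ N := by
  have := eval_mem_of_eval_mem N hT (C c * (C x + C x' * Polynomial.X) ^ l *
    (C y + C y' * Polynomial.X) ^ m) (fun s hs => by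
      have := h s hs
      simp only [Algebra.smul_def] at this
      simpa [mul_comm _ (algebraMap K R s)] using this) 0
  simpa using this

lemma infinite_add_ne_zero [Infinite K] (c : K) : {s : K | c + s ≠ 0}.Infinite := by
  refine Set.infinite_of_finite_compl ?_
  convert Set.finite_singleton (-c)
  ext s
  simp [add_eq_zero_iff_eq_neg']

/-- A subspace stable under `H` contains a family if it contains its highest weight vector. -/
lemma fam_mem_of_stable [Infinite K] (N : Submodule K (GSp4 K → K))
    (hN : ∀ h, ∀ F ∈ N, rtrans (toGSp K h) F ∈ N) (q m k r : ℕ)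
    (h0 : fam q m k r (![1, 0] : Fin 2 → K) ![1, 0] ∈ N) (ξ η : Fin 2 → K) :
    fam q m k r ξ η ∈ N := by
  have h1 : ∀ ξ η : Fin 2 → K, ξ 0 ≠ 0 → η 0 ≠ 0 → fam q m k r ξ η ∈ N := by
    intro ξ η hξ hη
    have := hN (ofSL (lowSL (ξ 0) (ξ 1) hξ) (lowSL (η 0) (η 1) hη)) _ h0
    rw [rtrans_fam, mu_ofSL, std_pr₁_ofSL, std_pr₂_ofSL, lowSL_mulVec, lowSL_mulVec,
      Units.val_one, one_pow, one_smul] at this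
    convert this using 2 <;> ext i <;> fin_cases i <;> rfl
  have h2 : ∀ ξ η : Fin 2 → K, ξ 0 ≠ 0 → fam q m k r ξ η ∈ N := by
    intro ξ η hξ
    have := mem_of_line N (infinite_add_ne_zero (η 0)) (outerMinor K ^ q * outer K ξ ^ k)
      (mixed K ξ η) (mixed K ξ ![1, 0]) (inner K η) (inner K ![1, 0]) m r (fun s hs => by
        have := h1 ξ (η + s • ![1, 0]) hξ (by simpa using hs)
        rw [fam, map_add, map_add, map_smul, map_smul] at this
        convert this using 1
        ring)
    convert this using 1
    rw [fam]
    ring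
  have := mem_of_line N (infinite_add_ne_zero (ξ 0)) (outerMinor K ^ q * inner K η ^ r)
    (mixed K ξ η) (mixed K ![1, 0] η) (outer K ξ) (outer K ![1, 0]) m k (fun s hs => by
      have := h2 (ξ + s • ![1, 0]) η (by simpa using hs)
      rw [fam, map_add, map_add, map_smul, map_smul, LinearMap.add_apply,
        LinearMap.smul_apply] at this
      convert this using 1
      ring)
  convert this using 1
  rw [fam]
  ring

lemma model_rtrans {a b : ℕ} (h : GSp4 K) {F : GSp4 K → K} (hF : F ∈ (model K a b).toSubmodule) :
    rtrans h F ∈ (model K a b).toSubmodule := (model K a b).apply_mem_toSubmodule h hF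

/-- The families without outer minors lie in the model: a root subgroup that adds an inner column to
an outer one turns outer factors into inner ones. -/
lemma fam_zero_mem_model [CharZero K] (a k r : ℕ) (ξ η : Fin 2 → K) :
    fam 0 a k r ξ η ∈ (model K a (k + r)).toSubmodule := by
  refine fam_mem_of_stable _ (fun h F hF => model_rtrans _ hF) _ _ _ _ ?_ ξ η
  clear ξ η
  induction r generalizing k with
  | zero =>
    change fam 0 a k 0 _ _ ∈ (model K a k).toSubmodule
    convert hwFun_mem (K := K) a k using 1
    funext g
    simp [fam, mixed_apply, rowForm_apply, hwFun, minor]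
    ring
  | succ r ih =>
    have h1 := ih (k + 1)
    rw [add_right_comm, add_assoc] at h1
    have h2 := polarize (model K a (k + (r + 1))).toSubmodule
      (mixed K ![1, 0] ![1, 0] ^ a * inner K ![1, 0] ^ r) 0 0 0 0 (outer K ![1, 0])
      (inner K ![1, 0]) 0 0 (k + 1) (fun s => by
        have := model_rtrans (low s 0 0 0) h1
        convert this using 1
        funext g
        simp [fam, mixed_apply, rowForm_apply, entries_low, Matrix.mul_apply, Fin.sum_univ_four]
        ring)
    refine (Submodule.smul_mem_iff _ (Nat.cast_ne_zero (R := K).2 k.succ_ne_zero)).1 ?_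
    convert h2 using 1
    simp [fam, Algebra.smul_def]
    ring

/-- The polarization of a family in both variables, rewritten by the quadratic relations. -/
lemma double_polarization_identity {R : Type*} [CommRing R]
    {d z₁₁ z₁₂ z₂₁ z₂₂ u₁ u₂ v₁ v₂ : R} (q m k r : ℕ)
    (h1 : z₁₂ * z₂₁ = z₁₁ * z₂₂ + d ^ 2) (h2 : z₂₁ * v₂ = z₂₂ * v₁ + d * u₂)
    (h3 : z₁₂ * u₂ = z₂₂ * u₁ + d * v₂) (h4 : z₁₁ * v₂ = z₁₂ * v₁ + d * u₁) :
    (m + 2) * (d ^ q * u₁ ^ k) * ((m + 1) * z₁₁ ^ m * z₁₂ * z₂₁ * v₁ ^ r +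
        z₁₁ ^ (m + 1) * z₂₂ * v₁ ^ r + z₁₁ ^ (m + 1) * z₂₁ * (r * v₁ ^ (r - 1) * v₂)) +
      d ^ q * (k * u₁ ^ (k - 1) * u₂) * ((m + 2) * z₁₁ ^ (m + 1) * z₁₂ * v₁ ^ r +
        z₁₁ ^ (m + 2) * (r * v₁ ^ (r - 1) * v₂)) =
    (m + k + 2) * (m + r + 2) * (z₂₂ * (d ^ q * z₁₁ ^ (m + 1) * u₁ ^ k * v₁ ^ r)) +
      (m + 1) * (m + 2) * (d ^ (q + 2) * z₁₁ ^ m * u₁ ^ k * v₁ ^ r) +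
      r * (m + k + 2) * (u₂ * (d ^ (q + 1) * z₁₁ ^ (m + 1) * u₁ ^ k * v₁ ^ (r - 1))) +
      k * (m + r + 2) * (v₂ * (d ^ (q + 1) * z₁₁ ^ (m + 1) * u₁ ^ (k - 1) * v₁ ^ r)) := by
  rcases k with _ | k <;> rcases r with _ | r <;>
    simp only [Nat.add_sub_cancel, Nat.cast_zero, Nat.cast_add, Nat.cast_one, pow_zero]
  · linear_combination ((m + 2) * (m + 1) * d ^ q * z₁₁ ^ m) * h1
  · linear_combination ((m + 2) * (m + 1) * d ^ q * z₁₁ ^ m * v₁ ^ (r + 1)) * h1 +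
      ((m + 2) * (r + 1) * d ^ q * z₁₁ ^ (m + 1) * v₁ ^ r) * h2
  · linear_combination ((m + 2) * (m + 1) * d ^ q * z₁₁ ^ m * u₁ ^ (k + 1)) * h1 +
      ((m + 2) * (k + 1) * d ^ q * z₁₁ ^ (m + 1) * u₁ ^ k) * h3
  · linear_combination ((m + 2) * (m + 1) * d ^ q * z₁₁ ^ m * u₁ ^ (k + 1) * v₁ ^ (r + 1)) * h1 +
      ((m + 2) * (r + 1) * d ^ q * z₁₁ ^ (m + 1) * u₁ ^ (k + 1) * v₁ ^ r) * h2 +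
      ((m + 2) * (k + 1) * d ^ q * z₁₁ ^ (m + 1) * u₁ ^ k * v₁ ^ (r + 1)) * h3 +
      ((k + 1) * (r + 1) * d ^ q * z₁₁ ^ (m + 1) * u₁ ^ k * v₁ ^ r) * (u₂ * h4 + v₁ * h3)

/-- The coefficient computation behind `fam_mem_model`: the four relations determine `T` modulo a
subspace. -/
lemma mem_of_relations [CharZero K] {X : Type*} [AddCommGroup X] [Module K X] (N : Submodule K X)
    (q m k r : ℕ) {A C E T : X}
    (h0 : ((2 * (m + 1) : ℕ) : K) • T + (k : K) • C + (r : K) • E - (q : K) • A ∈ N)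
    (hC : (k : K) • (((m : K) + r + 2) • C - ((m : K) + 1) • T) ∈ N)
    (hE : (r : K) • (((m : K) + k + 2) • E - ((m : K) + 1) • T) ∈ N)
    (hA : (q : K) • ((((m : K) + k + 2) * (m + r + 2)) • A + (((m : K) + 1) * (m + 2)) • T +
      ((r : K) * (m + k + 2)) • E + ((k : K) * (m + r + 2)) • C) ∈ N) : T ∈ N := by
  have hne : ((q * (m + 1) * (m + k + r + 2) + 2 * (m + 1) * (m + k + 2) * (m + r + 2) +
      k * (m + 1) * (m + k + 2) + r * (m + 1) * (m + r + 2) : ℕ) : K) ≠ 0 := by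
    rw [Nat.cast_ne_zero]
    positivity
  refine (Submodule.smul_mem_iff _ hne).1 ?_
  -- eliminate `A`, then `C` and `E`; the coefficient of `T` that remains is a positive integer
  have h1 := N.smul_mem (((m : K) + k + 2) * (m + r + 2)) h0
  have h2 := N.smul_mem (-((m : K) + k + 2) - q) hC
  have h3 := N.smul_mem (-((m : K) + r + 2) - q) hE
  have := N.add_mem (N.add_mem (N.add_mem h1 h2) h3) hA
  convert this using 1
  push_cast
  module

/-- The families lie in the model of `V^{a,b}`; the induction on `q` uses the root subgroup that
mixes the outer and the inner columns. -/
lemma fam_mem_model [CharZero K] {a b : ℕ} (q : ℕ) : ∀ m k r, q + m = a → k + r = b →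
    ∀ ξ η : Fin 2 → K, fam q m k r ξ η ∈ (model K a b).toSubmodule := by
  induction q using Nat.strong_induction_on with
  | _ q ih =>
  intro m k r hm hk ξ η
  rcases q with _ | q
  · rw [zero_add] at hm
    subst hm hk
    exact fam_zero_mem_model m k r ξ η
  refine fam_mem_of_stable _ (fun h F hF => model_rtrans _ hF) _ _ _ _ ?_ ξ η
  clear ξ η
  set N := (model K a b).toSubmodule
  set e₀ : Fin 2 → K := ![1, 0] with he₀
  set e₁ : Fin 2 → K := ![0, 1] with he₁
  have hb01 : bracket e₀ e₁ = 1 := by simp [bracket, he₀, he₁]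
  have hb10 : bracket e₁ e₀ = -1 := by simp [bracket, he₀, he₁]
  refine mem_of_relations N q m k r (A := mixed K e₁ e₁ * fam (q - 1) (m + 1) k r e₀ e₀)
    (C := inner K e₁ * fam q (m + 1) (k - 1) r e₀ e₀)
    (E := outer K e₁ * fam q (m + 1) k (r - 1) e₀ e₀) ?_ ?_ ?_ ?_
  -- the tangent vector of the root subgroup at a family with one outer minor less
  · have h1 : ∀ s : K, ((C (outerMinor K) - C (mixed K e₁ e₁) * Polynomial.X) ^ q *
        (C (mixed K e₀ e₀) + C (2 * outerMinor K) * Polynomial.X -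
          C (mixed K e₁ e₁) * Polynomial.X ^ 2) ^ (m + 1) *
        (C (outer K e₀) + C (inner K e₁) * Polynomial.X) ^ k *
        (C (inner K e₀) + C (outer K e₁) * Polynomial.X) ^ r).eval
          (algebraMap K (GSp4 K → K) s) ∈ N := by
      intro s
      have := model_rtrans (low 0 s 0 0) (ih q (by omega) (m + 1) k r (by omega) hk e₀ e₀)
      convert this using 1
      funext g
      have hr := rel_row g
      have e1 : rtrans (low 0 s 0 0) (mixed K e₀ e₀) g = mixed K e₀ e₀ g +
          2 * outerMinor K g * s - mixed K e₁ e₁ g * s ^ 2 := by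
        simp [mixed_apply, rowForm_apply, entries_low, Matrix.mul_apply, Fin.sum_univ_four, he₀,
          he₁, outerMinor]
        linear_combination -s * hr
      have e2 : rtrans (low 0 s 0 0) (outerMinor K) g = outerMinor K g - mixed K e₁ e₁ g * s := by
        simp [mixed_apply, rowForm_apply, entries_low, Matrix.mul_apply, Fin.sum_univ_four,
          he₁, outerMinor]
        ring
      have e3 : rtrans (low 0 s 0 0) (outer K e₀) g = outer K e₀ g + inner K e₁ g * s := by
        simp [rowForm_apply, entries_low, Matrix.mul_apply, Fin.sum_univ_four, he₀, he₁]
      have e4 : rtrans (low 0 s 0 0) (inner K e₀) g = inner K e₀ g + outer K e₁ g * s := by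
        simp [rowForm_apply, entries_low, Matrix.mul_apply, Fin.sum_univ_four, he₀, he₁]
      rw [fam]
      simp only [map_mul, map_pow, Pi.mul_apply, Pi.pow_apply, e1, e2, e3, e4]
      simp
    have h2 := derivative_eval_mem N _ h1
    convert h2 using 1
    simp [Polynomial.derivative_mul, Polynomial.derivative_pow, fam, Algebra.smul_def]
    rw [show algebraMap K (GSp4 K → K) 2 = 2 from map_ofNat _ 2]
    ring
  · rcases k with _ | k
    · simp
    · have h1 := inner_mul_fam_sub_mem N q (m + 1) k r e₀
        (fun η => ih q (by omega) (m + 1) k (r + 1) (by omega) (by omega) e₀ η) e₀ e₁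
      refine N.smul_mem _ ?_
      convert h1 using 2
      · push_cast
        ring_nf
      · rw [hb01]
        push_cast
        rw [mul_one]
  · rcases r with _ | r
    · simp
    · have h1 := outer_mul_fam_sub_mem N q (m + 1) k r e₀
        (fun ξ => ih q (by omega) (m + 1) (k + 1) r (by omega) (by omega) ξ e₀) e₀ e₁
      refine N.smul_mem _ ?_
      convert h1 using 2
      · push_cast
        ring_nf
      · rw [hb01]
        push_cast
        rw [mul_one]
  -- polarization in both variables of a family with two outer minors less
  · rcases q with _ | q
    · simp
    refine N.smul_mem _ ?_
    have h1 := fun η => polarize_outer N q (m + 2) k r η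
      (fun ξ => ih q (by omega) (m + 2) k r (by omega) hk ξ η) e₀ e₁
    have h2 : ∀ s : K, (C ((m + 2) * (outerMinor K ^ q * outer K e₀ ^ k)) *
        ((C (mixed K e₀ e₀) + C (mixed K e₀ e₁) * Polynomial.X) ^ (m + 1) *
          (C (mixed K e₁ e₀) + C (mixed K e₁ e₁) * Polynomial.X) *
          (C (inner K e₀) + C (inner K e₁) * Polynomial.X) ^ r) +
        C (outerMinor K ^ q * (k * outer K e₀ ^ (k - 1) * outer K e₁)) *
        ((C (mixed K e₀ e₀) + C (mixed K e₀ e₁) * Polynomial.X) ^ (m + 2) *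
          (C (inner K e₀) + C (inner K e₁) * Polynomial.X) ^ r)).eval
          (algebraMap K (GSp4 K → K) s) ∈ N := by
      intro s
      have := h1 (e₀ + s • e₁)
      simp only [map_add, map_smul] at this
      simp only [Algebra.smul_def] at this
      convert this using 1
      simp
      ring
    have h3 := derivative_eval_mem N _ h2
    convert h3 using 1
    have i1 := mixed_mul_mixed e₀ e₁ e₀ e₁
    have i2 := mixed_mul_inner e₁ e₁ e₀
    have i3 := mixed_mul_outer e₁ e₀ e₁
    have i4 := mixed_mul_inner e₀ e₁ e₀
    rw [hb01, mul_one, one_smul] at i1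
    rw [hb10, neg_smul, one_smul, sub_neg_eq_add] at i2 i3 i4
    have h4 := double_polarization_identity q m k r i1 i2 i3 i4
    simp only [fam, Algebra.smul_def, map_mul, map_add, map_natCast, map_ofNat, map_one,
      Nat.add_sub_cancel]
    refine h4.symm.trans ?_
    simp [Polynomial.derivative_mul, Polynomial.derivative_pow]
    ring

end Spanning

/-! ### Equivariant maps out of sums of irreducible representations -/

section Joint

variable {K : Type*} [Field K] [CharZero K] {ι : Type*} [DecidableEq ι]
  (n l e : ι → ℕ) {X : Type*} [AddCommMonoid X] [Module K X] (ρ : Representation K (H K) X)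
  (Φ : ∀ i, SymBox K (n i) (l i) →ₗ[K] X)

/-- Maps out of the summands that are equivariant on products of powers assemble to an equivariant
map. -/
lemma toModule_comp_irrSum
    (hΦ : ∀ i h ξ η, ρ h (Φ i (pw (n i) ξ ⊗ₜ pw (l i) η)) = ((H.mu K h : Kˣ) : K) ^ e i •
      Φ i (pw (n i) (std K (H.pr₁ K h) ξ) ⊗ₜ pw (l i) (std K (H.pr₂ K h) η))) (h : H K) :
    DirectSum.toModule K ι X Φ ∘ₗ irrSum n l e h = ρ h ∘ₗ DirectSum.toModule K ι X Φ := by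
  refine DirectSum.linearMap_ext K fun i => LinearMap.ext fun z => ?_
  simp only [LinearMap.comp_apply]
  rw [irrSum_of, DirectSum.toModule_lof, DirectSum.toModule_lof]
  exact LinearMap.congr_fun (comp_irr_eq ρ (Φ i) h (hΦ i h)) z

lemma injective_toModule [Fintype ι]
    (hΦ : ∀ i h ξ η, ρ h (Φ i (pw (n i) ξ ⊗ₜ pw (l i) η)) = ((H.mu K h : Kˣ) : K) ^ e i •
      Φ i (pw (n i) (std K (H.pr₁ K h) ξ) ⊗ₜ pw (l i) (std K (H.pr₂ K h) η)))
    (hne : ∀ i, Φ i (hw (n i) (l i)) ≠ 0) (hinj : Function.Injective fun i => (n i, l i)) :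
    Function.Injective (DirectSum.toModule K ι X Φ) :=
  injective_of_hw n l e ρ _ (toModule_comp_irrSum n l e ρ Φ hΦ)
    (fun i => by rw [DirectSum.toModule_lof]; exact hne i) hinj

omit [CharZero K] [DecidableEq ι] in
lemma finrank_sum_symBox [Fintype ι] : Module.finrank K (⨁ i, SymBox K (n i) (l i)) =
    ∑ i, (n i + 1) * (l i + 1) := by
  rw [Module.finrank_directSum]
  simp [Module.finrank_tensorProduct]

omit [CharZero K] [DecidableEq ι] in
lemma injective_iff_surjective_of_finrank_eq {Y : Type*} [AddCommMonoid Y] [Module K Y]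
    [Module.Finite K X] [Module.Finite K Y] (f : X →ₗ[K] Y)
    (h : Module.finrank K X = Module.finrank K Y) :
    Function.Injective f ↔ Function.Surjective f := by
  let _ : AddCommGroup X := Module.addCommMonoidToAddCommGroup K
  let _ : AddCommGroup Y := Module.addCommMonoidToAddCommGroup K
  exact LinearMap.injective_iff_surjective_of_finrank_eq_finrank h

end Joint

/-! ### The Clebsch–Gordan decomposition -/

section ClebschGordan

variable {K : Type*} [Field K]

variable (K) in
/-- The symmetric algebra of the plane. -/
abbrev PlaneAlg : Type _ := SymmetricAlgebra K (Fin 2 → K)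

variable (K) in
/-- The polynomial functions of three points of the plane, in which the products
`Sym^k ⊠ (Sym^l ⊗ Sym^c)` are embedded. -/
def TripleAlg : Type _ := (PlaneAlg K ⊗[K] PlaneAlg K) ⊗[K] PlaneAlg K

instance : CommRing (TripleAlg K) :=
  inferInstanceAs (CommRing ((PlaneAlg K ⊗[K] PlaneAlg K) ⊗[K] PlaneAlg K))

instance : Algebra K (TripleAlg K) :=
  inferInstanceAs (Algebra K ((PlaneAlg K ⊗[K] PlaneAlg K) ⊗[K] PlaneAlg K))

variable (K) in
/-- The linear forms in the first point. -/
def form₁ : (Fin 2 → K) →ₗ[K] TripleAlg K :=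
  (Algebra.TensorProduct.includeLeft.comp Algebra.TensorProduct.includeLeft :
    PlaneAlg K →ₐ[K] TripleAlg K).toLinearMap ∘ₗ SymmetricAlgebra.ι K (Fin 2 → K)

variable (K) in
/-- The linear forms in the second point. -/
def form₂ : (Fin 2 → K) →ₗ[K] TripleAlg K :=
  (Algebra.TensorProduct.includeLeft.comp Algebra.TensorProduct.includeRight :
    PlaneAlg K →ₐ[K] TripleAlg K).toLinearMap ∘ₗ SymmetricAlgebra.ι K (Fin 2 → K)

variable (K) in
/-- The linear forms in the third point. -/
def form₃ : (Fin 2 → K) →ₗ[K] TripleAlg K :=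
  (Algebra.TensorProduct.includeRight : PlaneAlg K →ₐ[K] TripleAlg K).toLinearMap ∘ₗ
    SymmetricAlgebra.ι K (Fin 2 → K)

/-- A decomposable element of `TripleAlg`. -/
def triple (x y z : PlaneAlg K) : TripleAlg K := (x ⊗ₜ[K] y) ⊗ₜ[K] z

lemma triple_mul (x y z x' y' z' : PlaneAlg K) :
    triple x y z * triple x' y' z' = triple (x * x') (y * y') (z * z') := by
  change (x ⊗ₜ[K] y ⊗ₜ[K] z) * (x' ⊗ₜ[K] y' ⊗ₜ[K] z') = _
  rw [Algebra.TensorProduct.tmul_mul_tmul, Algebra.TensorProduct.tmul_mul_tmul]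
  rfl

lemma form₁_apply (ξ : Fin 2 → K) : form₁ K ξ = triple (SymmetricAlgebra.ι K _ ξ) 1 1 := rfl

lemma form₂_apply (ξ : Fin 2 → K) : form₂ K ξ = triple 1 (SymmetricAlgebra.ι K _ ξ) 1 := rfl

lemma form₃_apply (ξ : Fin 2 → K) : form₃ K ξ = triple 1 1 (SymmetricAlgebra.ι K _ ξ) := rfl

variable (K) in
/-- The determinant of the second and the third point. -/
def detForm : TripleAlg K :=
  form₂ K ![1, 0] * form₃ K ![0, 1] - form₂ K ![0, 1] * form₃ K ![1, 0]

variable (K) in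
/-- The embedding of the trihomogeneous elements. -/
def tripleIncl (k l c : ℕ) :
    SymBox K k l ⊗[K] SymPow K (Fin 2 → K) c →ₗ[K] TripleAlg K :=
  TensorProduct.map (TensorProduct.map (SymPow K (Fin 2 → K) k).subtype
    (SymPow K (Fin 2 → K) l).subtype) (SymPow K (Fin 2 → K) c).subtype

lemma tripleIncl_tmul (k l c : ℕ) (p : SymPow K (Fin 2 → K) k) (q : SymPow K (Fin 2 → K) l)
    (r : SymPow K (Fin 2 → K) c) : tripleIncl K k l c ((p ⊗ₜ q) ⊗ₜ r) = triple p.1 q.1 r.1 := rfl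

lemma tripleIncl_injective (k l c : ℕ) : Function.Injective (tripleIncl K k l c) :=
  TensorProduct.map_injective_of_flat_flat _ _
    (TensorProduct.map_injective_of_flat_flat _ _ (Submodule.subtype_injective _)
      (Submodule.subtype_injective _)) (Submodule.subtype_injective _)

/-- The action of `H` on `TripleAlg` by algebra endomorphisms. -/
def tripleAct (h : H K) : TripleAlg K →ₐ[K] TripleAlg K :=
  Algebra.TensorProduct.map (Algebra.TensorProduct.map (symMap (std K (H.pr₁ K h)))
    (symMap (std K (H.pr₂ K h)))) (symMap (std K (H.pr₂ K h)))

variable (K) in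
/-- The representation `Sym^k ⊠ (Sym^l ⊗ Sym^c)` of `H`. -/
abbrev tripleRep (k l c : ℕ) :
    Representation K (H K) (SymBox K k l ⊗[K] SymPow K (Fin 2 → K) c) :=
  Representation.tprod (irr k l 0) ((Sym K c).comp (H.pr₂ K))

lemma tripleIncl_rep (k l c : ℕ) (h : H K) (x) :
    tripleIncl K k l c (tripleRep K k l c h x) = tripleAct h (tripleIncl K k l c x) := by
  suffices e : tripleIncl K k l c ∘ₗ tripleRep K k l c h =
      (tripleAct h).toLinearMap ∘ₗ tripleIncl K k l c from LinearMap.congr_fun e x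
  refine TensorProduct.ext_threefold fun p q r => ?_
  have h1 : irr k l 0 h (p ⊗ₜ[K] q) = Sym K k (H.pr₁ K h) p ⊗ₜ[K] Sym K l (H.pr₂ K h) q := by
    change ((((H.mu K ^ 0) h : Kˣ)) : K) • TensorProduct.map (Sym K k (H.pr₁ K h))
      (Sym K l (H.pr₂ K h)) (p ⊗ₜ q) = _
    simp
  have h2 : tripleRep K k l c h ((p ⊗ₜ[K] q) ⊗ₜ[K] r) =
      irr k l 0 h (p ⊗ₜ[K] q) ⊗ₜ[K] Sym K c (H.pr₂ K h) r := rfl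
  rw [LinearMap.comp_apply, h2, h1]
  rfl

lemma symMap_ι (f : (Fin 2 → K) →ₗ[K] (Fin 2 → K)) (ξ : Fin 2 → K) :
    symMap f (SymmetricAlgebra.ι K _ ξ) = SymmetricAlgebra.ι K _ (f ξ) := by
  simp [symMap]

lemma tripleAct_triple (h : H K) (x y z : PlaneAlg K) : tripleAct h (triple x y z) =
    triple (symMap (std K (H.pr₁ K h)) x) (symMap (std K (H.pr₂ K h)) y)
      (symMap (std K (H.pr₂ K h)) z) := rfl

lemma tripleAct_form₁ (h : H K) (ξ : Fin 2 → K) :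
    tripleAct h (form₁ K ξ) = form₁ K (std K (H.pr₁ K h) ξ) := by
  rw [form₁_apply, form₁_apply, tripleAct_triple, symMap_ι, map_one]

lemma tripleAct_form₂ (h : H K) (ξ : Fin 2 → K) :
    tripleAct h (form₂ K ξ) = form₂ K (std K (H.pr₂ K h) ξ) := by
  rw [form₂_apply, form₂_apply, tripleAct_triple, symMap_ι, map_one, map_one]

lemma tripleAct_form₃ (h : H K) (ξ : Fin 2 → K) :
    tripleAct h (form₃ K ξ) = form₃ K (std K (H.pr₂ K h) ξ) := by
  rw [form₃_apply, form₃_apply, tripleAct_triple, symMap_ι, map_one, map_one]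

lemma form_std {R : Type*} [AddCommGroup R] [Module K R] (f : (Fin 2 → K) →ₗ[K] R)
    (g : GL (Fin 2) K) :
    f (std K g ![1, 0]) = g.1 0 0 • f ![1, 0] + g.1 1 0 • f ![0, 1] ∧
    f (std K g ![0, 1]) = g.1 0 1 • f ![1, 0] + g.1 1 1 • f ![0, 1] := by
  constructor <;> rw [← map_smul, ← map_smul, ← map_add] <;> congr 1 <;> ext i <;>
    fin_cases i <;> simp [std, Matrix.mulVec, dotProduct]

lemma tripleAct_detForm (h : H K) :
    tripleAct h (detForm K) = ((H.mu K h : Kˣ) : K) • detForm K := by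
  have hmu : ((H.mu K h : Kˣ) : K) = (H.pr₂ K h : Matrix (Fin 2) (Fin 2) K).det :=
    congrArg Units.val h.2
  have e₂ := form_std (form₂ K) (H.pr₂ K h)
  have e₃ := form_std (form₃ K) (H.pr₂ K h)
  rw [hmu, Matrix.det_fin_two, detForm, map_sub, map_mul, map_mul, tripleAct_form₂,
    tripleAct_form₂, tripleAct_form₃, tripleAct_form₃, e₂.1, e₂.2, e₃.1, e₃.2]
  simp only [Algebra.smul_def, map_sub, map_mul]
  ring

/-- The trihomogeneous elements of the triple algebra. -/
def triplePart (k l c : ℕ) : Submodule K (TripleAlg K) := LinearMap.range (tripleIncl K k l c)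

lemma mul_mem_triplePart {k l c k' l' c' : ℕ} {x y : TripleAlg K} (hx : x ∈ triplePart k l c)
    (hy : y ∈ triplePart k' l' c') : x * y ∈ triplePart (k + k') (l + l') (c + c') := by
  have hmul {m m' : ℕ} (p : SymPow K (Fin 2 → K) m) (p' : SymPow K (Fin 2 → K) m') :
      p.1 * p'.1 ∈ SymPow K (Fin 2 → K) (m + m') := by
    rw [SymPow, pow_add]
    exact Submodule.mul_mem_mul p.2 p'.2
  obtain ⟨x, rfl⟩ := hx
  obtain ⟨y, rfl⟩ := hy
  induction x using TensorProduct.induction_on with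
  | zero => rw [map_zero, zero_mul]; exact Submodule.zero_mem _
  | add x x' h h' => rw [map_add, add_mul]; exact Submodule.add_mem _ h h'
  | tmul x r =>
  induction x using TensorProduct.induction_on with
  | zero => rw [TensorProduct.zero_tmul, map_zero, zero_mul]; exact Submodule.zero_mem _
  | add x x' h h' =>
    rw [TensorProduct.add_tmul, map_add, add_mul]; exact Submodule.add_mem _ h h'
  | tmul p q =>
  induction y using TensorProduct.induction_on with
  | zero => rw [map_zero, mul_zero]; exact Submodule.zero_mem _
  | add x x' h h' => rw [map_add, mul_add]; exact Submodule.add_mem _ h h'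
  | tmul y r' =>
  induction y using TensorProduct.induction_on with
  | zero => rw [TensorProduct.zero_tmul, map_zero, mul_zero]; exact Submodule.zero_mem _
  | add x x' h h' =>
    rw [TensorProduct.add_tmul, map_add, mul_add]; exact Submodule.add_mem _ h h'
  | tmul p' q' =>
    refine ⟨(⟨_, hmul p p'⟩ ⊗ₜ ⟨_, hmul q q'⟩) ⊗ₜ ⟨_, hmul r r'⟩, ?_⟩
    rw [tripleIncl_tmul, tripleIncl_tmul, tripleIncl_tmul, triple_mul]

lemma one_mem_triplePart : (1 : TripleAlg K) ∈ triplePart 0 0 0 :=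
  ⟨(pw 0 0 ⊗ₜ pw 0 0) ⊗ₜ pw 0 0, by rw [tripleIncl_tmul, coe_pw, pow_zero]; rfl⟩

lemma pow_mem_triplePart {k l c : ℕ} {x : TripleAlg K} (hx : x ∈ triplePart k l c) (m : ℕ) :
    x ^ m ∈ triplePart (m * k) (m * l) (m * c) := by
  induction m with
  | zero =>
    rw [pow_zero, zero_mul, zero_mul, zero_mul]
    exact one_mem_triplePart
  | succ m ih =>
    rw [pow_succ, add_mul, add_mul, add_mul, one_mul, one_mul, one_mul]
    exact mul_mem_triplePart ih hx

lemma form₁_mem (ξ : Fin 2 → K) : form₁ K ξ ∈ triplePart 1 0 0 :=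
  ⟨(pw 1 ξ ⊗ₜ pw 0 0) ⊗ₜ pw 0 0, by
    rw [tripleIncl_tmul, coe_pw, coe_pw, pow_zero, pow_one, form₁_apply]⟩

lemma form₂_mem (ξ : Fin 2 → K) : form₂ K ξ ∈ triplePart 0 1 0 :=
  ⟨(pw 0 0 ⊗ₜ pw 1 ξ) ⊗ₜ pw 0 0, by
    rw [tripleIncl_tmul, coe_pw, coe_pw, pow_zero, pow_one, form₂_apply]⟩

lemma form₃_mem (ξ : Fin 2 → K) : form₃ K ξ ∈ triplePart 0 0 1 :=
  ⟨(pw 0 0 ⊗ₜ pw 0 0) ⊗ₜ pw 1 ξ, by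
    rw [tripleIncl_tmul, coe_pw, coe_pw, pow_zero, pow_one, form₃_apply]⟩

lemma detForm_mem : detForm K ∈ triplePart 0 1 1 := by
  have h : ∀ ξ η, form₂ K ξ * form₃ K η ∈ triplePart 0 1 1 := by
    intro ξ η
    have := mul_mem_triplePart (form₂_mem ξ) (form₃_mem η)
    rwa [zero_add, zero_add, add_zero] at this
  exact Submodule.sub_mem _ (h _ _) (h _ _)

/-- The Clebsch–Gordan family: the multiples of the `j`-th power of the determinant. -/
def cgFam (k l c j : ℕ) (ξ η : Fin 2 → K) : TripleAlg K :=
  form₁ K ξ ^ k * detForm K ^ j * form₂ K η ^ (l - j) * form₃ K η ^ (c - j)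

lemma cgFam_mem_bihom {k l c j : ℕ} (hl : j ≤ l) (hc : j ≤ c) :
    cgFam k l c j ∈ bihom K (TripleAlg K) k (l + c - 2 * j) := by
  have h := bihom_mul (bihom_mul (bihom_mul (bihom_pow (bihom_left (form₁ K)) k)
    (bihom_const (detForm K ^ j))) (bihom_pow (bihom_right (form₂ K)) (l - j)))
    (bihom_pow (bihom_right (form₃ K)) (c - j))
  have e : l + c - 2 * j = k * 0 + 0 + (l - j) * 1 + (c - j) * 1 := by omega
  rw [e]
  simp only [mul_one, add_zero, mul_zero] at h ⊢
  exact h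

lemma cgFam_mem_triplePart {k l c j : ℕ} (hl : j ≤ l) (hc : j ≤ c) (ξ η : Fin 2 → K) :
    cgFam k l c j ξ η ∈ triplePart k l c := by
  have h := mul_mem_triplePart (mul_mem_triplePart (mul_mem_triplePart
    (pow_mem_triplePart (form₁_mem ξ) k) (pow_mem_triplePart (detForm_mem (K := K)) j))
    (pow_mem_triplePart (form₂_mem η) (l - j))) (pow_mem_triplePart (form₃_mem η) (c - j))
  simp only [mul_one, mul_zero, add_zero, zero_add, Nat.add_sub_cancel' hl,
    Nat.add_sub_cancel' hc] at h
  exact h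

lemma tripleAct_cgFam (h : H K) (k l c j : ℕ) (ξ η : Fin 2 → K) :
    tripleAct h (cgFam k l c j ξ η) = ((H.mu K h : Kˣ) : K) ^ j •
      cgFam k l c j (std K (H.pr₁ K h) ξ) (std K (H.pr₂ K h) η) := by
  rw [cgFam, map_mul, map_mul, map_mul, map_pow, map_pow, map_pow, map_pow, tripleAct_form₁,
    tripleAct_form₂, tripleAct_form₃, tripleAct_detForm, _root_.smul_pow, cgFam]
  simp only [smul_mul_assoc, mul_smul_comm]

lemma cgFam_ne_zero (k l c j : ℕ) : cgFam k l c j (![1, 0] : Fin 2 → K) ![1, 0] ≠ 0 := by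
  -- evaluate at three points, the second and the third of which are linearly independent
  let f (s : K) : PlaneAlg K →ₐ[K] K :=
    SymmetricAlgebra.lift (LinearMap.proj 0 + s • LinearMap.proj 1)
  let F : TripleAlg K →ₐ[K] K :=
    Algebra.TensorProduct.productMap (Algebra.TensorProduct.productMap (f 0) (f 0)) (f 1)
  intro h
  have h1 := congrArg F h
  have hF : ∀ x y z, F (triple x y z) = f 0 x * f 0 y * f 1 z := by
    intro x y z
    change Algebra.TensorProduct.productMap _ _ (_ ⊗ₜ _) = _
    rw [Algebra.TensorProduct.productMap_apply_tmul, Algebra.TensorProduct.productMap_apply_tmul]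
  rw [cgFam, detForm, map_mul, map_mul, map_mul, map_pow, map_pow, map_pow, map_pow, map_sub,
    map_mul, map_mul, form₁_apply, form₂_apply, form₂_apply, form₃_apply, form₃_apply, map_zero,
    hF, hF, hF, hF, hF] at h1
  simp [f] at h1

lemma sum_clebschGordan (l c m : ℕ) (hl : m ≤ l) (hc : m ≤ c) :
    ∑ j ∈ Finset.range (m + 1), (l + c - 2 * j + 1) = (m + 1) * (l + c - m + 1) := by
  induction m with
  | zero => simp
  | succ m ih =>
    rw [Finset.sum_range_succ, ih (by omega) (by omega)]
    obtain ⟨p, rfl⟩ := Nat.exists_eq_add_of_le hl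
    obtain ⟨q, rfl⟩ := Nat.exists_eq_add_of_le hc
    have h1 : m + 1 + p + (m + 1 + q) - m = p + q + m + 2 := by omega
    have h2 : m + 1 + p + (m + 1 + q) - 2 * (m + 1) = p + q := by omega
    have h3 : m + 1 + p + (m + 1 + q) - (m + 1) = p + q + m + 1 := by omega
    rw [h1, h2, h3]
    ring

/-- The dimension count for the Clebsch–Gordan decomposition. -/
lemma sum_clebschGordan_min (l c : ℕ) :
    ∑ j : Fin (min l c + 1), (l + c - 2 * j + 1) = (l + 1) * (c + 1) := by
  rw [Fin.sum_univ_eq_sum_range (fun j => l + c - 2 * j + 1), sum_clebschGordan _ _ _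
    (min_le_left _ _) (min_le_right _ _)]
  rcases le_total l c with h | h
  · rw [min_eq_left h, Nat.add_sub_cancel_left]
  · rw [min_eq_right h, Nat.add_sub_cancel, mul_comm]

/-- The Clebsch–Gordan decomposition of `Sym^k ⊠ (Sym^l ⊗ Sym^c)`. -/
theorem exists_clebschGordan [CharZero K] (k l c : ℕ) :
    ∃ C : ∀ j : Fin (min l c + 1),
        SymBox K k (l + c - 2 * j) →ₗ[K] SymBox K k l ⊗[K] SymPow K (Fin 2 → K) c,
      (∀ j h ξ η, tripleRep K k l c h (C j (pw k ξ ⊗ₜ pw _ η)) =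
        ((H.mu K h : Kˣ) : K) ^ (j : ℕ) •
          C j (pw k (std K (H.pr₁ K h) ξ) ⊗ₜ pw _ (std K (H.pr₂ K h) η))) ∧
      Function.Surjective (DirectSum.toModule K _ _ C) := by
  have hl : ∀ j : Fin (min l c + 1), (j : ℕ) ≤ l := fun j => by omega
  have hc : ∀ j : Fin (min l c + 1), (j : ℕ) ≤ c := fun j => by omega
  choose Φ hΦ using fun j : Fin (min l c + 1) =>
    exists_lift (cgFam_mem_bihom (K := K) (k := k) (hl j) (hc j))
  have hmem : ∀ j y, Φ j y ∈ triplePart k l c := fun j y =>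
    range_lift (Φ j) _ (fun ξ η => by rw [hΦ]; exact cgFam_mem_triplePart (hl j) (hc j) ξ η) y
  let i := LinearEquiv.ofInjective (tripleIncl K k l c) (tripleIncl_injective k l c)
  let C : ∀ j : Fin (min l c + 1),
      SymBox K k (l + c - 2 * j) →ₗ[K] SymBox K k l ⊗[K] SymPow K (Fin 2 → K) c :=
    fun j => i.symm.toLinearMap ∘ₗ (Φ j).codRestrict (triplePart k l c) (hmem j)
  have hC : ∀ j y, tripleIncl K k l c (C j y) = Φ j y := fun j y =>
    congrArg Subtype.val (i.apply_symm_apply ⟨Φ j y, hmem j y⟩)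
  have heq : ∀ j h ξ η, tripleRep K k l c h (C j (pw k ξ ⊗ₜ pw _ η)) =
      ((H.mu K h : Kˣ) : K) ^ (j : ℕ) •
        C j (pw k (std K (H.pr₁ K h) ξ) ⊗ₜ pw _ (std K (H.pr₂ K h) η)) := by
    intro j h ξ η
    apply tripleIncl_injective
    rw [tripleIncl_rep, hC, hΦ, tripleAct_cgFam, LinearMap.map_smul, hC, hΦ]
  refine ⟨C, heq, ?_⟩
  -- injectivity holds because the highest weights differ, and surjectivity by counting dimensions
  refine (injective_iff_surjective_of_finrank_eq _ ?_).1 (injective_toModule (fun _ => k) _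
    (fun j : Fin (min l c + 1) => (j : ℕ)) (tripleRep K k l c) C heq (fun j h0 => ?_)
      fun j j' h => ?_)
  · rw [finrank_sum_symBox, Module.finrank_tensorProduct, Module.finrank_tensorProduct,
      finrank_symPow, finrank_symPow, finrank_symPow, ← Finset.mul_sum, mul_assoc]
    rw [sum_clebschGordan_min]
  · have h1 := hC j (hw _ _)
    rw [h0, map_zero, hw, hΦ] at h1
    exact cgFam_ne_zero k l c j h1.symm
  · have h2 : l + c - 2 * (j : ℕ) = l + c - 2 * (j' : ℕ) := congrArg Prod.snd h
    have := hl j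
    have := hl j'
    have := hc j
    have := hc j'
    exact Fin.ext (by omega)

end ClebschGordan

/-! ### The branching law -/

section Branching

variable {K : Type*} [Field K]

lemma toModule_mem {ι : Type*} [DecidableEq ι] {M : ι → Type*} [∀ i, AddCommMonoid (M i)]
    [∀ i, Module K (M i)] {X : Type*} [AddCommMonoid X] [Module K X] (Φ : ∀ i, M i →ₗ[K] X)
    (N : Submodule K X) (h : ∀ i z, Φ i z ∈ N) (y : ⨁ i, M i) :
    DirectSum.toModule K ι X Φ y ∈ N := by
  induction y using DirectSum.induction_on with
  | zero => rw [map_zero]; exact N.zero_mem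
  | add x y hx hy => rw [map_add]; exact N.add_mem hx hy
  | of i z =>
    have := DirectSum.toModule_lof K (φ := Φ) i z
    rw [DirectSum.lof_eq_of] at this
    rw [this]
    exact h i z

lemma apply_mem_range_toModule {ι : Type*} [DecidableEq ι] {M : ι → Type*}
    [∀ i, AddCommMonoid (M i)] [∀ i, Module K (M i)] {X : Type*} [AddCommMonoid X] [Module K X]
    (Φ : ∀ i, M i →ₗ[K] X) (i : ι) (z : M i) :
    Φ i z ∈ LinearMap.range (DirectSum.toModule K ι X Φ) :=
  ⟨DirectSum.lof K ι M i z, DirectSum.toModule_lof K i z⟩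

lemma fam_mem_bihom (q m k r : ℕ) :
    fam q m k r ∈ bihom K (GSp4 K → K) (m + k) (m + r) := by
  have hs (f f' : (Fin 2 → K) →ₗ[K] (GSp4 K → K)) :
      ((fun ξ _ => f ξ) * fun _ η => f' η) ∈ bihom K (GSp4 K → K) 1 1 := by
    have := bihom_mul (bihom_left f) (bihom_right f')
    rwa [zero_add, add_zero] at this
  have hm : (fun ξ η => mixed K ξ η) ∈ bihom K (GSp4 K → K) 1 1 := by
    have := Submodule.sub_mem _ (hs (rowForm K 0 0 3) (rowForm K 1 1 2))
      (hs (rowForm K 1 0 3) (rowForm K 0 1 2))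
    exact this
  have h := bihom_mul (bihom_mul (bihom_mul (bihom_const (outerMinor K ^ q)) (bihom_pow hm m))
    (bihom_pow (bihom_left (outer K)) k)) (bihom_pow (bihom_right (inner K)) r)
  simp only [mul_one, mul_zero, add_zero, zero_add] at h
  exact h

lemma fam_ne_zero (q m k r : ℕ) : fam q m k r (![1, 0] : Fin 2 → K) ![1, 0] ≠ 0 := by
  -- all four factors are `1` at an element whose first rows are `(1, 1, 1, 1)` and `(0, 1, 0, 1)`
  intro h
  have h1 := congrFun h (up 1 0 0 0 * up 0 1 0 0)
  simp [fam, mixed_apply, rowForm_apply, outerMinor, entries_up, Matrix.mul_apply,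
    Fin.sum_univ_four] at h1

lemma irr_eq_smul (n l e : ℕ) (h : H K) (z : SymBox K n l) :
    irr n l e h z = ((H.mu K h : Kˣ) : K) ^ e • irr n l 0 h z := by
  change ((((H.mu K ^ e) h : Kˣ)) : K) • boxH (Sym K n) (Sym K l) h z =
    _ • ((((H.mu K ^ 0) h : Kˣ)) : K) • boxH (Sym K n) (Sym K l) h z
  simp

variable [CharZero K]

/-- The restriction of the model of `V^{a,b}` to `H`. -/
theorem exists_branching_model (a b : ℕ) :
    ∃ Φ : ∀ i : Fin (a + 1) × Fin (b + 1),
        SymBox K (a + b - i.1 - i.2) (a - i.1 + i.2) →ₗ[K] (model K a b).toSubmodule,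
      (∀ i h ξ η, (model K a b).toRepresentation (toGSp K h) (Φ i (pw _ ξ ⊗ₜ pw _ η)) =
        ((H.mu K h : Kˣ) : K) ^ (i.1 : ℕ) •
          Φ i (pw _ (std K (H.pr₁ K h) ξ) ⊗ₜ pw _ (std K (H.pr₂ K h) η))) ∧
      Function.Bijective (DirectSum.toModule K _ _ Φ) := by
  have hdeg : ∀ i : Fin (a + 1) × Fin (b + 1),
      fam (i.1 : ℕ) (a - i.1) (b - i.2) i.2 ∈
        bihom K (GSp4 K → K) (a + b - i.1 - i.2) (a - i.1 + i.2) := by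
    intro i
    convert fam_mem_bihom (i.1 : ℕ) (a - i.1) (b - i.2) i.2 using 1
    congr 1
    omega
  choose Φ hΦ using fun i => exists_lift (hdeg i)
  have hmem : ∀ i y, Φ i y ∈ (model K a b).toSubmodule := fun i y =>
    range_lift (Φ i) _ (fun ξ η => by
      rw [hΦ]; exact fam_mem_model _ _ _ _ (by omega) (by omega) ξ η) y
  let Φ' : ∀ i : Fin (a + 1) × Fin (b + 1),
      SymBox K (a + b - i.1 - i.2) (a - i.1 + i.2) →ₗ[K] (model K a b).toSubmodule :=
    fun i => (Φ i).codRestrict _ (hmem i)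
  have heq : ∀ i h ξ η, (model K a b).toRepresentation (toGSp K h) (Φ' i (pw _ ξ ⊗ₜ pw _ η)) =
      ((H.mu K h : Kˣ) : K) ^ (i.1 : ℕ) •
        Φ' i (pw _ (std K (H.pr₁ K h) ξ) ⊗ₜ pw _ (std K (H.pr₂ K h) η)) := by
    intro i h ξ η
    apply Subtype.ext
    change rtrans (toGSp K h) (Φ i (pw _ ξ ⊗ₜ pw _ η)) = _ • Φ i _
    rw [hΦ, hΦ, rtrans_fam]
  refine ⟨Φ', heq, ?_, ?_⟩
  · refine injective_toModule _ _ (fun i => (i.1 : ℕ))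
      ((model K a b).toRepresentation.comp (toGSp K)) Φ' heq (fun i h0 => ?_) fun i i' h => ?_
    · have h1 : Φ i (hw _ _) = 0 := congrArg Subtype.val h0
      rw [hw, hΦ] at h1
      exact fam_ne_zero _ _ _ _ h1
    · have h1 := congrArg Prod.fst h
      have h2 := congrArg Prod.snd h
      dsimp only at h1 h2
      ext <;> omega
  · rintro ⟨F, hF⟩
    have hle : (model K a b).toSubmodule ≤
        (LinearMap.range (DirectSum.toModule K _ _ Φ')).map (model K a b).toSubmodule.subtype := by
      refine (model_le_famSpan a b).trans (Submodule.span_le.2 ?_)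
      rintro _ ⟨q, m, k, r, ξ, η, rfl, rfl, rfl⟩
      let i : Fin (q + m + 1) × Fin (k + r + 1) := (⟨q, by omega⟩, ⟨r, by omega⟩)
      refine ⟨_, apply_mem_range_toModule Φ' i (pw _ ξ ⊗ₜ pw _ η), ?_⟩
      change Φ i (pw _ ξ ⊗ₜ pw _ η) = _
      rw [hΦ]
      simp [i]
    obtain ⟨x, ⟨y, hy⟩, hx⟩ := hle hF
    exact ⟨y, hy.trans (Subtype.ext hx)⟩

variable {V : Type*} [AddCommGroup V] [Module K V] {π : Representation K (GSp4 K) V}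

/-- The restriction of `V^{a,b}` to `H`. -/
theorem exists_branching {a b : ℕ} (h : IsV a b π) :
    ∃ Φ : ∀ i : Fin (a + 1) × Fin (b + 1),
        SymBox K (a + b - i.1 - i.2) (a - i.1 + i.2) →ₗ[K] V,
      (∀ i h ξ η, π (toGSp K h) (Φ i (pw _ ξ ⊗ₜ pw _ η)) = ((H.mu K h : Kˣ) : K) ^ (i.1 : ℕ) •
          Φ i (pw _ (std K (H.pr₁ K h) ξ) ⊗ₜ pw _ (std K (H.pr₂ K h) η))) ∧
      Function.Bijective (DirectSum.toModule K _ _ Φ) := by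
  obtain ⟨φ⟩ := nonempty_equiv_model h
  obtain ⟨Φ, h1, h2⟩ := exists_branching_model (K := K) a b
  refine ⟨fun i => φ.symm.toLinearEquiv.toLinearMap ∘ₗ Φ i, fun i h ξ η => ?_, ?_⟩
  · have := equiv_map φ.symm (toGSp K h) (Φ i (pw _ ξ ⊗ₜ pw _ η))
    rw [h1] at this
    exact this.symm.trans (LinearEquiv.map_smul φ.symm.toLinearEquiv _ _)
  · have e : DirectSum.toModule K _ _ (fun i => φ.symm.toLinearEquiv.toLinearMap ∘ₗ Φ i) =
        φ.symm.toLinearEquiv.toLinearMap ∘ₗ DirectSum.toModule K _ _ Φ := by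
      refine DirectSum.linearMap_ext K fun i => LinearMap.ext fun z => ?_
      simp only [LinearMap.comp_apply]
      rw [DirectSum.toModule_lof, DirectSum.toModule_lof]
      rfl
    rw [e]
    exact φ.symm.toLinearEquiv.bijective.comp h2

/-- The index set, fibred over the constituents of `V^{a,b}`. -/
def indexEquiv (a b c : ℕ) : Index a b c ≃
    Σ i : Fin (a + 1) × Fin (b + 1), Fin (min (a - i.1 + i.2) c + 1) where
  toFun x :=
    ⟨(⟨x.1.1, by omega⟩, ⟨x.1.2.1, by omega⟩), ⟨x.1.2.2, by have := x.2.2.2; simp; omega⟩⟩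
  invFun y := ⟨(y.1.1, y.1.2, y.2), by dsimp only; omega, by dsimp only; omega, by dsimp only; omega⟩
  left_inv _ := rfl
  right_inv _ := rfl

instance (a b c : ℕ) : Fintype (Index a b c) := Fintype.ofEquiv _ (indexEquiv a b c).symm

/-- The branching law for `W^{a,b,c}`. -/
theorem nonempty_equiv_irrSum {a b : ℕ} (hπ : IsV a b π) (c : ℕ) :
    Nonempty ((iotaW π c).Equiv (irrSum (K := K)
      (fun x : Index a b c => a + b - x.1.1 - x.1.2.1)
      (fun x => a - x.1.1 + x.1.2.1 + c - 2 * x.1.2.2) (fun x => x.1.2.2 + x.1.1))) := by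
  have := hπ.algebraic.1
  obtain ⟨Φ, hΦ, hbij⟩ := exists_branching hπ
  choose C hC hsurj using fun i : Fin (a + 1) × Fin (b + 1) =>
    exists_clebschGordan (K := K) (a + b - i.1 - i.2) (a - i.1 + i.2) c
  let T (i : Fin (a + 1) × Fin (b + 1)) :
      SymBox K (a + b - i.1 - i.2) (a - i.1 + i.2) ⊗[K] SymPow K (Fin 2 → K) c →ₗ[K]
        V ⊗[K] SymPow K (Fin 2 → K) c := TensorProduct.map (Φ i) LinearMap.id
  have hT : ∀ i h z, iotaW π c h (T i z) = ((H.mu K h : Kˣ) : K) ^ (i.1 : ℕ) •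
      T i (tripleRep K _ _ c h z) := by
    intro i h z
    suffices e : iotaW π c h ∘ₗ T i = ((H.mu K h : Kˣ) : K) ^ (i.1 : ℕ) •
        (T i ∘ₗ tripleRep K _ _ c h) from LinearMap.congr_fun e z
    refine TensorProduct.ext' fun y w => ?_
    have h1 := LinearMap.congr_fun (comp_irr_eq (π.comp (toGSp K)) (Φ i) h (hΦ i h)) y
    simp only [LinearMap.comp_apply] at h1
    rw [irr_eq_smul, LinearMap.map_smul] at h1
    change π (toGSp K h) (Φ i y) ⊗ₜ[K] Sym K c (H.pr₂ K h) w =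
      ((H.mu K h : Kˣ) : K) ^ (i.1 : ℕ) •
        (Φ i (irr _ _ 0 h y) ⊗ₜ[K] Sym K c (H.pr₂ K h) w)
    rw [TensorProduct.smul_tmul', h1]
    rfl
  let Ψ : ∀ x : Index a b c, SymBox K (a + b - x.1.1 - x.1.2.1)
      (a - x.1.1 + x.1.2.1 + c - 2 * x.1.2.2) →ₗ[K] V ⊗[K] SymPow K (Fin 2 → K) c :=
    fun x => T (indexEquiv a b c x).1 ∘ₗ C (indexEquiv a b c x).1 (indexEquiv a b c x).2
  have hΨ : ∀ x h ξ η, iotaW π c h (Ψ x (pw _ ξ ⊗ₜ pw _ η)) =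
      ((H.mu K h : Kˣ) : K) ^ (x.1.2.2 + x.1.1) •
        Ψ x (pw _ (std K (H.pr₁ K h) ξ) ⊗ₜ pw _ (std K (H.pr₂ K h) η)) := by
    intro x h ξ η
    have h1 := hT (indexEquiv a b c x).1 h
      (C (indexEquiv a b c x).1 (indexEquiv a b c x).2 (pw _ ξ ⊗ₜ pw _ η))
    rw [hC, LinearMap.map_smul, smul_smul, ← pow_add] at h1
    rw [add_comm x.1.2.2]
    exact h1
  have hΨs : Function.Surjective (DirectSum.toModule K _ _ Ψ) := by
    rw [← LinearMap.range_eq_top, eq_top_iff]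
    set N := LinearMap.range (DirectSum.toModule K _ _ Ψ)
    have h1 : ∀ i z, T i z ∈ N := by
      intro i z
      obtain ⟨w, rfl⟩ := hsurj i z
      refine toModule_mem (C i) (N.comap (T i)) (fun j y => ?_) w
      exact apply_mem_range_toModule Ψ ((indexEquiv a b c).symm ⟨i, j⟩) y
    intro z _
    induction z using TensorProduct.induction_on with
    | zero => exact N.zero_mem
    | add x y hx hy => exact N.add_mem (hx trivial) (hy trivial)
    | tmul v w =>
      obtain ⟨y, rfl⟩ := hbij.2 v
      exact toModule_mem Φ (N.comap ((TensorProduct.mk K V _).flip w))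
        (fun i y => h1 i (y ⊗ₜ w)) y
  -- surjectivity is inherited from the two steps, and injectivity follows by counting dimensions
  have hfin : Module.finrank K (⨁ x : Index a b c, SymBox K (a + b - x.1.1 - x.1.2.1)
      (a - x.1.1 + x.1.2.1 + c - 2 * x.1.2.2)) =
      Module.finrank K (V ⊗[K] SymPow K (Fin 2 → K) c) := by
    rw [finrank_sum_symBox, Module.finrank_tensorProduct,
      ← (LinearEquiv.ofBijective _ hbij).finrank_eq, finrank_sum_symBox, finrank_symPow,
      Finset.sum_mul, ← (indexEquiv a b c).symm.sum_comp, Fintype.sum_sigma]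
    refine Finset.sum_congr rfl fun i _ => ?_
    rw [mul_assoc, ← sum_clebschGordan_min, Finset.mul_sum]
    rfl
  have hΨb : Function.Bijective (DirectSum.toModule K _ _ Ψ) :=
    ⟨(injective_iff_surjective_of_finrank_eq _ hfin).2 hΨs, hΨs⟩
  exact ⟨(Representation.Equiv.mk (LinearEquiv.ofBijective _ hΨb) fun h =>
    toModule_comp_irrSum _ _ _ (iotaW π c) Ψ hΨ h).symm⟩

end Branching

end GSpBranching

end

theorem mainTheorem11 {K : Type*} [Field K] [CharZero K] (a b c : ℕ) :
    -- `V^{a,b}` exists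
    (∃ (n : ℕ) (π : Representation K (GSpBranching.GSp4 K) (Fin n → K)),
      GSpBranching.IsV a b π) ∧
    -- the branching law and its corollary, for every model of `V^{a,b}`
    ∀ {V : Type*} [AddCommGroup V] [Module K V]
      (π : Representation K (GSpBranching.GSp4 K) V), GSpBranching.IsV a b π →
      Nonempty ((GSpBranching.iotaW π c).Equiv
        (Representation.directSum (GSpBranching.summand K a b c))) ∧
      ((∃ (S : Subrepresentation (GSpBranching.iotaW π c)) (d : ℕ) (e : ℤ),
          GSpBranching.IsSymBoxOne S d e) ↔ c ≤ a + b) ∧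
      (c ≤ a + b → ∀ (d : ℕ) (e : ℤ),
        ((∃ S : Subrepresentation (GSpBranching.iotaW π c), GSpBranching.IsSymBoxOne S d e) ↔
          ∃ r : ℤ, max 0 (-(a : ℤ) + c) ≤ r ∧ r ≤ min (b : ℤ) c ∧
            (d : ℤ) = b + c - 2 * r ∧ e = a + r) ∧
        ∀ S S' : Subrepresentation (GSpBranching.iotaW π c),
          GSpBranching.IsSymBoxOne S d e → GSpBranching.IsSymBoxOne S' d e → S = S') := by
  refine ⟨GSpBranching.exists_isV a b, fun {V} _ _ π hπ => ?_⟩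
  obtain ⟨Θ⟩ := GSpBranching.nonempty_equiv_irrSum hπ c
  -- a constituent with trivial second factor has `j = c = a - q + r`, so its twist determines it
  have hinj : ∀ x y : GSpBranching.Index a b c,
      a - x.1.1 + x.1.2.1 + c - 2 * x.1.2.2 = 0 → a - y.1.1 + y.1.2.1 + c - 2 * y.1.2.2 = 0 →
      x.1.2.2 + x.1.1 = y.1.2.2 + y.1.1 → x = y := by
    rintro ⟨⟨q, r, j⟩, h1, h2, h3⟩ ⟨⟨q', r', j'⟩, h1', h2', h3'⟩ h4 h5 h6
    have e : q = q' ∧ r = r' ∧ j = j' := by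
      clear Θ
      replace h1 : q ≤ a := h1
      replace h1' : q' ≤ a := h1'
      replace h3 : j ≤ min (a - q + r) c := h3
      replace h3' : j' ≤ min (a - q' + r') c := h3'
      dsimp only at h4 h5 h6
      omega
    obtain ⟨rfl, rfl, rfl⟩ := e
    rfl
  have hiff : ∀ (d : ℕ) (e : ℤ),
      (∃ S : Subrepresentation (GSpBranching.iotaW π c), GSpBranching.IsSymBoxOne S d e) ↔
        ∃ r : ℤ, max 0 (-(a : ℤ) + c) ≤ r ∧ r ≤ min (b : ℤ) c ∧
          (d : ℤ) = b + c - 2 * r ∧ e = a + r := by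
    intro d e
    constructor
    · rintro ⟨S, hS⟩
      obtain ⟨⟨⟨q, r, j⟩, h1, h2, h3⟩, h4, h5, h6, -⟩ :=
        GSpBranching.exists_index_of_isSymBoxOne Θ hS hinj
      dsimp only at h1 h2 h3 h4 h5 h6
      exact ⟨r, by omega, by omega, by omega, by omega⟩
    · rintro ⟨r, h1, h2, h3, h4⟩
      lift r to ℕ using by omega
      -- the constituent with invariants `q = a + r - c`, `r` and `j = c`
      obtain ⟨q, hq⟩ : ∃ q : ℕ, q + c = a + r := ⟨a + r - c, by omega⟩
      have hr := GSpBranching.exists_isSymBoxOne Θ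
        (i := ⟨(q, r, c), by dsimp only; omega, by dsimp only; omega, by dsimp only; omega⟩)
        (by dsimp only; omega)
      dsimp only at hr
      have hd : a + b - q - r = d := by omega
      have he : ((c + q : ℕ) : ℤ) = e := by omega
      rwa [hd, he] at hr
  refine ⟨⟨Θ⟩, ⟨?_, fun hc => ?_⟩, fun _ d e => ⟨hiff d e, fun S S' hS hS' =>
    GSpBranching.isSymBoxOne_unique Θ hS hS' hinj⟩⟩
  · rintro ⟨S, d, e, hS⟩
    obtain ⟨r, h1, h2, -, -⟩ := (hiff d e).1 ⟨S, hS⟩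
    omega
  -- for `c ≤ a + b` the exponent `r = max(0, c - a)` is admissible
  · obtain ⟨S, hS⟩ := (hiff (b + c - 2 * (c - a)) (a + (c - a : ℕ))).2
      ⟨(c - a : ℕ), by omega, by omega, by omega, rfl⟩
    exact ⟨S, _, _, hS⟩
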